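/- Let $n\ge 2$ and let $V:(0,+\infty)\to\mathbb R$ be a smooth convex function. Let $\mu$ be a probability measure on $\mathbb R^n$ whose Lebesgue density is proportional to $x\mapsto e^{-V(\Vert x\Vert)}$. Let $\mathcal E_\mu(f,g)=\int_{\mathbb R^n}\nabla f\cdot\nabla g\,d\mu$ be the closed Dirichlet form in $L^2(\mu)$ obtained by completing $\mathcal C_0^\infty(\mathbb R^n)$ for the norm $(\Vert f\Vert_{L^2(\mu)}^2+\mathcal E_\mu(f,f))^{1/2}$, and let $-\mathcal L_\mu$ be the associated non-negative self-adjoint operator: $f$ is in its domain and $-\mathcal L_\mu f=h$ if and only if $f$ is in the form domain, $h\in L^2(\mu)$, and $\mathcal E_\mu(f,g)=\int hg\,d\mu$ for all $g$ in the form domain. It is a self-adjoint realization of $-\Delta+\nabla V\cdot\nabla$: for each $f\in\mathcal C_0^\infty(\mathbb R^n)$ such that the function $$x\mapsto\Delta f(x)-\frac{V'(\Vert x\Vert)}{\Vert x\Vert}\,x\cdot\nabla f(x)$$ belongs to $L^2(\mu)$, $f$ is in the domain of $\mathcal L_\mu$ and $\mathcal L_\mu f$ is this function. Then $\int_{\mathbb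 R^n}\Vert x\Vert^2\,\mu(dx)<+\infty$, and there is a largest real number $\lambda_1(-\mathcal L_\mu)$ such that the spectrum of $-\mathcal L_\mu$ in $L^2(\mu)$ lies in $\{0\}\cup[\lambda_1(-\mathcal L_\mu),+\infty)$ (the spectral gap); it satisfies $$\frac{n-1}{\int_{\mathbb R^n}\Vert x\Vert^2\,\mu(dx)}\le\lambda_1(-\mathcal L_\mu)\le\frac{n}{\int_{\mathbb R^n}\Vert x\Vert^2\,\mu(dx)}.$$ -/

import Mathlib

open MeasureTheory Set
open scoped ContDiff InnerProductSpace

namespace RadialGap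

/-- `C_0^∞(ℝⁿ)`: smooth, compactly supported real functions. -/
structure IsTestFunction {n : ℕ} (φ : EuclideanSpace ℝ (Fin n) → ℝ) : Prop where
  smooth : ContDiff ℝ ∞ φ
  compact : HasCompactSupport φ

/-- The differential expression `L f (x) = Δ f (x) - (V'(‖x‖) / ‖x‖) x · ∇ f (x)`. -/
noncomputable def diffusionExpr {n : ℕ} (V : ℝ → ℝ) (f : EuclideanSpace ℝ (Fin n) → ℝ)
    (x : EuclideanSpace ℝ (Fin n)) : ℝ :=
  Laplacian.laplacian f x - deriv V ‖x‖ / ‖x‖ * ⟪x, gradient f x⟫_ℝ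

theorem gradient_add' {n : ℕ} {φ ψ : EuclideanSpace ℝ (Fin n) → ℝ} (hφ : IsTestFunction φ)
    (hψ : IsTestFunction ψ) : gradient (φ + ψ) = gradient φ + gradient ψ := by
  funext x
  have h1 := hφ.smooth.differentiable (by simp) x
  have h2 := hψ.smooth.differentiable (by simp) x
  simp only [gradient, Pi.add_apply]
  rw [fderiv_add h1 h2, map_add]

theorem gradient_smul' {n : ℕ} {φ : EuclideanSpace ℝ (Fin n) → ℝ} (hφ : IsTestFunction φ)
    (c : ℝ) : gradient (c • φ) = c • gradient φ := by
  funext x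
  have h1 := hφ.smooth.differentiable (by simp) x
  simp only [gradient, Pi.smul_apply]
  rw [fderiv_const_smul h1, map_smulₛₗ]
  simp

/-- The pairs `(φ, ∇φ)`, `φ ∈ C_0^∞(ℝⁿ)`, as elements of `L²(μ) × L²(μ; ℝⁿ)`. -/
noncomputable def testGradientGraph {n : ℕ} (μ : Measure (EuclideanSpace ℝ (Fin n))) :
    Submodule ℝ (Lp ℝ 2 μ × Lp (EuclideanSpace ℝ (Fin n)) 2 μ) where
  carrier := {p | ∃ φ, IsTestFunction φ ∧ p.1 =ᵐ[μ] φ ∧ p.2 =ᵐ[μ] gradient φ}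
  zero_mem' := by
    refine ⟨0, ⟨contDiff_const, HasCompactSupport.zero⟩, Lp.coeFn_zero _ _ _, ?_⟩
    refine (Lp.coeFn_zero _ _ _).trans (Filter.EventuallyEq.of_eq ?_)
    funext x
    simp [gradient, Pi.zero_def]
  add_mem' := by
    rintro p q ⟨φ, hφ, h1, h2⟩ ⟨ψ, hψ, h3, h4⟩
    refine ⟨φ + ψ, ⟨hφ.smooth.add hψ.smooth, hφ.compact.add hψ.compact⟩,
      (Lp.coeFn_add _ _).trans (h1.add h3), ?_⟩
    rw [gradient_add' hφ hψ]
    exact (Lp.coeFn_add _ _).trans (h2.add h4)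
  smul_mem' := by
    rintro c p ⟨φ, hφ, h1, h2⟩
    refine ⟨c • φ, ⟨hφ.smooth.const_smul c, hφ.compact.smul_left⟩,
      (Lp.coeFn_smul c _).trans (h1.const_smul c), ?_⟩
    rw [gradient_smul' hφ c]
    exact (Lp.coeFn_smul c _).trans (h2.const_smul c)

/-- The closed Dirichlet form of `μ`: the pairs `(f, ∇f)` with `f` in the form domain, that is, in
the completion of `C_0^∞(ℝⁿ)` for the norm `(‖f‖² + ∫ ‖∇f‖² dμ) ^ (1/2)`. -/
noncomputable def formGraph {n : ℕ} (μ : Measure (EuclideanSpace ℝ (Fin n))) :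
    Submodule ℝ (Lp ℝ 2 μ × Lp (EuclideanSpace ℝ (Fin n)) 2 μ) :=
  (testGradientGraph μ).topologicalClosure

/-- The graph of the self-adjoint operator associated with the closed Dirichlet form: the pairs
`(f, h)` with `f` in the form domain, `h ∈ L²(μ)` and `∫ ∇f · ∇g dμ = ∫ h g dμ` for every `g` in the
form domain. -/
noncomputable def generatorGraph {n : ℕ} (μ : Measure (EuclideanSpace ℝ (Fin n))) :
    Submodule ℝ (Lp ℝ 2 μ × Lp ℝ 2 μ) where
  carrier := {p | ∃ G : Lp (EuclideanSpace ℝ (Fin n)) 2 μ, (p.1, G) ∈ formGraph μ ∧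
    ∀ q ∈ formGraph μ, ⟪G, q.2⟫_ℝ = ⟪p.2, q.1⟫_ℝ}
  zero_mem' := ⟨0, (formGraph μ).zero_mem, fun q _ => by simp⟩
  add_mem' := by
    rintro p p' ⟨G, hG, h⟩ ⟨G', hG', h'⟩
    refine ⟨G + G', (formGraph μ).add_mem hG hG', fun q hq => ?_⟩
    rw [Prod.snd_add, inner_add_left, inner_add_left, h q hq, h' q hq]
  smul_mem' := by
    rintro c p ⟨G, hG, h⟩
    refine ⟨c • G, (formGraph μ).smul_mem c hG, fun q hq => ?_⟩
    rw [Prod.smul_snd, real_inner_smul_left, real_inner_smul_left, h q hq]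

/-- `generatorGraph μ` is single-valued, so it is the graph of an operator. -/
theorem generatorGraph_single_valued {n : ℕ} (μ : Measure (EuclideanSpace ℝ (Fin n)))
    [IsFiniteMeasure μ] (p : Lp ℝ 2 μ × Lp ℝ 2 μ) (hp : p ∈ generatorGraph μ) (h0 : p.1 = 0) :
    p.2 = 0 := by
  obtain ⟨G, hG, h⟩ := hp
  have hG0 : G = 0 := by
    have := h _ hG
    simpa [h0] using this
  have hd := Lp.dense_hasCompactSupport_contDiff (F := ℝ) (μ := μ) (p := 2) (by simp)
  refine hd.eq_zero_of_inner_left ℝ (fun v hv => ?_)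
  obtain ⟨φ, h1, h2, h3⟩ := hv
  have hφ : IsTestFunction φ := ⟨h3, h2⟩
  have hc : Continuous (gradient φ) :=
    (InnerProductSpace.toDual ℝ (EuclideanSpace ℝ (Fin n))).symm.continuous.comp
      (h3.continuous_fderiv (by simp))
  have hs : HasCompactSupport (gradient φ) :=
    (h2.fderiv (𝕜 := ℝ)).comp_left
      (g := (InnerProductSpace.toDual ℝ (EuclideanSpace ℝ (Fin n))).symm) (by simp)
  have hm : MemLp (gradient φ) 2 μ := hc.memLp_of_hasCompactSupport hs
  have hq : (v, hm.toLp) ∈ formGraph μ :=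
    Submodule.le_topologicalClosure _ ⟨φ, hφ, h1, hm.coeFn_toLp⟩
  have := h _ hq
  simpa [hG0] using this.symm

/-- The non-negative self-adjoint operator `-L_μ` in `L²(μ)`. -/
noncomputable def negGenerator {n : ℕ} (μ : Measure (EuclideanSpace ℝ (Fin n))) :
    Lp ℝ 2 μ →ₗ.[ℝ] Lp ℝ 2 μ :=
  (generatorGraph μ).toLinearPMap

/-- The spectrum of a closed unbounded operator `A`: those `t` for which `A - t` is not a bijection
from the domain of `A` onto the whole space (when it is one, its inverse is automatically bounded,
by the closed graph theorem). -/
def opSpectrum {H : Type*} [NormedAddCommGroup H] [InnerProductSpace ℝ H]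
    (A : H →ₗ.[ℝ] H) : Set ℝ :=
  {t | ¬ Function.Bijective (fun f : A.domain => A f - t • (f : H))}

/-- `l` is the largest real `t` such that the spectrum of `A` lies in `{0} ∪ [t, +∞)`. -/
def IsSpectralGap {H : Type*} [NormedAddCommGroup H] [InnerProductSpace ℝ H]
    (A : H →ₗ.[ℝ] H) (l : ℝ) : Prop :=
  IsGreatest {t : ℝ | opSpectrum A ⊆ {0} ∪ Ici t} l

end RadialGap

/-! The upper bound tests the form on the coordinate functions. Each has mean zero by symmetry and a
gradient of norm one, so the gap `l` satisfies `l ∫ x_i² dμ ≤ 1`; summing over `i` gives the claim.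

The lower bound is a Poincaré inequality, proved first for functions supported in an annulus. Put
`w(r) = r^(n-1) e^{-V(r)}`, `N = n - 1` and `A = N ∫ w / ∫ r² w`. In polar coordinates `f` splits
into its spherical mean `m(r)` and the fluctuation `f - m`. The mean obeys a Poincaré inequality for
`w` on the half-line with constant `A`. On each ray the fluctuation obeys the Hardy-type inequality
`A ∫ h² w ≤ ∫ h'² w + N ∫ (h²/r²) w`, whose last term is paid for by the Poincaré inequality on
spheres, with constant `N` (`IsAnnular.poincare`).

The two one-dimensional inequalities are proved together, in
`IsRadialWeight.hardyIneq_and_poincareIneq`. Let `q = -w'/w`, so that `q' = V'' + N/r²`. A mean-zero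
`g` can be written `g = q h - h'`, and integration by parts gives `∫ g² w = ∫ h'² w + ∫ q' h² w` and
`∫ g² w = ∫ g' h w`. If `q' ≥ ε + N/r²`, a Hardy inequality with constant `B` makes the first
expression at least `(B + ε) ∫ h² w`, and by duality a Poincaré inequality with constant `B + ε`
follows: convexity gains `ε`. Conversely, Poincaré with a constant `B ≤ A` implies Hardy with the
same `B`, because `(∫ h w)² ≤ ∫ (h²/r²) w · ∫ r² w`. Starting from `B = 0`, finitely many turns
reach `A`. Adding `ε r²/2` to `V` supplies the gain, and then `ε → 0`.

The sphere inequality follows from the Gaussian one applied to `x ↦ ‖x‖ g(x/‖x‖)`; the Gaussian one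
is proved by interpolating between two independent copies through rotations.

Annular functions suffice because `n ≥ 2` gives `w = O(r)` at the origin, so logarithmic cutoffs
have vanishing energy. The same cutoffs put the constants and the coordinates into the form domain,
and identify the generator through Green's formula away from the origin. Finally,
`RadialGap.exists_isSpectralGap` shows for an abstract closed form that the infimum of the energy on
the orthogonal complement of the ground state is the spectral gap: below it Lax–Milgram inverts the
operator, and at it almost-minimisers are incompatible with a bounded inverse. -/

namespace RadialGap
open Filter Topology

/-! ### Functions on `(0, ∞)` with compact support -/

/-- `F` vanishes on `(0, ∞)` outside a compact subinterval of `(0, ∞)`. -/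
def IsCompactlySupportedIoi (F : ℝ → ℝ) : Prop :=
  ∃ a b : ℝ, 0 < a ∧ a < b ∧ ∀ r, 0 < r → r ∉ Icc a b → F r = 0

theorem IsCompactlySupportedIoi.mono {F G : ℝ → ℝ} (hF : IsCompactlySupportedIoi F)
    (h : ∀ r, 0 < r → F r = 0 → G r = 0) : IsCompactlySupportedIoi G := by
  obtain ⟨a, b, ha, hab, hz⟩ := hF
  exact ⟨a, b, ha, hab, fun r hr hr' => h r hr (hz r hr hr')⟩

theorem IsCompactlySupportedIoi.union {F G H : ℝ → ℝ} (hF : IsCompactlySupportedIoi F)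
    (hG : IsCompactlySupportedIoi G) (h : ∀ r, 0 < r → F r = 0 → G r = 0 → H r = 0) :
    IsCompactlySupportedIoi H := by
  obtain ⟨a, b, ha, hab, hz⟩ := hF
  obtain ⟨c, d, hc, hcd, hz'⟩ := hG
  refine ⟨min a c, max b d, lt_min ha hc, (min_le_left _ _).trans_lt
    (hab.trans_le (le_max_left _ _)), fun r hr hr' => h r hr (hz r hr ?_) (hz' r hr ?_)⟩
  · exact fun hm => hr' ⟨(min_le_left _ _).trans hm.1, hm.2.trans (le_max_left _ _)⟩
  · exact fun hm => hr' ⟨(min_le_right _ _).trans hm.1, hm.2.trans (le_max_right _ _)⟩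

theorem integrableOn_Ioi_of_compactlySupported {F : ℝ → ℝ} (hc : ContinuousOn F (Ioi 0))
    (hF : IsCompactlySupportedIoi F) : IntegrableOn F (Ioi 0) := by
  obtain ⟨a, b, ha, hab, hz⟩ := hF
  have h1 : IntegrableOn F (Icc a b) :=
    (hc.mono fun x hx => ha.trans_le hx.1).integrableOn_compact isCompact_Icc
  exact h1.of_forall_sdiff_eq_zero measurableSet_Ioi fun x hx => hz x hx.1 hx.2

/-- All integrations by parts on the half-line reduce to this: compact support in the open half-line
removes the boundary terms. -/
theorem integral_Ioi_deriv_eq_zero {F F' : ℝ → ℝ} (hd : ∀ r, 0 < r → HasDerivAt F (F' r) r)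
    (hc : ContinuousOn F' (Ioi 0)) (hF : IsCompactlySupportedIoi F) :
    ∫ r in Ioi 0, F' r = 0 := by
  obtain ⟨a, b, ha, hab, hz⟩ := hF
  have hz' : ∀ r, 0 < r → r ∉ Icc a b → F' r = 0 := by
    intro r hr hr'
    have : F =ᶠ[𝓝 r] fun _ => 0 := by
      filter_upwards [isClosed_Icc.isOpen_compl.mem_nhds hr', lt_mem_nhds hr] with x hx hx'
      exact hz x hx' hx
    exact (hd r hr).unique ((hasDerivAt_const r (0 : ℝ)).congr_of_eventuallyEq this)
  -- The interval is enlarged so that its endpoints lie strictly outside `[a, b]`, where `F` is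
  -- known to vanish.
  have hsub : Ioc (a / 2) (b + 1) ⊆ Ioi 0 := fun x hx => lt_trans (by positivity) hx.1
  rw [setIntegral_eq_of_subset_of_forall_sdiff_eq_zero measurableSet_Ioi hsub]
  · rw [← intervalIntegral.integral_of_le (by linarith)]
    have hu : uIcc (a / 2) (b + 1) ⊆ Ioi 0 := by
      rw [uIcc_of_le (by linarith)]
      exact fun x hx => lt_of_lt_of_le (by positivity) hx.1
    rw [intervalIntegral.integral_eq_sub_of_hasDerivAt (f := F) (fun x hx => hd x (hu hx))
      (hc.mono hu).intervalIntegrable, hz _ (by linarith) (fun h => by linarith [h.2]),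
      hz _ (by linarith) (fun h => by linarith [h.1]), sub_zero]
  · rintro x ⟨hx, hx'⟩
    refine hz' x hx fun h => hx' ⟨by linarith [h.1], by linarith [h.2]⟩

/-- `g` is continuously differentiable on `(0, ∞)` with derivative `g'` and has compact support
there. -/
structure IsRadialTest (g g' : ℝ → ℝ) : Prop where
  hasDeriv : ∀ r, 0 < r → HasDerivAt g (g' r) r
  cont' : ContinuousOn g' (Ioi 0)
  supp : IsCompactlySupportedIoi g

namespace IsRadialTest

variable {g g' h h' : ℝ → ℝ}

theorem cont (hg : IsRadialTest g g') : ContinuousOn g (Ioi 0) :=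
  fun r hr => (hg.hasDeriv r hr).continuousAt.continuousWithinAt

theorem supp' (hg : IsRadialTest g g') : IsCompactlySupportedIoi g' := by
  obtain ⟨a, b, ha, hab, hz⟩ := hg.supp
  refine ⟨a, b, ha, hab, fun r hr hr' => ?_⟩
  have : g =ᶠ[𝓝 r] fun _ => 0 := by
    filter_upwards [isClosed_Icc.isOpen_compl.mem_nhds hr', lt_mem_nhds hr] with x hx hx'
    exact hz x hx' hx
  exact (hg.hasDeriv r hr).unique ((hasDerivAt_const r (0 : ℝ)).congr_of_eventuallyEq this)

theorem sub (hg : IsRadialTest g g') (hh : IsRadialTest h h') :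
    IsRadialTest (fun r => g r - h r) (fun r => g' r - h' r) where
  hasDeriv r hr := (hg.hasDeriv r hr).sub (hh.hasDeriv r hr)
  cont' := hg.cont'.sub hh.cont'
  supp := hg.supp.union hh.supp fun r _ h1 h2 => by simp [h1, h2]

theorem const_mul (hg : IsRadialTest g g') (c : ℝ) :
    IsRadialTest (fun r => c * g r) (fun r => c * g' r) where
  hasDeriv r hr := (hg.hasDeriv r hr).const_mul c
  cont' := hg.cont'.const_smul c
  supp := hg.supp.mono fun r _ h1 => by simp [h1]

end IsRadialTest

/-! ### Logarithmic cutoffs -/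

/-- A cutoff on `(0, ∞)`, equal to `1` where `|log r| ≤ k + 1`, to `0` where
`|log r| ≥ √2 (k + 1)`. -/
noncomputable def logCutoff (k : ℕ) (r : ℝ) : ℝ :=
  Real.smoothTransition (2 - (Real.log r / (k + 1)) ^ 2)

/-- The derivative of `logCutoff k`. -/
noncomputable def logCutoffDeriv (k : ℕ) (r : ℝ) : ℝ :=
  deriv Real.smoothTransition (2 - (Real.log r / (k + 1)) ^ 2) *
    (-(2 * (Real.log r / (k + 1)) * (r⁻¹ / (k + 1))))

theorem hasDerivAt_smoothTransition (x : ℝ) :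
    HasDerivAt Real.smoothTransition (deriv Real.smoothTransition x) x :=
  ((Real.smoothTransition.contDiff (n := 1)).differentiable (by simp) x).hasDerivAt

theorem continuous_deriv_smoothTransition : Continuous (deriv Real.smoothTransition) :=
  (Real.smoothTransition.contDiff (n := 1)).continuous_deriv (by simp)

theorem deriv_smoothTransition_of_neg {x : ℝ} (hx : x < 0) :
    deriv Real.smoothTransition x = 0 := by
  have : Real.smoothTransition =ᶠ[𝓝 x] fun _ => 0 := by
    filter_upwards [gt_mem_nhds hx] with y hy using Real.smoothTransition.zero_of_nonpos hy.le
  rw [this.deriv_eq, deriv_const]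

theorem deriv_smoothTransition_of_one_lt {x : ℝ} (hx : 1 < x) :
    deriv Real.smoothTransition x = 0 := by
  have : Real.smoothTransition =ᶠ[𝓝 x] fun _ => 1 := by
    filter_upwards [lt_mem_nhds hx] with y hy using Real.smoothTransition.one_of_one_le hy.le
  rw [this.deriv_eq, deriv_const]

theorem exists_abs_deriv_smoothTransition_le :
    ∃ C, 0 ≤ C ∧ ∀ x, |deriv Real.smoothTransition x| ≤ C := by
  obtain ⟨C, hC⟩ := (isCompact_Icc (a := (0 : ℝ)) (b := 1)).exists_bound_of_continuousOn
    continuous_deriv_smoothTransition.continuousOn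
  refine ⟨C, (norm_nonneg _).trans (hC 0 (by simp)), fun x => ?_⟩
  by_cases hx : x ∈ Icc (0 : ℝ) 1
  · exact hC x hx
  · rw [mem_Icc, not_and_or, not_le, not_le] at hx
    have : deriv Real.smoothTransition x = 0 :=
      hx.elim deriv_smoothTransition_of_neg deriv_smoothTransition_of_one_lt
    rw [this, abs_zero]
    exact (norm_nonneg _).trans (hC 0 (by simp))

theorem hasDerivAt_logCutoff (k : ℕ) {r : ℝ} (hr : 0 < r) :
    HasDerivAt (logCutoff k) (logCutoffDeriv k r) r := by
  have h1 : HasDerivAt (fun r => 2 - (Real.log r / ((k : ℝ) + 1)) ^ 2)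
      (-(2 * (Real.log r / (k + 1)) * (r⁻¹ / (k + 1)))) r := by
    have := (((Real.hasDerivAt_log hr.ne').div_const ((k : ℝ) + 1)).pow 2).const_sub 2
    simpa using this
  exact (hasDerivAt_smoothTransition _).comp r h1

theorem continuousOn_logCutoffDeriv (k : ℕ) : ContinuousOn (logCutoffDeriv k) (Ioi 0) := by
  have hl : ContinuousOn Real.log (Ioi 0) :=
    Real.continuousOn_log.mono fun x hx => ne_of_gt hx
  refine ContinuousOn.mul (continuous_deriv_smoothTransition.comp_continuousOn ?_) ?_
  · exact continuousOn_const.sub ((hl.div_const _).pow 2)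
  · refine ((continuousOn_const.mul (hl.div_const _)).mul
      (ContinuousOn.div_const ?_ _)).neg
    exact continuousOn_inv₀.mono fun x hx => ne_of_gt hx

/-- The cutoff already vanishes once `|log r| ≥ √2 (k + 1)`; the bound `2 (k + 1)` is cruder but
avoids the square root and leaves strict room for the derivative. -/
theorem two_lt_sq_of_notMem {k : ℕ} {r : ℝ} (hr : 0 < r)
    (h : r ∉ Icc (Real.exp (-(2 * (k + 1)))) (Real.exp (2 * (k + 1)))) :
    2 < (Real.log r / (k + 1)) ^ 2 := by
  have hk : (0 : ℝ) < k + 1 := by positivity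
  rw [mem_Icc, not_and_or, not_le, not_le] at h
  rcases h with h | h
  · have : Real.log r < -(2 * (k + 1)) := by rwa [Real.log_lt_iff_lt_exp hr]
    have : Real.log r / (k + 1) < -2 := by rw [div_lt_iff₀ hk]; linarith
    nlinarith
  · have : 2 * ((k : ℝ) + 1) < Real.log r := by rwa [Real.lt_log_iff_exp_lt hr]
    have : 2 < Real.log r / (k + 1) := by rw [lt_div_iff₀ hk]; linarith
    nlinarith

theorem logCutoff_eq_zero {k : ℕ} {r : ℝ} (hr : 0 < r)
    (h : r ∉ Icc (Real.exp (-(2 * (k + 1)))) (Real.exp (2 * (k + 1)))) :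
    logCutoff k r = 0 :=
  Real.smoothTransition.zero_of_nonpos (by linarith [two_lt_sq_of_notMem hr h])

theorem logCutoffDeriv_eq_zero {k : ℕ} {r : ℝ} (hr : 0 < r)
    (h : r ∉ Icc (Real.exp (-(2 * (k + 1)))) (Real.exp (2 * (k + 1)))) :
    logCutoffDeriv k r = 0 := by
  rw [logCutoffDeriv, deriv_smoothTransition_of_neg (by linarith [two_lt_sq_of_notMem hr h]),
    zero_mul]

theorem isRadialTest_logCutoff (k : ℕ) : IsRadialTest (logCutoff k) (logCutoffDeriv k) where
  hasDeriv _ hr := hasDerivAt_logCutoff k hr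
  cont' := continuousOn_logCutoffDeriv k
  supp := ⟨_, _, Real.exp_pos _, Real.exp_lt_exp.2 (by linarith [(k.cast_nonneg : (0 : ℝ) ≤ k)]),
    fun _ hr h => logCutoff_eq_zero hr h⟩

theorem logCutoff_nonneg (k : ℕ) (r : ℝ) : 0 ≤ logCutoff k r := Real.smoothTransition.nonneg _

theorem logCutoff_le_one (k : ℕ) (r : ℝ) : logCutoff k r ≤ 1 := Real.smoothTransition.le_one _

theorem abs_logCutoff_le_one (k : ℕ) (r : ℝ) : |logCutoff k r| ≤ 1 := by
  rw [abs_of_nonneg (logCutoff_nonneg k r)]; exact logCutoff_le_one k r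

theorem eventually_abs_log_div_lt (r : ℝ) :
    ∀ᶠ k : ℕ in atTop, (Real.log r / ((k : ℝ) + 1)) ^ 2 < 1 := by
  have h : Tendsto (fun k : ℕ => (Real.log r / ((k : ℝ) + 1)) ^ 2) atTop (𝓝 0) := by
    have := (tendsto_const_div_atTop_nhds_zero_nat (Real.log r)).comp (tendsto_add_atTop_nat 1)
    simpa using this.pow 2
  exact h.eventually (gt_mem_nhds one_pos)

theorem eventually_logCutoff_eq_one (r : ℝ) : ∀ᶠ k : ℕ in atTop, logCutoff k r = 1 := by
  filter_upwards [eventually_abs_log_div_lt r] with k hk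
  exact Real.smoothTransition.one_of_one_le (by linarith)

theorem eventually_logCutoffDeriv_eq_zero (r : ℝ) :
    ∀ᶠ k : ℕ in atTop, logCutoffDeriv k r = 0 := by
  filter_upwards [eventually_abs_log_div_lt r] with k hk
  rw [logCutoffDeriv, deriv_smoothTransition_of_one_lt (by linarith), zero_mul]

theorem exists_abs_logCutoffDeriv_le :
    ∃ C, 0 ≤ C ∧ ∀ (k : ℕ) (r : ℝ), 0 < r → |logCutoffDeriv k r| ≤ C / (k + 1) / r := by
  obtain ⟨C, hC0, hC⟩ := exists_abs_deriv_smoothTransition_le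
  -- The factor 4 is 2 from differentiating the square times the bound `|log r| / (k + 1) ≤ 2` on
  -- the support.
  refine ⟨C * 4, by positivity, fun k r hr => ?_⟩
  have hk : (0 : ℝ) < k + 1 := by positivity
  by_cases h : r ∈ Icc (Real.exp (-(2 * (k + 1)))) (Real.exp (2 * (k + 1)))
  · have h1 : |Real.log r / (k + 1)| ≤ 2 := by
      rw [abs_div, abs_of_pos hk, div_le_iff₀ hk, abs_le]
      constructor
      · exact (Real.le_log_iff_exp_le hr).2 h.1
      · exact (Real.log_le_iff_le_exp hr).2 h.2
    rw [logCutoffDeriv, abs_mul, abs_neg, abs_mul, abs_mul, abs_two,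
      abs_of_pos (show (0 : ℝ) < r⁻¹ / (k + 1) by positivity)]
    calc _ ≤ C * (2 * 2 * (r⁻¹ / (k + 1))) := by gcongr; exact hC _
      _ = _ := by field_simp; ring
  · rw [logCutoffDeriv_eq_zero hr h, abs_zero]
    positivity

/-- The logarithmic cutoffs have vanishing energy for weights that are `O(r)` at the origin. -/
theorem tendsto_integral_logCutoffDeriv_sq {w : ℝ → ℝ} (hw0 : ∀ r, 0 < r → 0 ≤ w r)
    (hwc : ContinuousOn w (Ioi 0)) (hwi : IntegrableOn w (Ioi 0))
    {M : ℝ} (hM : ∀ r, 0 < r → r ≤ 1 → w r ≤ M * r) :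
    Tendsto (fun k => ∫ r in Ioi 0, logCutoffDeriv k r ^ 2 * (1 + r ^ 2) * w r) atTop (𝓝 0) := by
  obtain ⟨C, hC0, hC⟩ := exists_abs_logCutoffDeriv_le
  have hM0 : 0 ≤ M := by have := hM 1 one_pos le_rfl; have := hw0 1 one_pos; linarith
  -- Up to `C² / (k + 1)²` the integrand is at most `w / r² + w`. Below 1 the first term is at most
  -- `M / r`, whose integral from `e^{-2(k+1)}` to 1 is `2 M (k + 1)`; beyond 1 it is at most `w`.
  -- The total is `O(1 / (k + 1))`.
  have key : ∀ k : ℕ, ∫ r in Ioi 0, logCutoffDeriv k r ^ 2 * (1 + r ^ 2) * w r ≤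
      C ^ 2 / (k + 1) ^ 2 * (2 * M * (k + 1) + 2 * ∫ r in Ioi 0, w r) := by
    intro k
    have hk : (0 : ℝ) < k + 1 := by positivity
    set a := Real.exp (-(2 * ((k : ℝ) + 1))) with ha
    have ha0 : 0 < a := Real.exp_pos _
    have ha1 : a ≤ 1 := Real.exp_le_one_iff.2 (by linarith)
    have hinv : IntegrableOn (fun r : ℝ => (Icc a 1).indicator (fun r => M * r⁻¹) r) (Ioi 0) := by
      refine (IntegrableOn.integrable_indicator ?_ measurableSet_Icc).integrableOn
      refine ContinuousOn.integrableOn_compact isCompact_Icc (continuousOn_const.mul ?_)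
      exact continuousOn_inv₀.mono fun x hx => (ha0.trans_le hx.1).ne'
    have hint : ∫ r in Ioi 0, (Icc a 1).indicator (fun r => M * r⁻¹) r = 2 * M * (k + 1) := by
      rw [setIntegral_indicator measurableSet_Icc,
        inter_eq_self_of_subset_right (show Icc a 1 ⊆ Ioi 0 from fun x hx => ha0.trans_le hx.1),
        integral_Icc_eq_integral_Ioc,
        ← intervalIntegral.integral_of_le ha1, intervalIntegral.integral_const_mul,
        integral_inv_of_pos ha0 one_pos, one_div, Real.log_inv, ha, Real.log_exp]
      ring
    calc _ ≤ ∫ r in Ioi 0, C ^ 2 / (k + 1) ^ 2 *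
          ((Icc a 1).indicator (fun r => M * r⁻¹) r + 2 * w r) := by
          refine setIntegral_mono_on ?_ ((hinv.add (hwi.const_mul 2)).const_mul _)
            measurableSet_Ioi ?_
          · refine integrableOn_Ioi_of_compactlySupported ?_ ?_
            · exact (((continuousOn_logCutoffDeriv k).pow 2).mul (by fun_prop)).mul hwc
            · exact (isRadialTest_logCutoff k).supp'.mono fun r _ h => by simp [h]
          · intro r hr
            have hr : 0 < r := hr
            have hwr := hw0 r hr
            by_cases hs : r ∈ Icc (Real.exp (-(2 * (k + 1)))) (Real.exp (2 * (k + 1)))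
            · have h1 : logCutoffDeriv k r ^ 2 ≤ (C / (k + 1) / r) ^ 2 := by
                rw [← sq_abs]; gcongr; exact hC k r hr
              have h2 : (C / (k + 1) / r) ^ 2 * (1 + r ^ 2) * w r =
                  C ^ 2 / (k + 1) ^ 2 * (w r / r ^ 2 + w r) := by
                field_simp
              refine (mul_le_mul_of_nonneg_right (mul_le_mul_of_nonneg_right h1 (by positivity))
                hwr).trans (h2.le.trans ?_)
              gcongr ?_ * ?_
              by_cases h3 : r ≤ 1
              · rw [indicator_of_mem (show r ∈ Icc a 1 from ⟨hs.1, h3⟩)]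
                have : w r / r ^ 2 ≤ M * r⁻¹ := by
                  rw [div_le_iff₀ (by positivity)]
                  calc w r ≤ M * r := hM r hr h3
                    _ = _ := by field_simp
                linarith
              · rw [indicator_of_notMem fun h => h3 h.2]
                have : w r / r ^ 2 ≤ w r := div_le_self hwr (by nlinarith)
                linarith
            · rw [logCutoffDeriv_eq_zero hr hs]
              have : 0 ≤ (Icc a 1).indicator (fun r => M * r⁻¹) r :=
                indicator_nonneg (fun x hx => mul_nonneg hM0
                  (inv_nonneg.2 (ha0.le.trans hx.1))) _
              have h4 : 0 ≤ C ^ 2 / ((k : ℝ) + 1) ^ 2 := by positivity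
              simp only [ne_eq, OfNat.ofNat_ne_zero, not_false_eq_true, zero_pow, zero_mul]
              exact mul_nonneg h4 (by linarith)
      _ = _ := by
        rw [integral_const_mul, integral_add hinv (hwi.const_mul 2), hint, integral_const_mul]
  refine squeeze_zero (fun k => setIntegral_nonneg measurableSet_Ioi fun r hr => ?_) key ?_
  · exact mul_nonneg (by positivity) (hw0 r hr)
  · have h1 : Tendsto (fun k : ℕ => 1 / ((k : ℝ) + 1)) atTop (𝓝 0) :=
      tendsto_one_div_add_atTop_nhds_zero_nat
    have h2 : Tendsto (fun k : ℕ => C ^ 2 * (2 * M) * (1 / ((k : ℝ) + 1)) +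
        C ^ 2 * (2 * ∫ r in Ioi 0, w r) * (1 / ((k : ℝ) + 1)) ^ 2) atTop (𝓝 0) := by
      simpa using (h1.const_mul (C ^ 2 * (2 * M))).add
        ((h1.pow 2).const_mul (C ^ 2 * (2 * ∫ r in Ioi 0, w r)))
    refine h2.congr fun k => ?_
    have hk : (k : ℝ) + 1 ≠ 0 := by positivity
    field_simp


/-! ### One-dimensional weighted inequalities -/

theorem integral_add_sub_eq {α : Type*} [MeasurableSpace α] {μ : Measure α} {f g h : α → ℝ}
    (hf : Integrable f μ) (hg : Integrable g μ) (hh : Integrable h μ) :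
    ∫ x, (f x + g x - h x) ∂μ = ∫ x, f x ∂μ + ∫ x, g x ∂μ - ∫ x, h x ∂μ := by
  rw [← integral_add hf hg]
  exact integral_sub (hf.add hg) hh

theorem sq_integral_mul_le {α : Type*} [MeasurableSpace α] {μ : Measure α} {f g : α → ℝ}
    (hf : Integrable (fun x => f x ^ 2) μ) (hg : Integrable (fun x => g x ^ 2) μ)
    (hfg : Integrable (fun x => f x * g x) μ) :
    (∫ x, f x * g x ∂μ) ^ 2 ≤ (∫ x, f x ^ 2 ∂μ) * ∫ x, g x ^ 2 ∂μ := by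
  have key : ∀ t : ℝ, 0 ≤ (∫ x, g x ^ 2 ∂μ) * (t * t) + (-2 * ∫ x, f x * g x ∂μ) * t +
      ∫ x, f x ^ 2 ∂μ := by
    intro t
    have h0 : 0 ≤ ∫ x, (f x - t * g x) ^ 2 ∂μ := integral_nonneg fun x => sq_nonneg _
    have h1 : ∫ x, (f x - t * g x) ^ 2 ∂μ =
        ∫ x, (f x ^ 2 + (t * t) * g x ^ 2 - (2 * t) * (f x * g x)) ∂μ := by
      congr 1; ext x; ring
    rw [h1, integral_add_sub_eq hf (hg.const_mul _) (hfg.const_mul _), integral_const_mul, integral_const_mul] at h0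
    linarith
  have := discrim_le_zero key
  rw [discrim] at this
  linarith

/-- A weight `w = e^{-U}` on `(0, ∞)` with `q = U'` and `q' = U''`. -/
structure IsRadialWeight (w q q' : ℝ → ℝ) : Prop where
  pos : ∀ r, 0 < r → 0 < w r
  hasDeriv : ∀ r, 0 < r → HasDerivAt w (-(q r * w r)) r
  hasDeriv_q : ∀ r, 0 < r → HasDerivAt q (q' r) r
  cont_q' : ContinuousOn q' (Ioi 0)
  int : IntegrableOn w (Ioi 0)
  int_sq : IntegrableOn (fun r => r ^ 2 * w r) (Ioi 0)
  bound : ∃ M, ∀ r, 0 < r → r ≤ 1 → w r ≤ M * r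

/-- The weighted Hardy-type inequality with constant `A`. -/
def HardyIneq (N : ℝ) (w : ℝ → ℝ) (A : ℝ) : Prop :=
  ∀ h h' : ℝ → ℝ, IsRadialTest h h' →
    A * ∫ r in Ioi 0, h r ^ 2 * w r ≤
      (∫ r in Ioi 0, h' r ^ 2 * w r) + N * ∫ r in Ioi 0, h r ^ 2 / r ^ 2 * w r

/-- The weighted Poincaré inequality on the half-line with constant `A`. -/
def PoincareIneq (w : ℝ → ℝ) (A : ℝ) : Prop :=
  ∀ g g' : ℝ → ℝ, IsRadialTest g g' →
    A * ((∫ r in Ioi 0, w r) * (∫ r in Ioi 0, g r ^ 2 * w r) - (∫ r in Ioi 0, g r * w r) ^ 2) ≤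
      (∫ r in Ioi 0, w r) * ∫ r in Ioi 0, g' r ^ 2 * w r

theorem setIntegral_Ioi_pos {w : ℝ → ℝ} (hw : ∀ r, 0 < r → 0 < w r)
    (hi : IntegrableOn w (Ioi 0)) : 0 < ∫ r in Ioi 0, w r := by
  rw [setIntegral_pos_iff_support_of_nonneg_ae]
  · have : Function.support w ∩ Ioi 0 = Ioi 0 :=
      inter_eq_self_of_subset_right fun r hr => (hw r hr).ne'
    rw [this]; simp
  · filter_upwards [ae_restrict_mem measurableSet_Ioi] with r hr using (hw r hr).le
  · exact hi

namespace IsRadialWeight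

variable {w q q' g g' h h' : ℝ → ℝ} {N A ε : ℝ}

theorem cont (hw : IsRadialWeight w q q') : ContinuousOn w (Ioi 0) :=
  fun r hr => (hw.hasDeriv r hr).continuousAt.continuousWithinAt

theorem cont_q (hw : IsRadialWeight w q q') : ContinuousOn q (Ioi 0) :=
  fun r hr => (hw.hasDeriv_q r hr).continuousAt.continuousWithinAt

theorem mass_pos (hw : IsRadialWeight w q q') : 0 < ∫ r in Ioi 0, w r :=
  setIntegral_Ioi_pos hw.pos hw.int

/-- A one-dimensional Bochner identity: the two integrands differ by the total derivative of `q h²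
w`. -/
theorem integral_adjoint_sq (hw : IsRadialWeight w q q') (hh : IsRadialTest h h') :
    ∫ r in Ioi 0, (q r * h r - h' r) ^ 2 * w r =
      (∫ r in Ioi 0, h' r ^ 2 * w r) + ∫ r in Ioi 0, q' r * h r ^ 2 * w r := by
  have hc := hh.cont
  have hc' := hh.cont'
  have hwc := hw.cont
  have hqc := hw.cont_q
  have hqc' := hw.cont_q'
  have hz := integral_Ioi_deriv_eq_zero (F := fun r => q r * h r ^ 2 * w r)
    (F' := fun r => (q' r * h r ^ 2 + q r * (2 * h r * h' r)) * w r +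
      q r * h r ^ 2 * (-(q r * w r)))
    (fun r hr => by
      have h2 : HasDerivAt (fun r => h r ^ 2) (2 * h r * h' r) r := by
        simpa using (hh.hasDeriv r hr).fun_pow 2
      exact ((hw.hasDeriv_q r hr).mul h2).mul (hw.hasDeriv r hr))
    (by fun_prop) (hh.supp.mono fun r _ h0 => by simp [h0])
  have i1 : IntegrableOn (fun r => (q r * h r - h' r) ^ 2 * w r) (Ioi 0) :=
    integrableOn_Ioi_of_compactlySupported (by fun_prop)
      (hh.supp.union hh.supp' fun r _ h0 h1 => by simp [h0, h1])
  have i2 : IntegrableOn (fun r => h' r ^ 2 * w r) (Ioi 0) :=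
    integrableOn_Ioi_of_compactlySupported (by fun_prop)
      (hh.supp'.mono fun r _ h0 => by simp [h0])
  have i3 : IntegrableOn (fun r => q' r * h r ^ 2 * w r) (Ioi 0) :=
    integrableOn_Ioi_of_compactlySupported (by fun_prop)
      (hh.supp.mono fun r _ h0 => by simp [h0])
  have : ∫ r in Ioi 0, (h' r ^ 2 * w r + q' r * h r ^ 2 * w r - (q r * h r - h' r) ^ 2 * w r) =
      0 := by
    refine Eq.trans ?_ hz
    congr 1; ext r; ring
  rw [integral_add_sub_eq i2 i3 i1] at this
  linarith

/-- The integrands differ by the total derivative of `g h w`, so `h ↦ q h - h'` is the adjoint of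
differentiation in `L²(w)`. -/
theorem integral_mul_adjoint (hw : IsRadialWeight w q q') (hg : IsRadialTest g g')
    (hh : IsRadialTest h h') :
    ∫ r in Ioi 0, g r * (q r * h r - h' r) * w r = ∫ r in Ioi 0, g' r * h r * w r := by
  have hc := hh.cont
  have hc' := hh.cont'
  have gc := hg.cont
  have gc' := hg.cont'
  have hwc := hw.cont
  have hqc := hw.cont_q
  have hz := integral_Ioi_deriv_eq_zero (F := fun r => g r * h r * w r)
    (F' := fun r => (g' r * h r + g r * h' r) * w r + g r * h r * (-(q r * w r)))
    (fun r hr => ((hg.hasDeriv r hr).mul (hh.hasDeriv r hr)).mul (hw.hasDeriv r hr))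
    (by fun_prop) (hh.supp.mono fun r _ h0 => by simp [h0])
  have i1 : IntegrableOn (fun r => g r * (q r * h r - h' r) * w r) (Ioi 0) :=
    integrableOn_Ioi_of_compactlySupported (by fun_prop)
      (hg.supp.mono fun r _ h0 => by simp [h0])
  have i2 : IntegrableOn (fun r => g' r * h r * w r) (Ioi 0) :=
    integrableOn_Ioi_of_compactlySupported (by fun_prop)
      (hg.supp'.mono fun r _ h0 => by simp [h0])
  have : ∫ r in Ioi 0, (g' r * h r * w r - g r * (q r * h r - h' r) * w r) = 0 := by
    refine Eq.trans ?_ hz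
    congr 1; ext r; ring
  rw [integral_sub i2 i1] at this
  linarith

/-- The adjoint derivative `h ↦ q h - h'` maps onto the mean-zero functions. -/
theorem exists_adjoint_eq (hw : IsRadialWeight w q q') (hg : IsRadialTest g g')
    (h0 : ∫ r in Ioi 0, g r * w r = 0) :
    ∃ h h', IsRadialTest h h' ∧ ∀ r, 0 < r → g r = q r * h r - h' r := by
  obtain ⟨a, b, ha, hab, hz⟩ := hg.supp
  have hgw : ContinuousOn (fun r => g r * w r) (Ioi 0) := hg.cont.mul hw.cont
  -- The equation to solve is `(h w)' = -g w`, hence `h = -P / w`. Starting the primitive at `a`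
  -- makes it vanish to the left of the support of `g`; the mean-zero hypothesis makes it vanish to
  -- the right.
  set P : ℝ → ℝ := fun r => ∫ t in a..r, g t * w t with hP
  have hPd : ∀ r, 0 < r → HasDerivAt P (g r * w r) r := by
    intro r hr
    have hsub : uIcc a r ⊆ Ioi 0 := fun x hx => lt_of_lt_of_le (lt_min ha hr) hx.1
    exact intervalIntegral.integral_hasDerivAt_right (hgw.mono hsub).intervalIntegrable
      (hgw.stronglyMeasurableAtFilter isOpen_Ioi r hr) (hgw.continuousAt (Ioi_mem_nhds hr))
  set h : ℝ → ℝ := fun r => -(P r * (w r)⁻¹) with hh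
  have hhd : ∀ r, 0 < r → HasDerivAt h (q r * h r - g r) r := by
    intro r hr
    have hwr := (hw.pos r hr).ne'
    have : HasDerivAt h _ r := ((hPd r hr).mul ((hw.hasDeriv r hr).inv hwr)).neg
    refine this.congr_deriv ?_
    simp only [h, Pi.inv_apply]
    field_simp
    ring
  have hhc : ContinuousOn h (Ioi 0) :=
    fun r hr => (hhd r hr).continuousAt.continuousWithinAt
  refine ⟨h, fun r => q r * h r - g r, ⟨hhd, (hw.cont_q.mul hhc).sub hg.cont, ?_⟩,
    fun r hr => by ring⟩
  refine ⟨a, b, ha, hab, fun r hr hr' => ?_⟩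
  suffices P r = 0 by simp [hh, this]
  rw [mem_Icc, not_and_or, not_le, not_le] at hr'
  rcases hr' with hr' | hr'
  · simp only [hP]
    rw [intervalIntegral.integral_symm, intervalIntegral.integral_of_le hr'.le,
      integral_Ioc_eq_integral_Ioo, setIntegral_eq_zero_of_forall_eq_zero, neg_zero]
    intro x hx
    rw [hz x (hr.trans hx.1) (fun h => absurd h.1 (not_le.2 hx.2)), zero_mul]
  · simp only [hP]
    rw [intervalIntegral.integral_of_le (hab.trans hr').le, ← integral_Icc_eq_integral_Ioc, ← h0]
    symm
    refine setIntegral_eq_of_subset_of_forall_sdiff_eq_zero measurableSet_Ioi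
      (fun x hx => ha.trans_le hx.1) fun x hx => ?_
    rw [hz x hx.1 fun h => hx.2 ⟨h.1, h.2.trans hr'.le⟩, zero_mul]

/-- The duality step: a Hardy inequality gives a Poincaré inequality for mean-zero functions,
with a gain from the convexity of the weight. -/
theorem poincare_of_mean_zero (hw : IsRadialWeight w q q')
    (hq : ∀ r, 0 < r → ε + N / r ^ 2 ≤ q' r) (hY : HardyIneq N w A) (hA : 0 ≤ A + ε)
    (hg : IsRadialTest g g') (h0 : ∫ r in Ioi 0, g r * w r = 0) :
    (A + ε) * ∫ r in Ioi 0, g r ^ 2 * w r ≤ ∫ r in Ioi 0, g' r ^ 2 * w r := by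
  obtain ⟨h, h', hh, hgh⟩ := hw.exists_adjoint_eq hg h0
  have hc := hh.cont
  have hc' := hh.cont'
  have gc := hg.cont
  have gc' := hg.cont'
  have hwc := hw.cont
  have hqc' := hw.cont_q'
  have e1 : ∫ r in Ioi 0, g r ^ 2 * w r =
      (∫ r in Ioi 0, h' r ^ 2 * w r) + ∫ r in Ioi 0, q' r * h r ^ 2 * w r := by
    rw [← hw.integral_adjoint_sq hh]
    refine setIntegral_congr_fun measurableSet_Ioi fun r hr => ?_
    simp only [hgh r hr]
  have e2 : ∫ r in Ioi 0, g r ^ 2 * w r = ∫ r in Ioi 0, g' r * h r * w r := by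
    rw [← hw.integral_mul_adjoint hg hh]
    refine setIntegral_congr_fun measurableSet_Ioi fun r hr => ?_
    simp only [← hgh r hr, sq]
  have j1 : IntegrableOn (fun r => h r ^ 2 * w r) (Ioi 0) :=
    integrableOn_Ioi_of_compactlySupported (by fun_prop)
      (hh.supp.mono fun r _ h0 => by simp [h0])
  have j2 : IntegrableOn (fun r => h r ^ 2 / r ^ 2 * w r) (Ioi 0) :=
    integrableOn_Ioi_of_compactlySupported
      ((ContinuousOn.div (by fun_prop) (by fun_prop) fun x hx => pow_ne_zero _ (ne_of_gt hx)).mul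
        hwc) (hh.supp.mono fun r _ h0 => by simp [h0])
  have j3 : IntegrableOn (fun r => q' r * h r ^ 2 * w r) (Ioi 0) :=
    integrableOn_Ioi_of_compactlySupported (by fun_prop)
      (hh.supp.mono fun r _ h0 => by simp [h0])
  have j4 : IntegrableOn (fun r => g' r ^ 2 * w r) (Ioi 0) :=
    integrableOn_Ioi_of_compactlySupported (by fun_prop)
      (hg.supp'.mono fun r _ h0 => by simp [h0])
  have j5 : IntegrableOn (fun r => g' r * h r * w r) (Ioi 0) :=
    integrableOn_Ioi_of_compactlySupported (by fun_prop)
      (hg.supp'.mono fun r _ h0 => by simp [h0])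
  have e3 : ε * (∫ r in Ioi 0, h r ^ 2 * w r) + N * (∫ r in Ioi 0, h r ^ 2 / r ^ 2 * w r) ≤
      ∫ r in Ioi 0, q' r * h r ^ 2 * w r := by
    rw [← integral_const_mul, ← integral_const_mul,
      ← integral_add (j1.const_mul _) (j2.const_mul _)]
    refine setIntegral_mono_on ((j1.const_mul _).add (j2.const_mul _)) j3 measurableSet_Ioi ?_
    intro r hr
    have := mul_le_mul_of_nonneg_right (hq r hr)
      (mul_nonneg (sq_nonneg (h r)) (hw.pos r hr).le)
    calc _ = (ε + N / r ^ 2) * (h r ^ 2 * w r) := by ring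
      _ ≤ _ := this
      _ = _ := by ring
  have e4 := hY h h' hh
  have e5 : (A + ε) * ∫ r in Ioi 0, h r ^ 2 * w r ≤ ∫ r in Ioi 0, g r ^ 2 * w r := by
    rw [add_mul]; linarith
  -- Cauchy–Schwarz in the form of a completed square, which avoids division. Its cross term is `∫
  -- g² w` by `e2`, and `e5` times `A + ε` bounds its `h²` term.
  have e6 : 0 ≤ ∫ r in Ioi 0, (g' r - (A + ε) * h r) ^ 2 * w r :=
    setIntegral_nonneg measurableSet_Ioi fun r hr => mul_nonneg (sq_nonneg _) (hw.pos r hr).le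
  have e7 : ∫ r in Ioi 0, (g' r - (A + ε) * h r) ^ 2 * w r = ∫ r in Ioi 0, (g' r ^ 2 * w r +
      (A + ε) ^ 2 * (h r ^ 2 * w r) - (2 * (A + ε)) * (g' r * h r * w r)) := by
    congr 1; ext r; ring
  rw [e7, integral_add_sub_eq j4 (j1.const_mul _) (j5.const_mul _),
    integral_const_mul, integral_const_mul, ← e2] at e6
  nlinarith [mul_le_mul_of_nonneg_left e5 hA]

end IsRadialWeight

/-! ### From mean-zero functions to all functions, and the bootstrap between the two inequalities -/

namespace IsRadialWeight

variable {w q q' g g' h h' : ℝ → ℝ} {N A ε : ℝ}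

theorem tendsto_integral_logCutoff_mul (hw : IsRadialWeight w q q') {f : ℝ → ℝ}
    (hf : ContinuousOn f (Ioi 0)) (hfi : IntegrableOn (fun r => f r * w r) (Ioi 0)) :
    Tendsto (fun k => ∫ r in Ioi 0, f r * logCutoff k r * w r) atTop
      (𝓝 (∫ r in Ioi 0, f r * w r)) := by
  refine tendsto_integral_of_dominated_convergence (fun r => |f r * w r|) (fun k => ?_) hfi.abs
    (fun k => ?_) ?_
  · exact ((hf.mul (isRadialTest_logCutoff k).cont).mul hw.cont).aestronglyMeasurable
      measurableSet_Ioi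
  · refine Eventually.of_forall fun r => ?_
    rw [Real.norm_eq_abs, mul_right_comm, abs_mul]
    exact mul_le_of_le_one_right (abs_nonneg _) (abs_logCutoff_le_one k r)
  · refine Eventually.of_forall fun r => ?_
    refine tendsto_const_nhds.congr' ?_
    filter_upwards [eventually_logCutoff_eq_one r] with k hk
    rw [hk, mul_one]

theorem tendsto_integral_mul_logCutoffDeriv (hw : IsRadialWeight w q q') {f : ℝ → ℝ}
    (hf : ContinuousOn f (Ioi 0)) (hfs : IsCompactlySupportedIoi f) :
    Tendsto (fun k => ∫ r in Ioi 0, f r * logCutoffDeriv k r * w r) atTop (𝓝 0) := by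
  obtain ⟨C, hC0, hC⟩ := exists_abs_logCutoffDeriv_le
  have hi : IntegrableOn (fun r => |f r| * (C / r) * w r) (Ioi 0) := by
    refine integrableOn_Ioi_of_compactlySupported ((hf.abs.mul ?_).mul hw.cont)
      (hfs.mono fun r _ h0 => by simp [h0])
    exact ContinuousOn.div (by fun_prop) (by fun_prop) fun x hx => ne_of_gt hx
  rw [show 𝓝 (0 : ℝ) = 𝓝 (∫ _ in Ioi (0 : ℝ), (0 : ℝ)) by simp]
  refine tendsto_integral_of_dominated_convergence _ (fun k => ?_) hi (fun k => ?_) ?_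
  · exact ((hf.mul (isRadialTest_logCutoff k).cont').mul hw.cont).aestronglyMeasurable
      measurableSet_Ioi
  · filter_upwards [ae_restrict_mem measurableSet_Ioi] with r hr
    have hr : 0 < r := hr
    rw [norm_mul, norm_mul, Real.norm_of_nonneg (hw.pos r hr).le, Real.norm_eq_abs,
      Real.norm_eq_abs]
    have hwr := (hw.pos r hr).le
    gcongr
    refine (hC k r hr).trans ?_
    gcongr
    exact div_le_self hC0 (by linarith [(k.cast_nonneg : (0 : ℝ) ≤ k)])
  · refine Eventually.of_forall fun r => ?_
    refine tendsto_const_nhds.congr' ?_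
    filter_upwards [eventually_logCutoffDeriv_eq_zero r] with k hk
    rw [hk]; ring

theorem tendsto_integral_logCutoffDeriv_sq_mul (hw : IsRadialWeight w q q') :
    Tendsto (fun k => ∫ r in Ioi 0, logCutoffDeriv k r ^ 2 * w r) atTop (𝓝 0) := by
  obtain ⟨M, hM⟩ := hw.bound
  have hwc := hw.cont
  refine squeeze_zero (fun k => setIntegral_nonneg measurableSet_Ioi fun r hr =>
    mul_nonneg (sq_nonneg _) (hw.pos r hr).le) (fun k => ?_)
    (tendsto_integral_logCutoffDeriv_sq (fun r hr => (hw.pos r hr).le) hwc hw.int hM)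
  have hc := (isRadialTest_logCutoff k).cont'
  refine setIntegral_mono_on ?_ ?_ measurableSet_Ioi fun r hr => ?_
  · exact integrableOn_Ioi_of_compactlySupported (by fun_prop)
      ((isRadialTest_logCutoff k).supp'.mono fun r _ h => by simp [h])
  · exact integrableOn_Ioi_of_compactlySupported (by fun_prop)
      ((isRadialTest_logCutoff k).supp'.mono fun r _ h => by simp [h])
  · have := (hw.pos r hr).le
    have h2 : (1 : ℝ) ≤ 1 + r ^ 2 := by nlinarith
    gcongr
    exact le_mul_of_one_le_right (sq_nonneg _) h2

/-- Constants are not compactly supported in `(0, ∞)`, so the mean is removed by subtracting a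
multiple of `logCutoff k`. The multiple tends to the mean, and the cutoff tends to 1 with energy
tending to 0. -/
theorem poincareIneq_of_mean_zero (hw : IsRadialWeight w q q')
    (hP : ∀ g g' : ℝ → ℝ, IsRadialTest g g' → ∫ r in Ioi 0, g r * w r = 0 →
      A * ∫ r in Ioi 0, g r ^ 2 * w r ≤ ∫ r in Ioi 0, g' r ^ 2 * w r) :
    PoincareIneq w A := by
  intro g g' hg
  have gc := hg.cont
  have gc' := hg.cont'
  have hwc := hw.cont
  have hχ := fun k => (isRadialTest_logCutoff k).cont
  have hχ' := fun k => (isRadialTest_logCutoff k).cont'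
  set Z := ∫ r in Ioi 0, w r with hZ
  have hZ0 : 0 < Z := hw.mass_pos
  set m := ∫ r in Ioi 0, g r * w r with hm
  set Zk : ℕ → ℝ := fun k => ∫ r in Ioi 0, logCutoff k r * w r
  have hZk : Tendsto Zk atTop (𝓝 Z) := by
    simpa using hw.tendsto_integral_logCutoff_mul (f := fun _ => 1) continuousOn_const
      (by simpa using hw.int)
  have hck : Tendsto (fun k => m / Zk k) atTop (𝓝 (m / Z)) := tendsto_const_nhds.div hZk hZ0.ne'
  have i1 : IntegrableOn (fun r => g r * w r) (Ioi 0) :=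
    integrableOn_Ioi_of_compactlySupported (by fun_prop) (hg.supp.mono fun r _ h0 => by simp [h0])
  have i2 : IntegrableOn (fun r => g r ^ 2 * w r) (Ioi 0) :=
    integrableOn_Ioi_of_compactlySupported (by fun_prop) (hg.supp.mono fun r _ h0 => by simp [h0])
  have i3 : IntegrableOn (fun r => g' r ^ 2 * w r) (Ioi 0) :=
    integrableOn_Ioi_of_compactlySupported (by fun_prop) (hg.supp'.mono fun r _ h0 => by simp [h0])
  have i4 (k : ℕ) : IntegrableOn (fun r => logCutoff k r * w r) (Ioi 0) :=
    integrableOn_Ioi_of_compactlySupported ((hχ k).mul hwc)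
      ((isRadialTest_logCutoff k).supp.mono fun r _ h0 => by simp [h0])
  have i5 (k : ℕ) : IntegrableOn (fun r => logCutoff k r * logCutoff k r * w r) (Ioi 0) :=
    integrableOn_Ioi_of_compactlySupported (((hχ k).mul (hχ k)).mul hwc)
      ((isRadialTest_logCutoff k).supp.mono fun r _ h0 => by simp [h0])
  have i6 (k : ℕ) : IntegrableOn (fun r => logCutoffDeriv k r ^ 2 * w r) (Ioi 0) :=
    integrableOn_Ioi_of_compactlySupported (((hχ' k).pow 2).mul hwc)
      ((isRadialTest_logCutoff k).supp'.mono fun r _ h0 => by simp [h0])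
  have i7 (k : ℕ) : IntegrableOn (fun r => g r * logCutoff k r * w r) (Ioi 0) :=
    integrableOn_Ioi_of_compactlySupported ((gc.mul (hχ k)).mul hwc)
      (hg.supp.mono fun r _ h0 => by simp [h0])
  have i8 (k : ℕ) : IntegrableOn (fun r => g' r * logCutoffDeriv k r * w r) (Ioi 0) :=
    integrableOn_Ioi_of_compactlySupported ((gc'.mul (hχ' k)).mul hwc)
      (hg.supp'.mono fun r _ h0 => by simp [h0])
  -- Squeezed through `2χ - 1 ≤ χ² ≤ 1`, so that only the limit of `∫ χ w` is needed.
  have t1 : Tendsto (fun k => ∫ r in Ioi 0, logCutoff k r * logCutoff k r * w r) atTop (𝓝 Z) := by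
    refine tendsto_of_tendsto_of_tendsto_of_le_of_le
      (g := fun k => 2 * Zk k - Z) (h := fun _ => Z) ?_ tendsto_const_nhds ?_ ?_
    · simpa [two_mul] using (hZk.const_mul 2).sub_const Z
    · intro k
      have : 2 * Zk k - Z = ∫ r in Ioi 0, (2 * (logCutoff k r * w r) - w r) := by
        rw [integral_sub ((i4 k).const_mul 2) hw.int, integral_const_mul]
      simp only
      rw [this]
      refine setIntegral_mono_on (((i4 k).const_mul 2).sub hw.int) (i5 k) measurableSet_Ioi ?_
      intro r hr
      have := (hw.pos r hr).le
      nlinarith [mul_nonneg (sq_nonneg (logCutoff k r - 1)) this]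
    · intro k
      refine setIntegral_mono_on (i5 k) hw.int measurableSet_Ioi fun r hr => ?_
      refine mul_le_of_le_one_left (hw.pos r hr).le ?_
      exact mul_le_one₀ (logCutoff_le_one k r) (logCutoff_nonneg k r) (logCutoff_le_one k r)
  have t2 := hw.tendsto_integral_logCutoff_mul gc i1
  have t3 := hw.tendsto_integral_mul_logCutoffDeriv gc' hg.supp'
  have t4 := hw.tendsto_integral_logCutoffDeriv_sq_mul
  have hlim1 := ((((hck.pow 2).mul t1).const_add (∫ r in Ioi 0, g r ^ 2 * w r)).sub
    ((hck.const_mul 2).mul t2)).const_mul A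
  have hlim2 := (((hck.pow 2).mul t4).const_add (∫ r in Ioi 0, g' r ^ 2 * w r)).sub
    ((hck.const_mul 2).mul t3)
  have key := le_of_tendsto_of_tendsto hlim1 hlim2 (by
    filter_upwards [hZk.eventually (lt_mem_nhds hZ0)] with k hk
    set c := m / Zk k
    have hgk := hg.sub ((isRadialTest_logCutoff k).const_mul c)
    have hmean : ∫ r in Ioi 0, (g r - c * logCutoff k r) * w r = 0 := by
      have : ∫ r in Ioi 0, (g r - c * logCutoff k r) * w r =
          ∫ r in Ioi 0, (g r * w r - c * (logCutoff k r * w r)) := by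
        congr 1; ext r; ring
      rw [this, integral_sub i1 ((i4 k).const_mul c), integral_const_mul]
      simp only [c]
      rw [div_mul_cancel₀ _ hk.ne', sub_self]
    have := hP _ _ hgk hmean
    have e1 : ∫ r in Ioi 0, (g r - c * logCutoff k r) ^ 2 * w r = ∫ r in Ioi 0,
        (g r ^ 2 * w r + c ^ 2 * (logCutoff k r * logCutoff k r * w r) -
          2 * c * (g r * logCutoff k r * w r)) := by
      congr 1; ext r; ring
    have e2 : ∫ r in Ioi 0, (g' r - c * logCutoffDeriv k r) ^ 2 * w r = ∫ r in Ioi 0,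
        (g' r ^ 2 * w r + c ^ 2 * (logCutoffDeriv k r ^ 2 * w r) -
          2 * c * (g' r * logCutoffDeriv k r * w r)) := by
      congr 1; ext r; ring
    rw [e1, e2, integral_add_sub_eq i2 ((i5 k).const_mul _) ((i7 k).const_mul _),
      integral_add_sub_eq i3 ((i6 k).const_mul _) ((i8 k).const_mul _), integral_const_mul,
      integral_const_mul, integral_const_mul, integral_const_mul] at this
    exact this)
  have e : Z * (∫ r in Ioi 0, g r ^ 2 * w r) - m ^ 2 =
      Z * ((∫ r in Ioi 0, g r ^ 2 * w r) + (m / Z) ^ 2 * Z - 2 * (m / Z) * m) := by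
    field_simp; ring
  rw [e, mul_left_comm]
  refine mul_le_mul_of_nonneg_left (key.trans (by simp)) hZ0.le

/-- Cauchy–Schwarz turns a Poincaré inequality into a Hardy inequality. -/
theorem hardyIneq_of_poincareIneq (hw : IsRadialWeight w q q') (hA : 0 ≤ A)
    (hAN : A * ∫ r in Ioi 0, r ^ 2 * w r ≤ N * ∫ r in Ioi 0, w r)
    (hP : PoincareIneq w A) : HardyIneq N w A := by
  intro g g' hg
  have gc := hg.cont
  have hwc := hw.cont
  have hZ0 := hw.mass_pos
  have hi : IntegrableOn (fun r => g r ^ 2 / r ^ 2 * w r) (Ioi 0) :=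
    integrableOn_Ioi_of_compactlySupported
      ((ContinuousOn.div (by fun_prop) (by fun_prop) fun x hx => pow_ne_zero _ (ne_of_gt hx)).mul
        hwc) (hg.supp.mono fun r _ h0 => by simp [h0])
  -- Factor `g w` as `(g/r) √w` times `r √w`. The squared mean in the Poincaré inequality is then
  -- absorbed by the Hardy term, which is where `hAN` comes in.
  have hCS : (∫ r in Ioi 0, g r * w r) ^ 2 ≤
      (∫ r in Ioi 0, g r ^ 2 / r ^ 2 * w r) * ∫ r in Ioi 0, r ^ 2 * w r := by
    have e1 : ∀ r ∈ Ioi (0 : ℝ), (g r / r * √(w r)) ^ 2 = g r ^ 2 / r ^ 2 * w r := fun r hr => by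
      rw [mul_pow, Real.sq_sqrt (hw.pos r hr).le, div_pow]
    have e2 : ∀ r ∈ Ioi (0 : ℝ), (r * √(w r)) ^ 2 = r ^ 2 * w r := fun r hr => by
      rw [mul_pow, Real.sq_sqrt (hw.pos r hr).le]
    have e3 : ∀ r ∈ Ioi (0 : ℝ), (g r / r * √(w r)) * (r * √(w r)) = g r * w r := fun r hr => by
      have h0 : r ≠ 0 := ne_of_gt hr
      calc _ = (g r / r * r) * (√(w r) * √(w r)) := by ring
        _ = _ := by rw [Real.mul_self_sqrt (hw.pos r hr).le, div_mul_cancel₀ _ h0]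
    rw [← setIntegral_congr_fun measurableSet_Ioi e1, ← setIntegral_congr_fun measurableSet_Ioi e2,
      ← setIntegral_congr_fun measurableSet_Ioi e3]
    refine sq_integral_mul_le ((integrableOn_congr_fun e1 measurableSet_Ioi).2 hi)
      ((integrableOn_congr_fun e2 measurableSet_Ioi).2 hw.int_sq)
      ((integrableOn_congr_fun e3 measurableSet_Ioi).2 ?_)
    exact integrableOn_Ioi_of_compactlySupported (by fun_prop)
      (hg.supp.mono fun r _ h0 => by simp [h0])
  have h1 := hP g g' hg
  have h2 : 0 ≤ ∫ r in Ioi 0, g r ^ 2 / r ^ 2 * w r :=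
    setIntegral_nonneg measurableSet_Ioi fun r hr => mul_nonneg (by positivity) (hw.pos r hr).le
  have h3 := mul_le_mul_of_nonneg_left hCS hA
  have h4 := mul_le_mul_of_nonneg_right hAN h2
  refine le_of_mul_le_mul_left ?_ hZ0
  linarith

/-- The Hardy and Poincaré inequalities with the sharp constant `N ∫ w / ∫ r² w` for uniformly
convex weights, by induction on multiples of the convexity gain. -/
theorem hardyIneq_and_poincareIneq (hw : IsRadialWeight w q q') (hε : 0 < ε) (hN : 0 ≤ N)
    (hq : ∀ r, 0 < r → ε + N / r ^ 2 ≤ q' r)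
    (hA : A * ∫ r in Ioi 0, r ^ 2 * w r = N * ∫ r in Ioi 0, w r) :
    HardyIneq N w A ∧ PoincareIneq w A := by
  have hZ0 := hw.mass_pos
  have hM0 : 0 < ∫ r in Ioi 0, r ^ 2 * w r :=
    setIntegral_Ioi_pos (fun r hr => mul_pos (by positivity) (hw.pos r hr)) hw.int_sq
  have hA0 : 0 ≤ A := by
    by_contra! h
    nlinarith [mul_nonneg hN hZ0.le, mul_neg_of_neg_of_pos h hM0]
  -- The target `A` is reached in `m` equal steps `δ = A / m`; the choice `m > A / ε` keeps each
  -- step within the gain `ε`, and every intermediate constant is at most `A`.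
  obtain ⟨m, hm⟩ := exists_nat_gt (A / ε)
  have hm0 : (0 : ℝ) < m := lt_of_le_of_lt (by positivity) hm
  set δ := A / m with hδ
  have hδ0 : 0 ≤ δ := by positivity
  have hδε : δ ≤ ε := by
    rw [hδ, div_le_iff₀ hm0]; rw [div_lt_iff₀ hε] at hm; linarith
  have key : ∀ j : ℕ, j ≤ m → HardyIneq N w (j * δ) ∧ PoincareIneq w (j * δ) := by
    intro j
    induction j with
    | zero =>
      refine fun _ => ⟨fun h h' hh => ?_, fun g g' hg => ?_⟩
      · have h1 : 0 ≤ ∫ r in Ioi 0, h r ^ 2 / r ^ 2 * w r :=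
          setIntegral_nonneg measurableSet_Ioi fun r hr =>
            mul_nonneg (by positivity) (hw.pos r hr).le
        have h2 : 0 ≤ ∫ r in Ioi 0, h' r ^ 2 * w r :=
          setIntegral_nonneg measurableSet_Ioi fun r hr =>
            mul_nonneg (by positivity) (hw.pos r hr).le
        simp only [CharP.cast_eq_zero, zero_mul]
        positivity
      · have h2 : 0 ≤ ∫ r in Ioi 0, g' r ^ 2 * w r :=
          setIntegral_nonneg measurableSet_Ioi fun r hr =>
            mul_nonneg (by positivity) (hw.pos r hr).le
        simp only [CharP.cast_eq_zero, zero_mul]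
        positivity
    | succ j ih =>
      intro hj
      have hY := (ih (by omega)).1
      have e : ((j + 1 : ℕ) : ℝ) * δ = j * δ + δ := by push_cast; ring
      have hP : PoincareIneq w (((j + 1 : ℕ) : ℝ) * δ) := by
        rw [e]
        refine hw.poincareIneq_of_mean_zero fun g g' hg h0 => ?_
        exact hw.poincare_of_mean_zero (fun r hr => (by gcongr : _ ≤ ε + N / r ^ 2).trans (hq r hr))
          hY (by positivity) hg h0
      refine ⟨hw.hardyIneq_of_poincareIneq (by positivity) ?_ hP, hP⟩
      rw [← hA]
      refine mul_le_mul_of_nonneg_right ?_ hM0.le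
      rw [hδ, ← mul_div_assoc, div_le_iff₀ hm0, mul_comm]
      gcongr
  have := key m le_rfl
  rwa [hδ, mul_div_cancel₀ _ hm0.ne'] at this

end IsRadialWeight

/-! ### Convex radial potentials -/

/-- A smooth convex function on `(0, ∞)`. -/
structure IsConvexPotential (V : ℝ → ℝ) : Prop where
  convex : ConvexOn ℝ (Ioi 0) V
  smooth : ContDiffOn ℝ ∞ V (Ioi 0)

/-- The weight `r ^ (n - 1) e^{-V(r)}` of the radial part of `e^{-V(‖x‖)} dx`. -/
noncomputable def radialWeight (n : ℕ) (V : ℝ → ℝ) (r : ℝ) : ℝ := r ^ (n - 1) * Real.exp (-V r)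

theorem radialWeight_pos (n : ℕ) (V : ℝ → ℝ) {r : ℝ} (hr : 0 < r) : 0 < radialWeight n V r :=
  mul_pos (pow_pos hr _) (Real.exp_pos _)

namespace IsConvexPotential

variable {V : ℝ → ℝ} {n : ℕ}

theorem hasDerivAt (hV : IsConvexPotential V) {r : ℝ} (hr : 0 < r) :
    HasDerivAt V (deriv V r) r :=
  ((hV.smooth.differentiableOn (by simp)).differentiableAt (Ioi_mem_nhds hr)).hasDerivAt

theorem smooth_deriv (hV : IsConvexPotential V) : ContDiffOn ℝ ∞ (deriv V) (Ioi 0) :=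
  hV.smooth.deriv_of_isOpen isOpen_Ioi (by simp)

theorem hasDerivAt_deriv (hV : IsConvexPotential V) {r : ℝ} (hr : 0 < r) :
    HasDerivAt (deriv V) (deriv (deriv V) r) r :=
  ((hV.smooth_deriv.differentiableOn (by simp)).differentiableAt (Ioi_mem_nhds hr)).hasDerivAt

theorem continuousOn (hV : IsConvexPotential V) : ContinuousOn V (Ioi 0) := hV.smooth.continuousOn

theorem continuousOn_deriv_deriv (hV : IsConvexPotential V) :
    ContinuousOn (deriv (deriv V)) (Ioi 0) :=
  hV.smooth_deriv.continuousOn_deriv_of_isOpen isOpen_Ioi (by simp)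

theorem deriv_deriv_nonneg (hV : IsConvexPotential V) {r : ℝ} (hr : 0 < r) :
    0 ≤ deriv (deriv V) r := by
  have hm : MonotoneOn (deriv V) (Ioi 0) :=
    hV.convex.monotoneOn_deriv fun x hx => (hV.hasDerivAt hx).differentiableAt
  have := hm.derivWithin_nonneg (x := r)
  rwa [derivWithin_of_mem_nhds (Ioi_mem_nhds hr)] at this

theorem tangent_le (hV : IsConvexPotential V) {x y : ℝ} (hx : 0 < x) (hy : 0 < y) :
    V x + deriv V x * (y - x) ≤ V y := by
  rcases lt_trichotomy x y with h | h | h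
  · have := hV.convex.le_slope_of_hasDerivAt hx hy h (hV.hasDerivAt hx)
    rw [slope_def_field, le_div_iff₀ (sub_pos.2 h)] at this
    linarith
  · simp [h]
  · have := hV.convex.slope_le_of_hasDerivAt hy hx h (hV.hasDerivAt hx)
    rw [slope_def_field, div_le_iff₀ (sub_pos.2 h)] at this
    linarith

theorem continuousOn_radialWeight (hV : IsConvexPotential V) :
    ContinuousOn (radialWeight n V) (Ioi 0) :=
  (by fun_prop : ContinuousOn (fun r : ℝ => r ^ (n - 1)) (Ioi 0)).mul hV.continuousOn.neg.rexp

/-- An integrable convex potential has a point of positive slope. -/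
theorem exists_deriv_pos (hV : IsConvexPotential V)
    (hi : IntegrableOn (radialWeight n V) (Ioi 0)) : ∃ x, 0 < x ∧ 0 < deriv V x := by
  by_contra! H
  have hle : ∀ r, 1 ≤ r → V r ≤ V 1 := by
    intro r hr
    have hr0 : 0 < r := one_pos.trans_le hr
    have := hV.tangent_le hr0 one_pos
    nlinarith [mul_nonneg (neg_nonneg.2 (H r hr0)) (sub_nonneg.2 hr)]
  have hconst : IntegrableOn (fun _ : ℝ => Real.exp (-V 1)) (Ioi 1) := by
    refine Integrable.mono' (hi.mono_set (Ioi_subset_Ioi zero_le_one))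
      (by fun_prop) ?_
    filter_upwards [ae_restrict_mem measurableSet_Ioi] with r hr
    have hr : (1 : ℝ) < r := hr
    rw [Real.norm_of_nonneg (Real.exp_pos _).le, radialWeight]
    have h1 : Real.exp (-V 1) ≤ Real.exp (-V r) := Real.exp_le_exp.2 (by linarith [hle r hr.le])
    have h2 : 1 ≤ r ^ (n - 1) := one_le_pow₀ hr.le
    nlinarith [Real.exp_pos (-V r)]
  rw [integrableOn_const_iff] at hconst
  simp [(Real.exp_pos _).ne'] at hconst

/-- The tangent line at a point of positive slope bounds `e^{-V}` by a decaying exponential, so all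
moments are finite. -/
theorem integrableOn_pow_mul_radialWeight (hV : IsConvexPotential V)
    (hi : IntegrableOn (radialWeight n V) (Ioi 0)) (m : ℕ) :
    IntegrableOn (fun r => r ^ m * radialWeight n V r) (Ioi 0) := by
  obtain ⟨x, hx, hd⟩ := hV.exists_deriv_pos hi
  have h0 := integrableOn_rpow_mul_exp_neg_mul_rpow (p := 1) (s := ((m + (n - 1) : ℕ) : ℝ))
    (lt_of_lt_of_le (by norm_num) (Nat.cast_nonneg _)) one_pos hd
  refine Integrable.mono' (h0.const_mul (Real.exp (-V x + deriv V x * x)))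
    (ContinuousOn.aestronglyMeasurable
      ((by fun_prop : ContinuousOn (fun r : ℝ => r ^ m) (Ioi 0)).mul hV.continuousOn_radialWeight)
      measurableSet_Ioi) ?_
  filter_upwards [ae_restrict_mem measurableSet_Ioi] with r hr
  have hr : 0 < r := hr
  have hw := radialWeight_pos n V hr
  rw [Real.norm_of_nonneg (by positivity), radialWeight, Real.rpow_natCast, Real.rpow_one,
    pow_add, ← mul_assoc, mul_left_comm, ← Real.exp_add]
  gcongr
  have := hV.tangent_le hx hr
  linarith

/-- `V` may blow up to `+∞` at the origin, but it stays above its tangent at 1, which is bounded on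
`(0, 1]`. -/
theorem exists_exp_neg_le (hV : IsConvexPotential V) :
    ∃ M, 0 < M ∧ ∀ r, 0 < r → r ≤ 1 → Real.exp (-V r) ≤ M := by
  refine ⟨Real.exp (-V 1 + |deriv V 1|), Real.exp_pos _, fun r hr hr1 => Real.exp_le_exp.2 ?_⟩
  have h1 := hV.tangent_le one_pos hr
  have h2 : -(|deriv V 1|) ≤ deriv V 1 * (r - 1) := by
    refine (neg_le_neg ?_).trans (neg_abs_le _)
    rw [abs_mul]
    refine mul_le_of_le_one_right (abs_nonneg _) ?_
    rw [abs_le]; constructor <;> linarith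
  linarith

/-- The hypothesis `n ≥ 2` enters as `r ^ (n - 1) ≤ r` on `(0, 1]`. This linear vanishing is what
gives the origin zero capacity. -/
theorem radialWeight_le (hV : IsConvexPotential V) (hn : 2 ≤ n) :
    ∃ M, ∀ r, 0 < r → r ≤ 1 → radialWeight n V r ≤ M * r := by
  obtain ⟨M, hM0, hM⟩ := hV.exists_exp_neg_le
  refine ⟨M, fun r hr hr1 => ?_⟩
  rw [radialWeight, mul_comm M]
  have : r ^ (n - 1) ≤ r := by
    simpa using pow_le_pow_of_le_one hr.le hr1 (show 1 ≤ n - 1 by omega)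
  have := hM r hr hr1
  gcongr

theorem add_sq (hV : IsConvexPotential V) {ε : ℝ} (hε : 0 ≤ ε) :
    IsConvexPotential (fun r => V r + ε / 2 * r ^ 2) where
  convex := by
    refine hV.convex.add ?_
    have : ConvexOn ℝ (Ioi (0 : ℝ)) fun r : ℝ => r ^ 2 :=
      (convexOn_pow 2).subset Ioi_subset_Ici_self (convex_Ioi 0)
    exact this.smul (by positivity)
  smooth := hV.smooth.add (by fun_prop)

/-- The Jacobian `r ^ (n - 1)` contributes `(n - 1) / r²` to `q'`, precisely the coefficient of the
Hardy term with `N = n - 1`. -/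
theorem isRadialWeight (hV : IsConvexPotential V) (hn : 2 ≤ n)
    (hi : IntegrableOn (radialWeight n V) (Ioi 0)) :
    IsRadialWeight (radialWeight n V) (fun r => deriv V r - ((n : ℝ) - 1) / r)
      (fun r => deriv (deriv V) r + ((n : ℝ) - 1) / r ^ 2) where
  pos r hr := radialWeight_pos n V hr
  hasDeriv r hr := by
    have h1 := ((hasDerivAt_id r).fun_pow (n - 1)).mul (hV.hasDerivAt hr).neg.exp
    refine HasDerivAt.congr_deriv (f := radialWeight n V) h1 ?_
    obtain ⟨m, rfl⟩ : ∃ m, n = m + 2 := ⟨n - 2, by omega⟩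
    simp only [radialWeight, id, Pi.neg_apply]
    rw [show m + 2 - 1 = m + 1 by omega, show m + 1 - 1 = m by omega]
    push_cast
    have := hr.ne'
    field_simp
    ring
  hasDeriv_q r hr := by
    have h1 := (hV.hasDerivAt_deriv hr).sub
      ((hasDerivAt_inv hr.ne').const_mul ((n : ℝ) - 1))
    have e : (fun r => deriv V r - ((n : ℝ) - 1) / r) = fun r => deriv V r - ((n : ℝ) - 1) * r⁻¹ := by
      ext; rw [div_eq_mul_inv]
    rw [e]
    refine h1.congr_deriv ?_
    have := hr.ne'
    field_simp
    ring
  cont_q' := hV.continuousOn_deriv_deriv.add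
    (continuousOn_const.div (by fun_prop) fun x hx => pow_ne_zero _ (ne_of_gt hx))
  int := hi
  int_sq := hV.integrableOn_pow_mul_radialWeight hi 2
  bound := hV.radialWeight_le hn

theorem radialWeight_add_sq (V : ℝ → ℝ) (ε r : ℝ) :
    radialWeight n (fun r => V r + ε / 2 * r ^ 2) r =
      radialWeight n V r * Real.exp (-(ε / 2 * r ^ 2)) := by
  rw [radialWeight, radialWeight, neg_add, Real.exp_add, mul_assoc]

theorem tendsto_integral_radialWeight_add_sq (hV : IsConvexPotential V) {f : ℝ → ℝ}
    (hf : ContinuousOn f (Ioi 0)) (hfi : IntegrableOn (fun r => f r * radialWeight n V r) (Ioi 0)) :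
    Tendsto (fun k : ℕ => ∫ r in Ioi 0,
      f r * radialWeight n (fun r => V r + (1 / ((k : ℝ) + 1)) / 2 * r ^ 2) r) atTop
      (𝓝 (∫ r in Ioi 0, f r * radialWeight n V r)) := by
  simp only [radialWeight_add_sq]
  refine tendsto_integral_of_dominated_convergence (fun r => |f r * radialWeight n V r|)
    (fun k => ?_) hfi.abs (fun k => ?_) ?_
  · refine ContinuousOn.aestronglyMeasurable (hf.mul (hV.continuousOn_radialWeight.mul ?_))
      measurableSet_Ioi
    exact Continuous.continuousOn (by fun_prop)
  · refine Eventually.of_forall fun r => ?_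
    rw [Real.norm_eq_abs, ← mul_assoc, abs_mul]
    refine mul_le_of_le_one_right (abs_nonneg _) ?_
    rw [abs_of_pos (Real.exp_pos _), Real.exp_le_one_iff]
    have : 0 ≤ 1 / ((k : ℝ) + 1) / 2 * r ^ 2 := by positivity
    linarith
  · refine Eventually.of_forall fun r => ?_
    have h1 : Tendsto (fun k : ℕ => 1 / ((k : ℝ) + 1)) atTop (𝓝 0) :=
      tendsto_one_div_add_atTop_nhds_zero_nat
    have h2 := ((((h1.div_const 2).mul_const (r ^ 2)).neg).rexp.const_mul
      (radialWeight n V r)).const_mul (f r)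
    simpa using h2

/-- The Hardy and Poincaré inequalities for the radial weight of a convex potential. -/
theorem radial_inequalities (hV : IsConvexPotential V) (hn : 2 ≤ n)
    (hi : IntegrableOn (radialWeight n V) (Ioi 0)) {h h' : ℝ → ℝ} (hh : IsRadialTest h h') :
    (((n : ℝ) - 1) * (∫ r in Ioi 0, radialWeight n V r) *
        (∫ r in Ioi 0, h r ^ 2 * radialWeight n V r) ≤
      (∫ r in Ioi 0, r ^ 2 * radialWeight n V r) *
        ((∫ r in Ioi 0, h' r ^ 2 * radialWeight n V r) +
          ((n : ℝ) - 1) * ∫ r in Ioi 0, h r ^ 2 / r ^ 2 * radialWeight n V r)) ∧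
    (((n : ℝ) - 1) * ((∫ r in Ioi 0, radialWeight n V r) *
        (∫ r in Ioi 0, h r ^ 2 * radialWeight n V r) -
          (∫ r in Ioi 0, h r * radialWeight n V r) ^ 2) ≤
      (∫ r in Ioi 0, r ^ 2 * radialWeight n V r) *
        ∫ r in Ioi 0, h' r ^ 2 * radialWeight n V r) := by
  have hc := hh.cont
  have hc' := hh.cont'
  have hwc := hV.continuousOn_radialWeight (n := n)
  have c3 : ContinuousOn (fun r => h r ^ 2 / r ^ 2) (Ioi 0) :=
    ContinuousOn.div (by fun_prop) (by fun_prop) fun x hx => pow_ne_zero _ (ne_of_gt hx)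
  -- The quadratic term raises the second derivative by `ε = 1 / (k + 1)`, the gain needed by the
  -- bootstrap. With the denominator of the sharp constant cleared, both inequalities pass to the
  -- limit term by term.
  set U : ℕ → ℝ → ℝ := fun k r => V r + (1 / ((k : ℝ) + 1)) / 2 * r ^ 2 with hU
  have t0 : Tendsto (fun k => ∫ r in Ioi 0, radialWeight n (U k) r) atTop
      (𝓝 (∫ r in Ioi 0, radialWeight n V r)) := by
    simpa only [one_mul] using hV.tendsto_integral_radialWeight_add_sq (n := n) (f := fun _ => 1)
      continuousOn_const (by simpa using hi)
  have t1 := hV.tendsto_integral_radialWeight_add_sq (n := n) (f := fun r => r ^ 2) (by fun_prop)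
    (hV.integrableOn_pow_mul_radialWeight hi 2)
  have t2 := hV.tendsto_integral_radialWeight_add_sq (n := n) (f := fun r => h r ^ 2) (by fun_prop)
    (integrableOn_Ioi_of_compactlySupported (by fun_prop)
      (hh.supp.mono fun r _ h0 => by simp [h0]))
  have t3 := hV.tendsto_integral_radialWeight_add_sq (n := n) (f := fun r => h r) (by fun_prop)
    (integrableOn_Ioi_of_compactlySupported (by fun_prop)
      (hh.supp.mono fun r _ h0 => by simp [h0]))
  have t4 := hV.tendsto_integral_radialWeight_add_sq (n := n) (f := fun r => h' r ^ 2) (by fun_prop)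
    (integrableOn_Ioi_of_compactlySupported (by fun_prop)
      (hh.supp'.mono fun r _ h0 => by simp [h0]))
  have t5 := hV.tendsto_integral_radialWeight_add_sq (n := n) (f := fun r => h r ^ 2 / r ^ 2) c3
    (integrableOn_Ioi_of_compactlySupported (c3.mul hwc)
      (hh.supp.mono fun r _ h0 => by simp [h0]))
  have hN : (0 : ℝ) ≤ (n : ℝ) - 1 := by
    have : (2 : ℝ) ≤ n := by exact_mod_cast hn
    linarith
  have hk : ∀ k : ℕ,
      (∃ A, A * (∫ r in Ioi 0, r ^ 2 * radialWeight n (U k) r) =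
        ((n : ℝ) - 1) * (∫ r in Ioi 0, radialWeight n (U k) r) ∧
      HardyIneq ((n : ℝ) - 1) (radialWeight n (U k)) A ∧ PoincareIneq (radialWeight n (U k)) A) ∧
      0 < (∫ r in Ioi 0, radialWeight n (U k) r) ∧
      0 < ∫ r in Ioi 0, r ^ 2 * radialWeight n (U k) r := by
    intro k
    have hε : 0 < 1 / ((k : ℝ) + 1) := by positivity
    have hUk : IsConvexPotential (U k) := hV.add_sq hε.le
    have hik : IntegrableOn (radialWeight n (U k)) (Ioi 0) := by
      refine Integrable.mono' hi
        (hUk.continuousOn_radialWeight.aestronglyMeasurable measurableSet_Ioi) ?_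
      filter_upwards [ae_restrict_mem measurableSet_Ioi] with r hr
      rw [Real.norm_of_nonneg (radialWeight_pos n _ hr).le, radialWeight_add_sq]
      refine mul_le_of_le_one_right (radialWeight_pos n _ hr).le (Real.exp_le_one_iff.2 ?_)
      have : 0 ≤ 1 / ((k : ℝ) + 1) / 2 * r ^ 2 := by positivity
      linarith
    have hwk := hUk.isRadialWeight hn hik
    have hMk : 0 < ∫ r in Ioi 0, r ^ 2 * radialWeight n (U k) r :=
      setIntegral_Ioi_pos (fun r hr => mul_pos (by positivity) (radialWeight_pos n _ hr))
        hwk.int_sq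
    refine ⟨?_, hwk.mass_pos, hMk⟩
    refine ⟨((n : ℝ) - 1) * (∫ r in Ioi 0, radialWeight n (U k) r) /
      (∫ r in Ioi 0, r ^ 2 * radialWeight n (U k) r), div_mul_cancel₀ _ hMk.ne', ?_⟩
    refine hwk.hardyIneq_and_poincareIneq hε hN (fun r hr => ?_) (div_mul_cancel₀ _ hMk.ne')
    have h1 : deriv (U k) =ᶠ[𝓝 r] fun r => deriv V r + 1 / ((k : ℝ) + 1) * r := by
      filter_upwards [lt_mem_nhds hr] with x hx
      have := (hV.hasDerivAt hx).add ((hasDerivAt_pow 2 x).const_mul (1 / ((k : ℝ) + 1) / 2))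
      refine HasDerivAt.deriv (f := U k) (this.congr_deriv ?_)
      push_cast; ring
    have h2 : deriv (deriv (U k)) r = deriv (deriv V) r + 1 / ((k : ℝ) + 1) := by
      rw [h1.deriv_eq]
      simpa using ((hV.hasDerivAt_deriv hr).fun_add
        ((hasDerivAt_id r).const_mul (1 / ((k : ℝ) + 1)))).deriv
    rw [h2]
    have := hV.deriv_deriv_nonneg hr
    linarith
  refine ⟨le_of_tendsto_of_tendsto' ((t0.const_mul _).mul t2) (t1.mul (t4.add (t5.const_mul _)))
    fun k => ?_, le_of_tendsto_of_tendsto' (((t0.mul t2).sub (t3.pow 2)).const_mul _)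
    (t1.mul t4) fun k => ?_⟩
  · obtain ⟨⟨A, hA, hY, -⟩, hZ0, hM0⟩ := hk k
    have := mul_le_mul_of_nonneg_left (hY h h' hh) hM0.le
    calc _ = A * (∫ r in Ioi 0, r ^ 2 * radialWeight n (U k) r) *
          (∫ r in Ioi 0, h r ^ 2 * radialWeight n (U k) r) := by rw [hA]
      _ = (∫ r in Ioi 0, r ^ 2 * radialWeight n (U k) r) * (A *
          (∫ r in Ioi 0, h r ^ 2 * radialWeight n (U k) r)) := by ring
      _ ≤ _ := this
  · obtain ⟨⟨A, hA, -, hP⟩, hZ0, hM0⟩ := hk k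
    have := mul_le_mul_of_nonneg_left (hP h h' hh) hM0.le
    refine le_of_mul_le_mul_left ?_ hZ0
    calc _ = A * (∫ r in Ioi 0, r ^ 2 * radialWeight n (U k) r) *
          ((∫ r in Ioi 0, radialWeight n (U k) r) *
            (∫ r in Ioi 0, h r ^ 2 * radialWeight n (U k) r) -
          (∫ r in Ioi 0, h r * radialWeight n (U k) r) ^ 2) := by rw [hA]; ring
      _ = _ := by ring
      _ ≤ _ := this
      _ = _ := by ring

end IsConvexPotential

/-! ### The Gaussian Poincaré inequality -/

set_option linter.unusedSectionVars false

section Gaussian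

variable {E : Type*} [NormedAddCommGroup E] [InnerProductSpace ℝ E] [FiniteDimensional ℝ E]
  [MeasurableSpace E] [BorelSpace E]

/-- The unnormalised Gaussian weight `e^{-‖x‖²/2}`. -/
noncomputable def gaussWeight (x : E) : ℝ := Real.exp (-(1 / 2) * ‖x‖ ^ 2)

theorem gaussWeight_pos (x : E) : 0 < gaussWeight x := Real.exp_pos _

@[fun_prop]
theorem continuous_gaussWeight : Continuous (gaussWeight (E := E)) := by
  unfold gaussWeight; fun_prop

theorem integrable_exp_neg_mul_norm_sq {b : ℝ} (hb : 0 < b) :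
    Integrable (fun x : E => Real.exp (-b * ‖x‖ ^ 2)) := by
  have h := (GaussianFourier.integrable_cexp_neg_mul_sq_norm_add (V := E) (b := (b : ℂ))
    (by simpa using hb) 0 0).re
  refine h.congr (Eventually.of_forall fun x => ?_)
  simp only [zero_mul, add_zero]
  rw [show (-(b : ℂ) * (‖x‖ : ℂ) ^ 2) = ((-b * ‖x‖ ^ 2 : ℝ) : ℂ) by push_cast; ring]
  exact Complex.exp_ofReal_re _

theorem integrable_gaussWeight : Integrable (gaussWeight (E := E)) :=
  integrable_exp_neg_mul_norm_sq (by norm_num)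

theorem integrable_one_add_norm_mul_gaussWeight :
    Integrable (fun x : E => (1 + ‖x‖) * gaussWeight x) := by
  refine ((integrable_exp_neg_mul_norm_sq (E := E) (b := 1 / 4) (by norm_num)).const_mul 2).mono'
    (Continuous.aestronglyMeasurable (by fun_prop)) (Eventually.of_forall fun x => ?_)
  have hG := gaussWeight_pos x
  rw [Real.norm_of_nonneg (by positivity)]
  have e : gaussWeight x = Real.exp (-(1 / 4) * ‖x‖ ^ 2) * Real.exp (-(1 / 4 * ‖x‖ ^ 2)) := by
    rw [gaussWeight, ← Real.exp_add]; ring_nf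
  have h1 : 1 + ‖x‖ ≤ 2 * Real.exp (1 / 4 * ‖x‖ ^ 2) := by
    have := Real.add_one_le_exp (1 / 4 * ‖x‖ ^ 2)
    nlinarith [sq_nonneg (‖x‖ - 1), sq_nonneg (‖x‖ / 2 - 1)]
  rw [e, mul_left_comm, mul_comm (2 : ℝ)]
  gcongr
  calc _ ≤ 2 * Real.exp (1 / 4 * ‖x‖ ^ 2) * Real.exp (-(1 / 4 * ‖x‖ ^ 2)) := by gcongr
    _ = 2 := by rw [mul_assoc, ← Real.exp_add]; simp

theorem hasFDerivAt_gaussWeight (x : E) :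
    HasFDerivAt (gaussWeight (E := E)) ((-gaussWeight x) • innerSL ℝ x) x := by
  have h := (((hasStrictFDerivAt_norm_sq x).hasFDerivAt).const_mul (-(1 / 2) : ℝ)).exp
  refine h.congr_fderiv ?_
  ext v
  simp [gaussWeight]

/-- The product Gaussian weight. -/
noncomputable def gaussWeight₂ (p : E × E) : ℝ := gaussWeight p.1 * gaussWeight p.2

theorem gaussWeight₂_pos (p : E × E) : 0 < gaussWeight₂ p :=
  mul_pos (gaussWeight_pos _) (gaussWeight_pos _)

@[fun_prop]
theorem continuous_gaussWeight₂ : Continuous (gaussWeight₂ (E := E)) := by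
  unfold gaussWeight₂; fun_prop

theorem integrable_gaussBound (C : ℝ) :
    Integrable (fun p : E × E => C * ((1 + ‖p.1‖) * (1 + ‖p.2‖)) * gaussWeight₂ p) := by
  have h := (integrable_one_add_norm_mul_gaussWeight (E := E)).mul_prod
    (integrable_one_add_norm_mul_gaussWeight (E := E))
  refine (h.const_mul C).congr (Eventually.of_forall fun p => ?_)
  simp only [gaussWeight₂]; ring

theorem integrable_mul_gaussWeight₂ {K : E × E → ℝ} (hK : Continuous K) {C : ℝ}
    (hC : ∀ p, |K p| ≤ C * ((1 + ‖p.1‖) * (1 + ‖p.2‖))) :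
    Integrable (fun p => K p * gaussWeight₂ p) := by
  refine (integrable_gaussBound C).mono' (hK.mul continuous_gaussWeight₂).aestronglyMeasurable
    (Eventually.of_forall fun p => ?_)
  rw [norm_mul, Real.norm_of_nonneg (gaussWeight₂_pos p).le, Real.norm_eq_abs]
  exact mul_le_mul_of_nonneg_right (hC p) (gaussWeight₂_pos p).le

/-- Rotation of `E × E` by the angle with cosine `c` and sine `s`. -/
noncomputable def prodRotation (c s : ℝ) (h : c ^ 2 + s ^ 2 = 1) :
    WithLp 2 (E × E) ≃ₗᵢ[ℝ] WithLp 2 (E × E) where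
  toFun p := WithLp.toLp 2 (c • p.fst - s • p.snd, s • p.fst + c • p.snd)
  invFun p := WithLp.toLp 2 (c • p.fst + s • p.snd, (-s) • p.fst + c • p.snd)
  map_add' p q := by
    refine WithLp.ofLp_injective 2 (Prod.ext ?_ ?_) <;> simp <;> module
  map_smul' a p := by
    refine WithLp.ofLp_injective 2 (Prod.ext ?_ ?_) <;> simp <;> module
  left_inv p := by
    refine WithLp.ofLp_injective 2 (Prod.ext ?_ ?_)
    · simp only [WithLp.toLp_fst, WithLp.toLp_snd]
      calc _ = (c ^ 2 + s ^ 2) • p.fst := by module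
        _ = _ := by rw [h, one_smul]; rfl
    · simp only [WithLp.toLp_fst, WithLp.toLp_snd]
      calc _ = (c ^ 2 + s ^ 2) • p.snd := by module
        _ = _ := by rw [h, one_smul]; rfl
  right_inv p := by
    refine WithLp.ofLp_injective 2 (Prod.ext ?_ ?_)
    · simp only [WithLp.toLp_fst, WithLp.toLp_snd]
      calc _ = (c ^ 2 + s ^ 2) • p.fst := by module
        _ = _ := by rw [h, one_smul]; rfl
    · simp only [WithLp.toLp_fst, WithLp.toLp_snd]
      calc _ = (c ^ 2 + s ^ 2) • p.snd := by module
        _ = _ := by rw [h, one_smul]; rfl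
  norm_map' p := by
    rw [← sq_eq_sq₀ (norm_nonneg _) (norm_nonneg _), WithLp.prod_norm_sq_eq_of_L2,
      WithLp.prod_norm_sq_eq_of_L2]
    simp only [LinearEquiv.coe_mk, LinearMap.coe_mk, AddHom.coe_mk, WithLp.toLp_fst,
      WithLp.toLp_snd]
    rw [norm_sub_sq_real, norm_add_sq_real]
    simp only [norm_smul, mul_pow, Real.norm_eq_abs, sq_abs, real_inner_smul_left,
      real_inner_smul_right]
    linear_combination (‖p.fst‖ ^ 2 + ‖p.snd‖ ^ 2) * h

/-- The product weight depends only on `‖p.1‖² + ‖p.2‖²`. Since `E × E` carries the sup norm, the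
rotation is an isometry only on `WithLp 2 (E × E)`, and the change of variables passes through that
space. -/
theorem integral_rotation (c s : ℝ) (h : c ^ 2 + s ^ 2 = 1) (F : E × E → ℝ) :
    ∫ p : E × E, F (c • p.1 - s • p.2, s • p.1 + c • p.2) * gaussWeight₂ p =
      ∫ p : E × E, F p * gaussWeight₂ p := by
  have hm1 := WithLp.volume_preserving_toLp E E
  have hm2 := (prodRotation (E := E) c s h).measurePreserving
  have e1 : MeasurableEmbedding (WithLp.toLp 2 : E × E → WithLp 2 (E × E)) :=
    (WithLp.homeomorphProd 2 E E).symm.measurableEmbedding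
  have e2 : MeasurableEmbedding (prodRotation (E := E) c s h) :=
    (prodRotation (E := E) c s h).toHomeomorph.measurableEmbedding
  set H : WithLp 2 (E × E) → ℝ := fun p => F (WithLp.ofLp p) * gaussWeight₂ (WithLp.ofLp p)
  have h1 : ∫ p : E × E, F p * gaussWeight₂ p = ∫ p, H p := hm1.integral_comp e1 H
  rw [h1, ← hm2.integral_comp e2 H, ← hm1.integral_comp e1]
  refine integral_congr_ae (Eventually.of_forall fun p => ?_)
  have hp : WithLp.ofLp (prodRotation c s h (WithLp.toLp 2 p)) =
    (c • p.1 - s • p.2, s • p.1 + c • p.2) := rfl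
  simp only [H, hp]
  congr 1
  have hn : ‖c • p.1 - s • p.2‖ ^ 2 + ‖s • p.1 + c • p.2‖ ^ 2 = ‖p.1‖ ^ 2 + ‖p.2‖ ^ 2 := by
    rw [norm_sub_sq_real, norm_add_sq_real]
    simp only [norm_smul, mul_pow, Real.norm_eq_abs, sq_abs, real_inner_smul_left,
      real_inner_smul_right]
    linear_combination (‖p.1‖ ^ 2 + ‖p.2‖ ^ 2) * h
  simp only [gaussWeight₂, gaussWeight]
  rw [← Real.exp_add, ← Real.exp_add]
  congr 1
  linear_combination (1 / 2 : ℝ) * hn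

end Gaussian

/-! ### Gaussian integration by parts and interpolation by rotations -/

section Gaussian

variable {E : Type*} [NormedAddCommGroup E] [InnerProductSpace ℝ E] [FiniteDimensional ℝ E]
  [MeasurableSpace E] [BorelSpace E]

/-- Gaussian integration by parts. -/
theorem integral_mul_inner_mul_gaussWeight {u : E → ℝ} (hu : ContDiff ℝ 1 u) {C : ℝ}
    (hC : ∀ x, |u x| ≤ C) (hC' : ∀ x, ‖fderiv ℝ u x‖ ≤ C) (v : E) :
    ∫ x, u x * ⟪v, x⟫_ℝ * gaussWeight x = ∫ x, fderiv ℝ u x v * gaussWeight x := by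
  have hC0 : 0 ≤ C := (abs_nonneg _).trans (hC 0)
  have hucont := hu.continuous
  have hcd : Continuous fun x => fderiv ℝ u x v :=
    (hu.continuous_fderiv (by simp)).clm_apply continuous_const
  have hG : ∀ x : E, fderiv ℝ gaussWeight x v = -(⟪v, x⟫_ℝ * gaussWeight x) := fun x => by
    rw [(hasFDerivAt_gaussWeight x).fderiv]
    simp [real_inner_comm]; ring
  have i1 : Integrable (fun x => fderiv ℝ u x v * gaussWeight x) := by
    refine (integrable_gaussWeight.const_mul (C * ‖v‖)).mono'
      (Continuous.aestronglyMeasurable (by fun_prop)) (Eventually.of_forall fun x => ?_)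
    rw [norm_mul, Real.norm_of_nonneg (gaussWeight_pos x).le]
    have := (gaussWeight_pos x).le
    gcongr
    exact ((fderiv ℝ u x).le_opNorm v).trans (by gcongr; exact hC' x)
  have i2 : Integrable (fun x => u x * fderiv ℝ gaussWeight x v) := by
    simp only [hG]
    refine ((integrable_one_add_norm_mul_gaussWeight).const_mul (C * ‖v‖)).mono'
      (Continuous.aestronglyMeasurable (by fun_prop)) (Eventually.of_forall fun x => ?_)
    rw [norm_mul, norm_neg, norm_mul, Real.norm_of_nonneg (gaussWeight_pos x).le]
    have := (gaussWeight_pos x).le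
    calc _ ≤ C * (‖v‖ * (1 + ‖x‖) * gaussWeight x) := by
          gcongr
          · exact hC x
          · refine (norm_inner_le_norm v x).trans ?_
            gcongr; linarith
      _ = _ := by ring
  have i3 : Integrable (fun x => u x * gaussWeight x) := by
    refine (integrable_gaussWeight.const_mul C).mono'
      (Continuous.aestronglyMeasurable (by fun_prop)) (Eventually.of_forall fun x => ?_)
    rw [norm_mul, Real.norm_of_nonneg (gaussWeight_pos x).le]
    exact mul_le_mul_of_nonneg_right (hC x) (gaussWeight_pos x).le
  have := integral_mul_fderiv_eq_neg_fderiv_mul_of_integrable (v := v) i1 i2 i3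
    (fun x _ => hu.differentiable (by simp) x)
    (fun x _ => (hasFDerivAt_gaussWeight x).differentiableAt)
  simp only [hG, mul_neg] at this
  rw [integral_neg, neg_inj] at this
  simpa only [mul_assoc] using this

/-- The Gaussian Poincaré inequality, for the unnormalised weight. -/
theorem gaussian_poincare {f : E → ℝ} (hf : ContDiff ℝ 1 f) (hs : HasCompactSupport f) :
    (∫ x : E, gaussWeight x) * (∫ x, f x ^ 2 * gaussWeight x) - (∫ x, f x * gaussWeight x) ^ 2 ≤
      (∫ x : E, gaussWeight x) * ∫ x, ‖fderiv ℝ f x‖ ^ 2 * gaussWeight x := by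
  have hfc := hf.continuous
  have hfd := hf.continuous_fderiv (by simp)
  obtain ⟨C₁, hC₁⟩ := hs.exists_bound_of_continuous hfc
  obtain ⟨C₂, hC₂⟩ := (hs.fderiv (𝕜 := ℝ)).exists_bound_of_continuous hfd
  set C := max C₁ C₂
  have hC : ∀ x, |f x| ≤ C := fun x => (hC₁ x).trans (le_max_left _ _)
  have hC' : ∀ x, ‖fderiv ℝ f x‖ ≤ C := fun x => (hC₂ x).trans (le_max_right _ _)
  have hC0 : 0 ≤ C := (abs_nonneg _).trans (hC 0)
  set Z := ∫ x : E, gaussWeight x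
  set D := ∫ x, ‖fderiv ℝ f x‖ ^ 2 * gaussWeight x with hD
  set X : ℝ → E × E → E := fun t p => Real.cos t • p.1 + Real.sin t • p.2 with hX
  set X' : ℝ → E × E → E := fun t p => (-Real.sin t) • p.1 + Real.cos t • p.2 with hX'
  -- As `t` goes from `0` to `π/2`, `X t` turns the first variable into the independent second one,
  -- so `Φ` goes from `Z ∫ f² G` to `(∫ f G)²`, with `G` the Gaussian weight. The variance is the
  -- total decrease of `Φ`.
  set Φ : ℝ → ℝ := fun t => ∫ p : E × E, f p.1 * f (X t p) * gaussWeight₂ p with hΦ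
  have hone : ∀ p : E × E, 1 ≤ (1 + ‖p.1‖) * (1 + ‖p.2‖) := fun p =>
    one_le_mul_of_one_le_of_one_le (by linarith [norm_nonneg p.1]) (by linarith [norm_nonneg p.2])
  have hX'n : ∀ t p, ‖X' t p‖ ≤ (1 + ‖p.1‖) * (1 + ‖p.2‖) := by
    intro t p
    have h1 : ‖(-Real.sin t) • p.1‖ ≤ ‖p.1‖ := by
      rw [norm_smul, norm_neg]
      exact mul_le_of_le_one_left (norm_nonneg _) (Real.abs_sin_le_one t)
    have h2 : ‖Real.cos t • p.2‖ ≤ ‖p.2‖ := by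
      rw [norm_smul]
      exact mul_le_of_le_one_left (norm_nonneg _) (Real.abs_cos_le_one t)
    have := norm_add_le ((-Real.sin t) • p.1) (Real.cos t • p.2)
    simp only [hX']
    nlinarith [mul_nonneg (norm_nonneg p.1) (norm_nonneg p.2)]
  have hderiv : ∀ t, HasDerivAt Φ
      (∫ p : E × E, f p.1 * fderiv ℝ f (X t p) (X' t p) * gaussWeight₂ p) t := by
    intro t
    refine (hasDerivAt_integral_of_dominated_loc_of_deriv_le (s := univ)
      (F := fun t p => f p.1 * f (X t p) * gaussWeight₂ p)
      (F' := fun t p => f p.1 * fderiv ℝ f (X t p) (X' t p) * gaussWeight₂ p)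
      (bound := fun p => C ^ 2 * ((1 + ‖p.1‖) * (1 + ‖p.2‖)) * gaussWeight₂ p)
      univ_mem ?_ ?_ ?_ ?_ (integrable_gaussBound _) ?_).2
    · exact Eventually.of_forall fun t => Continuous.aestronglyMeasurable (by fun_prop)
    · refine integrable_mul_gaussWeight₂ (C := C ^ 2) (by fun_prop) fun p => ?_
      rw [abs_mul, sq]
      calc _ ≤ C * C := by gcongr <;> apply hC
        _ ≤ _ := le_mul_of_one_le_right (by positivity) (hone p)
    · exact Continuous.aestronglyMeasurable (by fun_prop)
    · refine Eventually.of_forall fun p t _ => ?_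
      rw [norm_mul, norm_mul, Real.norm_of_nonneg (gaussWeight₂_pos p).le]
      have := (gaussWeight₂_pos p).le
      have h1 : ‖fderiv ℝ f (X t p) (X' t p)‖ ≤ C * ((1 + ‖p.1‖) * (1 + ‖p.2‖)) :=
        ((fderiv ℝ f _).le_opNorm _).trans (by gcongr; exacts [hC' _, hX'n t p])
      calc _ ≤ C * (C * ((1 + ‖p.1‖) * (1 + ‖p.2‖))) * gaussWeight₂ p := by
            gcongr; exact hC p.1
        _ = _ := by ring
    · refine Eventually.of_forall fun p t _ => ?_
      have hXd : HasDerivAt (fun t => X t p) (X' t p) t :=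
        ((Real.hasDerivAt_cos t).smul_const p.1).add ((Real.hasDerivAt_sin t).smul_const p.2)
      exact (((hf.differentiable (by simp) (X t p)).hasFDerivAt.comp_hasDerivAt t hXd).const_mul
        (f p.1)).mul_const _
  have hD2 : ∫ p : E × E, ‖fderiv ℝ f p.1‖ ^ 2 * gaussWeight₂ p = Z * D := by
    rw [mul_comm Z, hD, ← integral_prod_mul]
    exact integral_congr_ae (Eventually.of_forall fun p => by simp only [gaussWeight₂]; ring)
  have hbound : ∀ t ∈ Icc 0 (Real.pi / 2), -(Real.sin t * (Z * D)) ≤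
      ∫ p : E × E, f p.1 * fderiv ℝ f (X t p) (X' t p) * gaussWeight₂ p := by
    intro t ht
    set c := Real.cos t
    set s := Real.sin t
    have hcs : c ^ 2 + s ^ 2 = 1 := Real.cos_sq_add_sin_sq t
    have hs0 : 0 ≤ s := Real.sin_nonneg_of_nonneg_of_le_pi ht.1 (by linarith [ht.2, Real.pi_pos])
    have hs1 : |s| ≤ 1 := Real.abs_sin_le_one t
    -- In the rotated variables `X t` and `X' t` become the two coordinates `p.1` and `p.2`, so the
    -- integrand is linear in `p.2` apart from the factor `f (c • p.1 - s • p.2)`.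
    rw [← integral_rotation c s hcs]
    have e1 : ∀ p : E × E, X t (c • p.1 - s • p.2, s • p.1 + c • p.2) = p.1 := fun p => by
      simp only [hX]
      calc _ = (c ^ 2 + s ^ 2) • p.1 := by module
        _ = _ := by rw [hcs, one_smul]
    have e2 : ∀ p : E × E, X' t (c • p.1 - s • p.2, s • p.1 + c • p.2) = p.2 := fun p => by
      simp only [hX']
      calc _ = (c ^ 2 + s ^ 2) • p.2 := by module
        _ = _ := by rw [hcs, one_smul]
    simp only [e1, e2]
    have hgc : Continuous (gradient f) :=
      (InnerProductSpace.toDual ℝ E).symm.continuous.comp hfd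
    have hgn : ∀ x, ‖gradient f x‖ = ‖fderiv ℝ f x‖ := fun x =>
      LinearIsometryEquiv.norm_map _ _
    have i1 : Integrable (fun p : E × E => f (c • p.1 - s • p.2) * fderiv ℝ f p.1 p.2 *
        gaussWeight₂ p) := by
      refine integrable_mul_gaussWeight₂ (C := C ^ 2) (by fun_prop) fun p => ?_
      rw [abs_mul, sq, mul_assoc]
      gcongr
      · exact hC _
      · refine ((fderiv ℝ f p.1).le_opNorm _).trans ?_
        gcongr
        · exact hC' _
        · nlinarith [norm_nonneg p.1, norm_nonneg p.2, mul_nonneg (norm_nonneg p.1) (norm_nonneg p.2)]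
    have hfb : ∀ p : E × E, |fderiv ℝ f (c • p.1 - s • p.2) (gradient f p.1)| ≤
        1 / 2 * ‖fderiv ℝ f (c • p.1 - s • p.2)‖ ^ 2 + 1 / 2 * ‖fderiv ℝ f p.1‖ ^ 2 := by
      intro p
      refine ((fderiv ℝ f _).le_opNorm _).trans ?_
      rw [hgn]
      nlinarith [sq_nonneg (‖fderiv ℝ f (c • p.1 - s • p.2)‖ - ‖fderiv ℝ f p.1‖)]
    have hsqb : ∀ x, ‖fderiv ℝ f x‖ ^ 2 ≤ C ^ 2 := fun x => by gcongr; exact hC' x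
    have i2 : Integrable (fun p : E × E => fderiv ℝ f (c • p.1 - s • p.2) (gradient f p.1) *
        gaussWeight₂ p) := by
      refine integrable_mul_gaussWeight₂ (C := C ^ 2) (by fun_prop) fun p => ?_
      refine (hfb p).trans (le_trans ?_ (le_mul_of_one_le_right (by positivity) (hone p)))
      linarith [hsqb (c • p.1 - s • p.2), hsqb p.1]
    have i3 : Integrable (fun p : E × E => ‖fderiv ℝ f (c • p.1 - s • p.2)‖ ^ 2 *
        gaussWeight₂ p) := by
      refine integrable_mul_gaussWeight₂ (C := C ^ 2) (by fun_prop) fun p => ?_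
      rw [abs_of_nonneg (by positivity)]
      exact (hsqb _).trans (le_mul_of_one_le_right (by positivity) (hone p))
    have i4 : Integrable (fun p : E × E => ‖fderiv ℝ f p.1‖ ^ 2 * gaussWeight₂ p) := by
      refine integrable_mul_gaussWeight₂ (C := C ^ 2) (by fun_prop) fun p => ?_
      rw [abs_of_nonneg (by positivity)]
      exact (hsqb _).trans (le_mul_of_one_le_right (by positivity) (hone p))
    -- For fixed first variable `z`, the factor linear in `w` is `⟪∇f(z), w⟫`. Gaussian integration
    -- by parts turns it into a derivative of `w ↦ f (c • z - s • w)`, whence the factor `-s`.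
    have h3 : ∫ p : E × E, f (c • p.1 - s • p.2) * fderiv ℝ f p.1 p.2 * gaussWeight₂ p =
        ∫ p : E × E, -s * (fderiv ℝ f (c • p.1 - s • p.2) (gradient f p.1) * gaussWeight₂ p) := by
      rw [Measure.volume_eq_prod, integral_prod _ i1, integral_prod _ (i2.const_mul _)]
      refine integral_congr_ae (Eventually.of_forall fun z => ?_)
      simp only [gaussWeight₂]
      set u : E → ℝ := fun w => f (c • z - s • w) with hu
      have hu1 : ContDiff ℝ 1 u := hf.comp (by fun_prop)
      have hud : ∀ w, HasFDerivAt u (-s • fderiv ℝ f (c • z - s • w)) w := by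
        intro w
        have h1 : HasFDerivAt (fun w : E => c • z - s • w)
            (-(s • ContinuousLinearMap.id ℝ E)) w :=
          ((hasFDerivAt_id w).const_smul s).const_sub (c • z)
        refine ((hf.differentiable (by simp) _).hasFDerivAt.comp w h1).congr_fderiv ?_
        ext v; simp
      have h := integral_mul_inner_mul_gaussWeight hu1 (C := C) (fun w => hC _)
        (fun w => by
          rw [(hud w).fderiv, norm_smul, norm_neg]
          exact (mul_le_of_le_one_left (norm_nonneg _) hs1).trans (hC' _)) (gradient f z)
      simp only [(hud _).fderiv, inner_gradient_left] at h
      calc _ = gaussWeight z * ∫ w, u w * fderiv ℝ f z w * gaussWeight w := by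
            rw [← integral_const_mul]; congr 1; ext w; ring
        _ = gaussWeight z * ∫ w, (-s • fderiv ℝ f (c • z - s • w)) (gradient f z) *
              gaussWeight w := by rw [h]
        _ = _ := by
            rw [← integral_const_mul]; congr 1; ext w; simp; ring
    have h4 : ∫ p : E × E, ‖fderiv ℝ f (c • p.1 - s • p.2)‖ ^ 2 * gaussWeight₂ p = Z * D := by
      rw [← hD2]
      exact integral_rotation c s hcs fun p => ‖fderiv ℝ f p.1‖ ^ 2
    -- By the arithmetic–geometric mean inequality; both squares integrate to `Z * D` by rotation
    -- invariance.
    have h5 : ∫ p : E × E, fderiv ℝ f (c • p.1 - s • p.2) (gradient f p.1) * gaussWeight₂ p ≤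
        Z * D := by
      have : Z * D = ∫ p : E × E, (1 / 2 * (‖fderiv ℝ f (c • p.1 - s • p.2)‖ ^ 2 * gaussWeight₂ p)
          + 1 / 2 * (‖fderiv ℝ f p.1‖ ^ 2 * gaussWeight₂ p)) := by
        rw [integral_add (i3.const_mul _) (i4.const_mul _), integral_const_mul,
          integral_const_mul, h4, hD2]
        ring
      rw [this]
      refine integral_mono i2 ((i3.const_mul _).add (i4.const_mul _)) fun p => ?_
      have := mul_le_mul_of_nonneg_right ((le_abs_self _).trans (hfb p)) (gaussWeight₂_pos p).le
      simp only
      linarith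
    rw [h3, integral_const_mul]
    nlinarith [mul_le_mul_of_nonneg_left h5 hs0]
  have hΨ : ∀ t, HasDerivAt (fun t => Φ t - Z * D * Real.cos t)
      ((∫ p : E × E, f p.1 * fderiv ℝ f (X t p) (X' t p) * gaussWeight₂ p) -
        Z * D * (-Real.sin t)) t :=
    fun t => (hderiv t).sub ((Real.hasDerivAt_cos t).const_mul _)
  -- The cosine drops by exactly 1 over the interval, which gives the Gaussian constant 1.
  have hmono : MonotoneOn (fun t => Φ t - Z * D * Real.cos t) (Icc 0 (Real.pi / 2)) := by
    refine monotoneOn_of_deriv_nonneg (convex_Icc _ _)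
      (fun t _ => (hΨ t).continuousAt.continuousWithinAt)
      (fun t _ => (hΨ t).differentiableAt.differentiableWithinAt) fun t ht => ?_
    rw [(hΨ t).deriv]
    linarith [hbound t (interior_subset ht)]
  have hpi : (0 : ℝ) ≤ Real.pi / 2 := by positivity
  have hfin := hmono (left_mem_Icc.2 hpi) (right_mem_Icc.2 hpi) hpi
  have hΦ0 : Φ 0 = Z * ∫ x, f x ^ 2 * gaussWeight x := by
    rw [mul_comm Z, ← integral_prod_mul]
    refine integral_congr_ae (Eventually.of_forall fun p => ?_)
    simp [hX, gaussWeight₂]; ring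
  have hΦ1 : Φ (Real.pi / 2) = (∫ x, f x * gaussWeight x) ^ 2 := by
    rw [sq, ← integral_prod_mul]
    refine integral_congr_ae (Eventually.of_forall fun p => ?_)
    simp [hX, gaussWeight₂]; ring
  simp only [Real.cos_zero, Real.cos_pi_div_two, hΦ0, hΦ1] at hfin
  linarith

end Gaussian

/-! ### Polar coordinates and radial cutoffs -/

section Polar

variable {E : Type*} [NormedAddCommGroup E] [InnerProductSpace ℝ E] [FiniteDimensional ℝ E]
  [MeasurableSpace E] [BorelSpace E]

/-- The surface measure of the unit sphere. -/
noncomputable abbrev surfaceMeasure (E : Type*) [NormedAddCommGroup E] [InnerProductSpace ℝ E]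
    [FiniteDimensional ℝ E] [MeasurableSpace E] [BorelSpace E] :
    Measure (Metric.sphere (0 : E) 1) := (volume : Measure E).toSphere

/-- The homeomorphism `E \ {0} ≃ S × (0, ∞)` preserves the relevant measures, and the removed origin
is null; Fubini then separates the angle from the radius. -/
theorem integral_polar [Nontrivial E] {F : E → ℝ} (hF : Integrable F) :
    ∫ x, F x = ∫ θ, (∫ r in Ioi (0 : ℝ), r ^ (Module.finrank ℝ E - 1) * F (r • (θ : E)))
      ∂surfaceMeasure E := by
  have hmp := (volume : Measure E).measurePreserving_homeomorphUnitSphereProd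
  have hme : MeasurableEmbedding (homeomorphUnitSphereProd E) :=
    Homeomorph.measurableEmbedding _
  set K : Metric.sphere (0 : E) 1 × Ioi (0 : ℝ) → ℝ := fun p => F (p.2.1 • (p.1 : E)) with hK
  have hKF : ∀ x : ({0}ᶜ : Set E), K (homeomorphUnitSphereProd E x) = F x := by
    intro x
    have hx : ‖(x : E)‖ ≠ 0 := norm_ne_zero_iff.2 x.2
    simp [hK, smul_smul, hx]
  have hi : Integrable (fun x : ({0}ᶜ : Set E) => F x) (Measure.comap Subtype.val volume) := by
    have := (integrableOn_iff_comap_subtypeVal (μ := volume) (f := F)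
      (measurableSet_singleton (0 : E)).compl).1 hF.integrableOn
    exact this
  have hKi : Integrable K ((surfaceMeasure E).prod
      (Measure.volumeIoiPow (Module.finrank ℝ E - 1))) := by
    rw [← hmp.integrable_comp_emb hme]
    exact hi.congr (Eventually.of_forall fun x => (hKF x).symm)
  calc ∫ x, F x = ∫ x : ({0}ᶜ : Set E), F x ∂(Measure.comap Subtype.val volume) := by
        rw [integral_subtype_comap (measurableSet_singleton _).compl fun x => F x,
          restrict_compl_singleton]
    _ = ∫ x : ({0}ᶜ : Set E), K (homeomorphUnitSphereProd E x) ∂(Measure.comap Subtype.val volume) := by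
        simp only [hKF]
    _ = ∫ p, K p ∂((surfaceMeasure E).prod
          (Measure.volumeIoiPow (Module.finrank ℝ E - 1))) := hmp.integral_comp hme K
    _ = _ := by
        rw [integral_prod _ hKi]
        refine integral_congr_ae (Eventually.of_forall fun θ => ?_)
        simp only [Measure.volumeIoiPow, ENNReal.ofReal, hK]
        rw [integral_withDensity_eq_integral_smul,
          integral_subtype_comap measurableSet_Ioi fun a =>
            Real.toNNReal (a ^ (Module.finrank ℝ E - 1)) • F (a • (θ : E)),
          setIntegral_congr_fun measurableSet_Ioi fun x hx => ?_]
        · rw [NNReal.smul_def, Real.coe_toNNReal _ (pow_nonneg hx.out.le _), smul_eq_mul]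
        · exact (measurable_subtype_coe.pow_const _).real_toNNReal

theorem integral_radial [Nontrivial E] (f : ℝ → ℝ) :
    ∫ x : E, f ‖x‖ = (surfaceMeasure E).real univ *
      ∫ r in Ioi (0 : ℝ), r ^ (Module.finrank ℝ E - 1) * f r := by
  rw [integral_fun_norm_addHaar, Measure.toSphere_real_apply_univ, nsmul_eq_mul]
  simp only [smul_eq_mul]
  ring

theorem surfaceMeasure_real_pos [Nontrivial E] : 0 < (surfaceMeasure E).real univ := by
  rw [measureReal_def]
  refine ENNReal.toReal_pos ?_ (measure_ne_top _ _)
  rw [Ne, Measure.measure_univ_eq_zero]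
  exact Measure.toSphere_ne_zero _

theorem integrable_surface {K : Metric.sphere (0 : E) 1 → ℝ} (hK : Continuous K) :
    Integrable K (surfaceMeasure E) :=
  hK.integrable_of_hasCompactSupport (HasCompactSupport.of_compactSpace K)

/-- A function on `S × (0, ∞)` that is continuous with compact radial support is integrable. -/
theorem integrable_sphere_prod {K : Metric.sphere (0 : E) 1 × ℝ → ℝ}
    (hK : ContinuousOn K (univ ×ˢ Ioi 0)) {a b : ℝ} (ha : 0 < a)
    (hz : ∀ θ r, 0 < r → r ∉ Icc a b → K (θ, r) = 0) :
    Integrable K ((surfaceMeasure E).prod (volume.restrict (Ioi 0))) := by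
  have h1 : IntegrableOn K (univ ×ˢ Icc a b) ((surfaceMeasure E).prod volume) := by
    refine ContinuousOn.integrableOn_compact (isCompact_univ.prod isCompact_Icc)
      (hK.mono (prod_mono_right fun x hx => ha.trans_le hx.1))
  have h2 : IntegrableOn K (univ ×ˢ Ioi 0) ((surfaceMeasure E).prod volume) := by
    refine h1.of_forall_sdiff_eq_zero (MeasurableSet.univ.prod measurableSet_Ioi) ?_
    rintro ⟨θ, r⟩ ⟨hr, hr'⟩
    exact hz θ r hr.2 fun h => hr' ⟨mem_univ _, h⟩
  rw [IntegrableOn, ← Measure.prod_restrict, Measure.restrict_univ] at h2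
  exact h2

theorem hasFDerivAt_norm' {x : E} (hx : x ≠ 0) :
    HasFDerivAt (fun y : E => ‖y‖) (‖x‖⁻¹ • innerSL ℝ x) x := by
  have hn : ‖x‖ ≠ 0 := norm_ne_zero_iff.2 hx
  have h := (hasStrictFDerivAt_norm_sq x).hasFDerivAt.sqrt (pow_ne_zero 2 hn)
  simp only [Real.sqrt_sq (norm_nonneg _)] at h
  refine h.congr_fderiv ?_
  ext v
  simp
  field_simp

theorem hasFDerivAt_normalize {x : E} (hx : x ≠ 0) :
    HasFDerivAt (fun y : E => ‖y‖⁻¹ • y)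
      (‖x‖⁻¹ • (ContinuousLinearMap.id ℝ E -
        ((‖x‖⁻¹ • innerSL ℝ x).smulRight (‖x‖⁻¹ • x)))) x := by
  have hn : ‖x‖ ≠ 0 := norm_ne_zero_iff.2 hx
  have h := ((hasDerivAt_inv hn).comp_hasFDerivAt x (hasFDerivAt_norm' hx)).smul (hasFDerivAt_id x)
  refine h.congr_fderiv ?_
  ext v
  simp [smul_smul, smul_sub]
  field_simp
  module

/-- The origin is the only point where the norm, and possibly `V ∘ ‖·‖`, fails to be smooth; cutoffs
vanishing near it remove the problem. -/
theorem contDiff_of_eq_zero_near {F : E → ℝ} {k : WithTop ℕ∞} {δ : ℝ} (hδ : 0 < δ)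
    (hz : ∀ x, ‖x‖ < δ → F x = 0) (hF : ∀ x, x ≠ 0 → ContDiffAt ℝ k F x) : ContDiff ℝ k F := by
  rw [contDiff_iff_contDiffAt]
  intro x
  by_cases hx : x = 0
  · subst hx
    refine (contDiffAt_const (c := (0 : ℝ))).congr_of_eventuallyEq ?_
    filter_upwards [Metric.ball_mem_nhds (0 : E) hδ] with y hy
    exact hz y (by simpa using hy)
  · exact hF x hx

theorem contDiffAt_logCutoff (k : ℕ) {r : ℝ} (hr : 0 < r) : ContDiffAt ℝ ∞ (logCutoff k) r := by
  have h1 : ContDiffAt ℝ ∞ (fun r => 2 - (Real.log r / ((k : ℝ) + 1)) ^ 2) r :=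
    contDiffAt_const.sub (((Real.contDiffAt_log.2 hr.ne').div_const _).pow 2)
  exact Real.smoothTransition.contDiff.contDiffAt.comp r h1

open Classical in
/-- The radial logarithmic cutoff on `E`, vanishing near the origin and near infinity. -/
noncomputable def cutoff (k : ℕ) (x : E) : ℝ := if x = 0 then 0 else logCutoff k ‖x‖

/-- The origin has to be excluded: `Real.log 0 = 0` makes `logCutoff k 0 = 1`, whereas the cutoff
must vanish there. -/
theorem cutoff_of_ne (k : ℕ) {x : E} (hx : x ≠ 0) : cutoff k x = logCutoff k ‖x‖ := if_neg hx

theorem cutoff_nonneg (k : ℕ) (x : E) : 0 ≤ cutoff k x := by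
  rw [cutoff]; split_ifs; exacts [le_rfl, logCutoff_nonneg _ _]

theorem cutoff_le_one (k : ℕ) (x : E) : cutoff k x ≤ 1 := by
  rw [cutoff]; split_ifs; exacts [zero_le_one, logCutoff_le_one _ _]

theorem cutoff_eq_zero_of_norm_lt {k : ℕ} {x : E} (hx : ‖x‖ < Real.exp (-(2 * (k + 1)))) :
    cutoff k x = 0 := by
  by_cases h : x = 0
  · simp [cutoff, h]
  · rw [cutoff_of_ne k h]
    exact logCutoff_eq_zero (norm_pos_iff.2 h) fun hm => absurd hm.1 (not_le.2 hx)

theorem cutoff_eq_zero_of_lt_norm {k : ℕ} {x : E} (hx : Real.exp (2 * (k + 1)) < ‖x‖) :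
    cutoff k x = 0 := by
  have h : x ≠ 0 := norm_pos_iff.1 ((Real.exp_pos _).trans hx)
  rw [cutoff_of_ne k h]
  exact logCutoff_eq_zero (norm_pos_iff.2 h) fun hm => absurd hm.2 (not_le.2 hx)

theorem eventually_cutoff_eq_one {x : E} (hx : x ≠ 0) : ∀ᶠ k : ℕ in atTop, cutoff k x = 1 := by
  filter_upwards [eventually_logCutoff_eq_one ‖x‖] with k hk
  rw [cutoff_of_ne k hx, hk]

theorem cutoff_eventuallyEq (k : ℕ) {x : E} (hx : x ≠ 0) :
    cutoff k =ᶠ[𝓝 x] fun y => logCutoff k ‖y‖ := by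
  filter_upwards [isOpen_compl_singleton.mem_nhds hx] with y hy using cutoff_of_ne k hy

theorem contDiff_cutoff (k : ℕ) : ContDiff ℝ ∞ (cutoff k : E → ℝ) := by
  refine contDiff_of_eq_zero_near (Real.exp_pos _) (fun x hx => cutoff_eq_zero_of_norm_lt hx)
    fun x hx => ?_
  refine ContDiffAt.congr_of_eventuallyEq ?_ (cutoff_eventuallyEq k hx)
  exact (contDiffAt_logCutoff k (norm_pos_iff.2 hx)).comp x (contDiffAt_norm ℝ hx)

theorem hasCompactSupport_cutoff (k : ℕ) : HasCompactSupport (cutoff k : E → ℝ) := by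
  refine HasCompactSupport.of_support_subset_isCompact
    (isCompact_closedBall (0 : E) (Real.exp (2 * (k + 1)))) fun x hx => ?_
  by_contra h
  refine hx (cutoff_eq_zero_of_lt_norm ?_)
  simpa using h

theorem hasFDerivAt_cutoff (k : ℕ) {x : E} (hx : x ≠ 0) :
    HasFDerivAt (cutoff k) ((logCutoffDeriv k ‖x‖ * ‖x‖⁻¹) • innerSL ℝ x) x := by
  have h := (hasDerivAt_logCutoff k (norm_pos_iff.2 hx)).comp_hasFDerivAt x (hasFDerivAt_norm' hx)
  rw [smul_smul] at h
  exact h.congr_of_eventuallyEq (cutoff_eventuallyEq k hx)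

theorem norm_fderiv_cutoff (k : ℕ) {x : E} (hx : x ≠ 0) :
    ‖fderiv ℝ (cutoff k) x‖ = |logCutoffDeriv k ‖x‖| := by
  have hn : ‖x‖ ≠ 0 := norm_ne_zero_iff.2 hx
  rw [(hasFDerivAt_cutoff k hx).fderiv, norm_smul, innerSL_apply_norm, norm_mul, norm_inv,
    norm_norm, mul_assoc, inv_mul_cancel₀ hn, mul_one, Real.norm_eq_abs]

end Polar

/-! ### The Poincaré inequality on the sphere -/

section Sphere

variable {E : Type*} [NormedAddCommGroup E] [InnerProductSpace ℝ E] [FiniteDimensional ℝ E]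
  [MeasurableSpace E] [BorelSpace E]

/-- The squared norm of the tangential part of the derivative of `g` at `x`, in the direction
orthogonal to the unit vector `θ`. -/
noncomputable def tangentialSq (g : E → ℝ) (x θ : E) : ℝ :=
  ‖fderiv ℝ g x‖ ^ 2 - (fderiv ℝ g x θ) ^ 2

/-- Pythagoras: if `u` represents `L`, the second covector is represented by `β` times the component
of `u` orthogonal to `θ`. -/
theorem norm_sq_radial_add_tangential (L : E →L[ℝ] ℝ) {θ : E} (hθ : ‖θ‖ = 1) (α β : ℝ) :
    ‖α • innerSL ℝ θ + β • L.comp (ContinuousLinearMap.id ℝ E - (innerSL ℝ θ).smulRight θ)‖ ^ 2 =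
      α ^ 2 + β ^ 2 * (‖L‖ ^ 2 - L θ ^ 2) := by
  obtain ⟨u, rfl⟩ := (InnerProductSpace.toDual ℝ E).surjective L
  have e : α • innerSL ℝ θ + β • ((InnerProductSpace.toDual ℝ E) u).comp
      (ContinuousLinearMap.id ℝ E - (innerSL ℝ θ).smulRight θ) =
      InnerProductSpace.toDual ℝ E (α • θ + β • (u - ⟪u, θ⟫_ℝ • θ)) := by
    ext v
    simp
    exact Or.inl (by ring)
  rw [e, LinearIsometryEquiv.norm_map, LinearIsometryEquiv.norm_map,
    InnerProductSpace.toDual_apply_apply, norm_add_sq_real, norm_smul, norm_smul, mul_pow, mul_pow,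
    norm_sub_sq_real, norm_smul, hθ]
  simp only [Real.norm_eq_abs, sq_abs, real_inner_smul_left, real_inner_smul_right,
    inner_sub_right, real_inner_self_eq_norm_sq, hθ, mul_one]
  rw [real_inner_comm u θ]
  ring

/-- The potential of the Gaussian weight. -/
noncomputable def gaussPotential (r : ℝ) : ℝ := 1 / 2 * r ^ 2

theorem isConvexPotential_gauss : IsConvexPotential gaussPotential where
  convex := by
    have : ConvexOn ℝ (Ioi (0 : ℝ)) fun r : ℝ => r ^ 2 :=
      (convexOn_pow 2).subset Ioi_subset_Ici_self (convex_Ioi 0)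
    exact this.smul (by norm_num)
  smooth := by unfold gaussPotential; fun_prop

theorem gaussWeight_eq (x : E) : gaussWeight x = Real.exp (-gaussPotential ‖x‖) := by
  rw [gaussWeight, gaussPotential, neg_mul]

theorem integrableOn_radialWeight_gauss [Nontrivial E] :
    IntegrableOn (radialWeight (Module.finrank ℝ E) gaussPotential) (Ioi 0) := by
  have h := (integrable_fun_norm_addHaar (volume : Measure E)
    (f := fun r => Real.exp (-gaussPotential r))).1
    (by simpa only [← gaussWeight_eq] using integrable_gaussWeight)
  exact h

/-- The derivative of `r^d e^{-r²/2}` is `(d - r²)` times the weight, and this function vanishes at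
both ends of `(0, ∞)`. -/
theorem integral_sq_radialWeight_gauss [Nontrivial E] :
    ∫ r in Ioi 0, r ^ 2 * radialWeight (Module.finrank ℝ E) gaussPotential r =
      Module.finrank ℝ E * ∫ r in Ioi 0, radialWeight (Module.finrank ℝ E) gaussPotential r := by
  have hd : 1 ≤ Module.finrank ℝ E := Module.finrank_pos
  have h0 := integrableOn_radialWeight_gauss (E := E)
  set d := Module.finrank ℝ E
  have h2 := isConvexPotential_gauss.integrableOn_pow_mul_radialWeight h0 2
  have hF : ∀ r : ℝ, HasDerivAt (fun r => r ^ d * Real.exp (-gaussPotential r))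
      (d * radialWeight d gaussPotential r - r ^ 2 * radialWeight d gaussPotential r) r := by
    intro r
    have h3 : HasDerivAt gaussPotential r r := by
      have := (hasDerivAt_pow 2 r).const_mul (1 / 2 : ℝ)
      exact this.congr_deriv (by push_cast; ring)
    refine ((hasDerivAt_pow d r).mul h3.neg.exp).congr_deriv ?_
    obtain ⟨m, hm⟩ : ∃ m, d = m + 1 := ⟨d - 1, by omega⟩
    simp only [radialWeight, Pi.neg_apply, hm, Nat.add_sub_cancel]
    ring
  have hlim : Tendsto (fun r => r ^ d * Real.exp (-gaussPotential r)) atTop (𝓝 0) := by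
    have h4 := (Real.tendsto_pow_mul_exp_neg_atTop_nhds_zero d).const_mul (Real.exp (1 / 2))
    rw [mul_zero] at h4
    refine squeeze_zero' ?_ ?_ h4
    · filter_upwards [eventually_ge_atTop 0] with r hr
      positivity
    · filter_upwards [eventually_ge_atTop 0] with r hr
      rw [mul_left_comm, ← Real.exp_add]
      gcongr
      rw [gaussPotential]
      nlinarith [sq_nonneg (r - 1)]
  have h5 := integral_Ioi_of_hasDerivAt_of_tendsto (a := 0)
    (hF 0).continuousAt.continuousWithinAt (fun r _ => hF r) ((h0.const_mul _).sub h2) hlim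
  rw [zero_pow (by omega), zero_mul, sub_zero] at h5
  rw [integral_sub (h0.const_mul _) h2, integral_const_mul] at h5
  linarith

/-- The function `x ↦ ‖x‖ g(x / ‖x‖)`, cut off near the origin and near infinity. -/
noncomputable def coneExtension (k : ℕ) (g : E → ℝ) (x : E) : ℝ :=
  ‖x‖ * cutoff k x * g (‖x‖⁻¹ • x)

theorem contDiff_coneExtension (k : ℕ) {g : E → ℝ} (hg : ContDiff ℝ 1 g) :
    ContDiff ℝ 1 (coneExtension k g) := by
  refine contDiff_of_eq_zero_near (Real.exp_pos (-(2 * ((k : ℝ) + 1)))) (fun x hx => ?_)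
    fun x hx => ?_
  · rw [coneExtension, cutoff_eq_zero_of_norm_lt hx]; ring
  · have hn : ContDiffAt ℝ 1 (fun x : E => ‖x‖) x := contDiffAt_norm ℝ hx
    refine (hn.mul ((contDiff_cutoff k).of_le (by simp)).contDiffAt).mul ?_
    exact hg.contDiffAt.comp x ((hn.inv (norm_ne_zero_iff.2 hx)).smul contDiffAt_id)

theorem hasCompactSupport_coneExtension (k : ℕ) (g : E → ℝ) :
    HasCompactSupport (coneExtension k g) := by
  have h : HasCompactSupport (fun x : E => ‖x‖ * cutoff k x) :=
    (hasCompactSupport_cutoff k).mul_left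
  exact h.mul_right

/-- The radial derivative acts on `r χ(r)` and yields `χ + r χ'`; in the tangential part the factor
`r` cancels the `1/r` from differentiating `x / ‖x‖`. -/
theorem norm_sq_fderiv_coneExtension (k : ℕ) {g : E → ℝ} (hg : ContDiff ℝ 1 g) {x : E}
    (hx : x ≠ 0) :
    ‖fderiv ℝ (coneExtension k g) x‖ ^ 2 =
      (logCutoff k ‖x‖ + ‖x‖ * logCutoffDeriv k ‖x‖) ^ 2 * g (‖x‖⁻¹ • x) ^ 2 +
      logCutoff k ‖x‖ ^ 2 * tangentialSq g (‖x‖⁻¹ • x) (‖x‖⁻¹ • x) := by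
  have hn : ‖x‖ ≠ 0 := norm_ne_zero_iff.2 hx
  set θ := ‖x‖⁻¹ • x with hθ
  have hθ1 : ‖θ‖ = 1 := by rw [hθ, norm_smul, norm_inv, norm_norm, inv_mul_cancel₀ hn]
  have hx' : x = ‖x‖ • θ := by rw [hθ, smul_smul, mul_inv_cancel₀ hn, one_smul]
  have h1 := (hasFDerivAt_norm' hx).mul (hasFDerivAt_cutoff k hx)
  have hg' : HasFDerivAt g (fderiv ℝ g θ) ((fun y : E => ‖y‖⁻¹ • y) x) :=
    (hg.differentiable (by simp) θ).hasFDerivAt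
  have h2 := HasFDerivAt.comp (g := g) (f := fun y : E => ‖y‖⁻¹ • y) x hg' (hasFDerivAt_normalize hx)
  have h3 : HasFDerivAt (coneExtension k g) _ x := h1.mul h2
  have e : fderiv ℝ (coneExtension k g) x =
      ((logCutoff k ‖x‖ + ‖x‖ * logCutoffDeriv k ‖x‖) * g θ) • innerSL ℝ θ +
      logCutoff k ‖x‖ • (fderiv ℝ g θ).comp
        (ContinuousLinearMap.id ℝ E - (innerSL ℝ θ).smulRight θ) := by
    rw [h3.fderiv]
    have hi : innerSL ℝ x = ‖x‖ • innerSL ℝ θ := by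
      conv_lhs => rw [hx', map_smul]
    rw [← hθ, hi]
    ext v
    simp only [add_apply, smul_apply,
      ContinuousLinearMap.comp_apply, sub_apply,
      ContinuousLinearMap.id_apply, ContinuousLinearMap.smulRight_apply, innerSL_apply_apply,
      smul_eq_mul, map_smul, map_sub, Pi.mul_apply, cutoff_of_ne k hx]
    field_simp
    ring
  rw [e, norm_sq_radial_add_tangential _ hθ1, tangentialSq]
  ring

theorem integral_polar_mul [Nontrivial E] {F : E → ℝ} (hF : Integrable F) {a : ℝ → ℝ}
    {K : Metric.sphere (0 : E) 1 → ℝ}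
    (h : ∀ (θ : Metric.sphere (0 : E) 1) (r : ℝ), 0 < r → F (r • (θ : E)) = a r * K θ) :
    ∫ x, F x = (∫ r in Ioi (0 : ℝ), r ^ (Module.finrank ℝ E - 1) * a r) *
      ∫ θ, K θ ∂surfaceMeasure E := by
  rw [integral_polar hF, ← integral_const_mul]
  refine integral_congr_ae (Eventually.of_forall fun θ => ?_)
  simp only
  rw [← integral_mul_const]
  refine setIntegral_congr_fun measurableSet_Ioi fun r hr => ?_
  simp only [h θ r hr, mul_assoc]

theorem sphere_coe_ne_zero {r : ℝ} (hr : 0 < r) (θ : Metric.sphere (0 : E) 1) :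
    r • (θ : E) ≠ 0 ∧ ‖r • (θ : E)‖ = r ∧ ‖r • (θ : E)‖⁻¹ • r • (θ : E) = θ := by
  have h : ‖r • (θ : E)‖ = r := by rw [norm_smul, Real.norm_of_nonneg hr.le]; simp
  refine ⟨fun h0 => ?_, h, ?_⟩
  · rw [h0, norm_zero] at h; exact hr.ne h
  · rw [h, smul_smul, inv_mul_cancel₀ hr.ne', one_smul]

theorem continuous_tangentialSq {g : E → ℝ} (hg : ContDiff ℝ 1 g) :
    Continuous fun θ : Metric.sphere (0 : E) 1 => tangentialSq g (θ : E) (θ : E) := by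
  have h : Continuous fun θ : Metric.sphere (0 : E) 1 => fderiv ℝ g (θ : E) :=
    (hg.continuous_fderiv (by simp)).comp continuous_subtype_val
  exact (h.norm.pow 2).sub ((h.clm_apply continuous_subtype_val).pow 2)

theorem tendsto_integral_mul_logCutoff_sq {w f : ℝ → ℝ} (hwc : ContinuousOn w (Ioi 0))
    (hw : ∀ r, 0 < r → 0 ≤ w r) (hf : ContinuousOn f (Ioi 0))
    (hi : IntegrableOn (fun r => f r ^ 2 * w r) (Ioi 0)) :
    Tendsto (fun k => ∫ r in Ioi 0, (f r * logCutoff k r) ^ 2 * w r) atTop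
      (𝓝 (∫ r in Ioi 0, f r ^ 2 * w r)) := by
  refine tendsto_integral_of_dominated_convergence (fun r => f r ^ 2 * w r) (fun k => ?_) hi
    (fun k => ?_) (Eventually.of_forall fun r => ?_)
  · exact (((hf.mul (isRadialTest_logCutoff k).cont).pow 2).mul hwc).aestronglyMeasurable
      measurableSet_Ioi
  · filter_upwards [ae_restrict_mem measurableSet_Ioi] with r hr
    have := hw r hr
    rw [Real.norm_of_nonneg (by positivity), mul_pow]
    gcongr
    refine mul_le_of_le_one_right (by positivity) ?_
    exact pow_le_one₀ (logCutoff_nonneg k r) (logCutoff_le_one k r)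
  · refine tendsto_const_nhds.congr' ?_
    filter_upwards [eventually_logCutoff_eq_one r] with k hk
    rw [hk, mul_one]

/-- The `1/r` bound on the derivative of the cutoff keeps `r χ'` bounded uniformly in `k`, so
dominated convergence applies. -/
theorem tendsto_integral_deriv_id_mul_logCutoff_sq {w : ℝ → ℝ} (hwc : ContinuousOn w (Ioi 0))
    (hw : ∀ r, 0 < r → 0 ≤ w r) (hi : IntegrableOn w (Ioi 0)) :
    Tendsto (fun k => ∫ r in Ioi 0, (logCutoff k r + r * logCutoffDeriv k r) ^ 2 * w r)
      atTop (𝓝 (∫ r in Ioi 0, w r)) := by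
  obtain ⟨C, hC0, hC⟩ := exists_abs_logCutoffDeriv_le
  refine tendsto_integral_of_dominated_convergence (fun r => (1 + C) ^ 2 * w r) (fun k => ?_)
    (hi.const_mul _) (fun k => ?_) (Eventually.of_forall fun r => ?_)
  · have hχ := (isRadialTest_logCutoff k).cont
    have hχ' := (isRadialTest_logCutoff k).cont'
    exact (((hχ.add (continuousOn_id.mul hχ')).pow 2).mul hwc).aestronglyMeasurable
      measurableSet_Ioi
  · filter_upwards [ae_restrict_mem measurableSet_Ioi] with r hr
    have hr : 0 < r := hr
    have := hw r hr
    rw [Real.norm_of_nonneg (by positivity), ← sq_abs]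
    gcongr
    refine (abs_add_le _ _).trans (add_le_add (abs_logCutoff_le_one k r) ?_)
    rw [abs_mul, abs_of_pos hr]
    calc _ ≤ r * (C / (k + 1) / r) := by gcongr; exact hC k r hr
      _ = C / (k + 1) := by field_simp
      _ ≤ C := div_le_self hC0 (by linarith [(k.cast_nonneg : (0 : ℝ) ≤ k)])
  · refine tendsto_const_nhds.congr' ?_
    filter_upwards [eventually_logCutoff_eq_one r, eventually_logCutoffDeriv_eq_zero r]
      with k hk hk'
    rw [hk, hk']; ring

theorem gaussWeight_smul_sphere (θ : Metric.sphere (0 : E) 1) {r : ℝ} (hr : 0 < r) :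
    gaussWeight (r • (θ : E)) = Real.exp (-gaussPotential r) := by
  rw [gaussWeight_eq, (sphere_coe_ne_zero hr θ).2.1]

theorem coneExtension_smul_sphere (k : ℕ) (g : E → ℝ) (θ : Metric.sphere (0 : E) 1) {r : ℝ}
    (hr : 0 < r) : coneExtension k g (r • (θ : E)) = r * logCutoff k r * g θ := by
  obtain ⟨h1, h2, h3⟩ := sphere_coe_ne_zero hr θ
  rw [coneExtension, cutoff_of_ne k h1, h3, h2]

theorem integral_gaussWeight_eq [Nontrivial E] : ∫ x : E, gaussWeight x =
    (∫ r in Ioi 0, radialWeight (Module.finrank ℝ E) gaussPotential r) *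
      (surfaceMeasure E).real univ := by
  have h := integral_polar_mul (E := E) integrable_gaussWeight (K := fun _ => 1)
    (a := fun r => Real.exp (-gaussPotential r))
    (fun θ r hr => by rw [gaussWeight_smul_sphere θ hr, mul_one])
  rw [h, integral_const, smul_eq_mul, mul_one]
  rfl

theorem integral_coneExtension_sq [Nontrivial E] (k : ℕ) {g : E → ℝ} (hg : ContDiff ℝ 1 g) :
    ∫ x, coneExtension k g x ^ 2 * gaussWeight x =
      (∫ r in Ioi 0, (r * logCutoff k r) ^ 2 *
        radialWeight (Module.finrank ℝ E) gaussPotential r) *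
      ∫ θ, g (θ : E) ^ 2 ∂surfaceMeasure E := by
  have hFc := (contDiff_coneExtension k hg).continuous
  have hFs := hasCompactSupport_coneExtension (E := E) k g
  have j : Integrable (fun x => coneExtension k g x ^ 2 * gaussWeight x) :=
    Continuous.integrable_of_hasCompactSupport (by fun_prop)
      (hFs.comp_left (g := fun t => t ^ 2) (by simp)).mul_right
  rw [integral_polar_mul j (K := fun θ => g (θ : E) ^ 2)
    (a := fun r => (r * logCutoff k r) ^ 2 * Real.exp (-gaussPotential r))
    (fun θ r hr => by
      rw [gaussWeight_smul_sphere θ hr, coneExtension_smul_sphere k g θ hr]; ring)]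
  congr 2; ext r; simp only [radialWeight]; ring

theorem integral_coneExtension [Nontrivial E] (k : ℕ) {g : E → ℝ} (hg : ContDiff ℝ 1 g)
    (h0 : ∫ θ, g (θ : E) ∂surfaceMeasure E = 0) :
    ∫ x, coneExtension k g x * gaussWeight x = 0 := by
  have hFc := (contDiff_coneExtension k hg).continuous
  have hFs := hasCompactSupport_coneExtension (E := E) k g
  have j : Integrable (fun x => coneExtension k g x * gaussWeight x) :=
    Continuous.integrable_of_hasCompactSupport (by fun_prop) hFs.mul_right
  rw [integral_polar_mul j (K := fun θ => g (θ : E))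
    (a := fun r => (r * logCutoff k r) * Real.exp (-gaussPotential r))
    (fun θ r hr => by
      rw [gaussWeight_smul_sphere θ hr, coneExtension_smul_sphere k g θ hr]; ring), h0, mul_zero]

theorem integral_fderiv_coneExtension [Nontrivial E] (k : ℕ) {g : E → ℝ} (hg : ContDiff ℝ 1 g) :
    ∫ x, ‖fderiv ℝ (coneExtension k g) x‖ ^ 2 * gaussWeight x =
      (∫ r in Ioi 0, (logCutoff k r + r * logCutoffDeriv k r) ^ 2 *
        radialWeight (Module.finrank ℝ E) gaussPotential r) *
          ∫ θ, g (θ : E) ^ 2 ∂surfaceMeasure E +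
      (∫ r in Ioi 0, logCutoff k r ^ 2 *
        radialWeight (Module.finrank ℝ E) gaussPotential r) *
          ∫ θ, tangentialSq g (θ : E) (θ : E) ∂surfaceMeasure E := by
  have hwc : ContinuousOn (radialWeight (Module.finrank ℝ E) gaussPotential) (Ioi 0) :=
    isConvexPotential_gauss.continuousOn_radialWeight
  have hχ := (isRadialTest_logCutoff k).cont
  have hχ' := (isRadialTest_logCutoff k).cont'
  have i1 : IntegrableOn (fun r => (logCutoff k r + r * logCutoffDeriv k r) ^ 2 *
      radialWeight (Module.finrank ℝ E) gaussPotential r) (Ioi 0) :=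
    integrableOn_Ioi_of_compactlySupported
      (((hχ.add (continuousOn_id.mul hχ')).pow 2).mul hwc)
      ((isRadialTest_logCutoff k).supp.union (isRadialTest_logCutoff k).supp'
        fun r _ h1 h2 => by simp [h1, h2])
  have i2 : IntegrableOn (fun r => logCutoff k r ^ 2 *
      radialWeight (Module.finrank ℝ E) gaussPotential r) (Ioi 0) :=
    integrableOn_Ioi_of_compactlySupported ((hχ.pow 2).mul hwc)
      ((isRadialTest_logCutoff k).supp.mono fun r _ h => by simp [h])
  have hgc := hg.continuous
  have hTc := continuous_tangentialSq hg
  have hFs := hasCompactSupport_coneExtension (E := E) k g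
  have hFc' := (contDiff_coneExtension k hg).continuous_fderiv (by simp)
  have j3 : Integrable (fun x => ‖fderiv ℝ (coneExtension k g) x‖ ^ 2 * gaussWeight x) :=
    Continuous.integrable_of_hasCompactSupport (by fun_prop)
      ((hFs.fderiv (𝕜 := ℝ)).comp_left (g := fun L => ‖L‖ ^ 2) (by simp)).mul_right
  rw [integral_polar j3, ← integral_const_mul, ← integral_const_mul,
    ← integral_add ((integrable_surface (by fun_prop)).const_mul _)
      ((integrable_surface hTc).const_mul _)]
  refine integral_congr_ae (Eventually.of_forall fun θ => ?_)
  simp only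
  rw [← integral_mul_const, ← integral_mul_const,
    ← integral_add (i1.mul_const _) (i2.mul_const _)]
  refine setIntegral_congr_fun measurableSet_Ioi fun r hr => ?_
  obtain ⟨h1, h2, h3⟩ := sphere_coe_ne_zero hr θ
  rw [norm_sq_fderiv_coneExtension k hg h1, gaussWeight_smul_sphere θ hr, h3, h2, radialWeight]
  ring

/-- As the cutoffs tend to 1, the Gaussian inequality for the cone extension becomes `∫ r² w ∫ g² ≤
∫ w (∫ g² + ∫ |∇_S g|²)`. Since `∫ r² w = d ∫ w`, one copy of `∫ g²` cancels, leaving `d - 1`.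
Homogeneity of degree one is the right choice because linear functions are extremal for the
Gaussian. -/
theorem sphere_poincare_of_mean_zero [Nontrivial E] {g : E → ℝ} (hg : ContDiff ℝ 1 g)
    (h0 : ∫ θ, g (θ : E) ∂surfaceMeasure E = 0) :
    ((Module.finrank ℝ E : ℝ) - 1) * ∫ θ, g (θ : E) ^ 2 ∂surfaceMeasure E ≤
      ∫ θ, tangentialSq g (θ : E) (θ : E) ∂surfaceMeasure E := by
  have hwi := integrableOn_radialWeight_gauss (E := E)
  have hmom := integral_sq_radialWeight_gauss (E := E)
  have hwpos : ∀ r, 0 < r → 0 < radialWeight (Module.finrank ℝ E) gaussPotential r :=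
    fun r hr => radialWeight_pos _ _ hr
  have hwc : ContinuousOn (radialWeight (Module.finrank ℝ E) gaussPotential) (Ioi 0) :=
    isConvexPotential_gauss.continuousOn_radialWeight
  have hW0 : 0 < ∫ r in Ioi 0, radialWeight (Module.finrank ℝ E) gaussPotential r :=
    setIntegral_Ioi_pos hwpos hwi
  have t1 := tendsto_integral_mul_logCutoff_sq hwc (fun r hr => (hwpos r hr).le) continuousOn_id
    (isConvexPotential_gauss.integrableOn_pow_mul_radialWeight hwi 2)
  have t2 := tendsto_integral_mul_logCutoff_sq hwc (fun r hr => (hwpos r hr).le)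
    (continuousOn_const (c := (1 : ℝ))) (by simpa using hwi)
  have t3 := tendsto_integral_deriv_id_mul_logCutoff_sq hwc (fun r hr => (hwpos r hr).le) hwi
  simp only [one_mul, one_pow] at t2
  simp only [id] at t1
  have hlim := le_of_tendsto_of_tendsto' (t1.mul_const (∫ θ, g (θ : E) ^ 2 ∂surfaceMeasure E))
    ((t3.mul_const (∫ θ, g (θ : E) ^ 2 ∂surfaceMeasure E)).add
      (t2.mul_const (∫ θ, tangentialSq g (θ : E) (θ : E) ∂surfaceMeasure E)))
    (fun k => by
      have hGP := gaussian_poincare (contDiff_coneExtension k hg)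
        (hasCompactSupport_coneExtension k g)
      rw [integral_gaussWeight_eq, integral_coneExtension_sq k hg, integral_coneExtension k hg h0,
        integral_fderiv_coneExtension k hg, zero_pow two_ne_zero, sub_zero] at hGP
      exact le_of_mul_le_mul_left hGP (mul_pos hW0 surfaceMeasure_real_pos))
  rw [hmom] at hlim
  refine le_of_mul_le_mul_left ?_ hW0
  linarith

/-- The Poincaré inequality on the unit sphere, with the sharp constant `dim E - 1`. -/
theorem sphere_poincare [Nontrivial E] {g : E → ℝ} (hg : ContDiff ℝ 1 g) (m : ℝ)
    (hm : ∫ θ, g (θ : E) ∂surfaceMeasure E = m * (surfaceMeasure E).real univ) :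
    ((Module.finrank ℝ E : ℝ) - 1) * ∫ θ, (g (θ : E) - m) ^ 2 ∂surfaceMeasure E ≤
      ∫ θ, tangentialSq g (θ : E) (θ : E) ∂surfaceMeasure E := by
  have hgc := hg.continuous
  have h := sphere_poincare_of_mean_zero (g := fun x => g x - m) (hg.sub contDiff_const) (by
    rw [integral_sub (integrable_surface (by fun_prop)) (integrable_const _), hm, integral_const,
      smul_eq_mul, mul_comm, sub_self])
  simpa only [tangentialSq, fderiv_sub_const] using h

end Sphere

/-! ### The Poincaré inequality for functions supported away from the origin -/

section Annulus

variable {E : Type*} [NormedAddCommGroup E] [InnerProductSpace ℝ E] [FiniteDimensional ℝ E]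
  [MeasurableSpace E] [BorelSpace E]

/-- `f` is continuously differentiable and supported in the annulus `a ≤ ‖x‖ ≤ b`. -/
structure IsAnnular (f : E → ℝ) (a b : ℝ) : Prop where
  smooth : ContDiff ℝ 1 f
  pos : 0 < a
  lt : a < b
  zero : ∀ x, ‖x‖ ∉ Icc a b → f x = 0

/-- The derivative of `f` in the radial direction `θ` at `r θ`. -/
noncomputable def radialDeriv (f : E → ℝ) (θ : Metric.sphere (0 : E) 1) (r : ℝ) : ℝ :=
  fderiv ℝ f (r • (θ : E)) θ

/-- The spherical mean of `f` at radius `r`. -/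
noncomputable def sphericalMean (f : E → ℝ) (r : ℝ) : ℝ :=
  ((surfaceMeasure E).real univ)⁻¹ * ∫ θ, f (r • (θ : E)) ∂surfaceMeasure E

/-- The derivative of the spherical mean. -/
noncomputable def sphericalMeanDeriv (f : E → ℝ) (r : ℝ) : ℝ :=
  ((surfaceMeasure E).real univ)⁻¹ * ∫ θ, radialDeriv f θ r ∂surfaceMeasure E

theorem continuous_smul_sphere :
    Continuous fun p : Metric.sphere (0 : E) 1 × ℝ => p.2 • (p.1 : E) :=
  continuous_snd.smul (continuous_subtype_val.comp continuous_fst)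

theorem integral_sphere_swap {K : Metric.sphere (0 : E) 1 → ℝ → ℝ}
    (hK : Integrable (Function.uncurry K) ((surfaceMeasure E).prod (volume.restrict (Ioi 0)))) :
    ∫ θ, (∫ r in Ioi 0, K θ r) ∂surfaceMeasure E =
      ∫ r in Ioi 0, ∫ θ, K θ r ∂surfaceMeasure E :=
  integral_integral_swap hK

/-- Decomposition of a second moment into mean and fluctuation. -/
theorem integral_sq_eq_mean_add {K : Metric.sphere (0 : E) 1 → ℝ} (hK : Continuous K)
    [Nontrivial E] {m : ℝ}
    (hm : m = ((surfaceMeasure E).real univ)⁻¹ * ∫ θ, K θ ∂surfaceMeasure E) :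
    ∫ θ, K θ ^ 2 ∂surfaceMeasure E = (surfaceMeasure E).real univ * m ^ 2 +
      ∫ θ, (K θ - m) ^ 2 ∂surfaceMeasure E := by
  have hs := surfaceMeasure_real_pos (E := E)
  have h1 : ∫ θ, K θ ∂surfaceMeasure E = m * (surfaceMeasure E).real univ := by
    rw [hm]; field_simp
  have h2 : ∫ θ, (K θ - m) ^ 2 ∂surfaceMeasure E =
      ∫ θ, (K θ ^ 2 + m ^ 2 - 2 * m * K θ) ∂surfaceMeasure E := by
    congr 1; ext θ; ring
  rw [h2, integral_add_sub_eq (integrable_surface (by fun_prop)) (integrable_const _)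
    ((integrable_surface hK).const_mul _), integral_const, integral_const_mul, h1, smul_eq_mul]
  ring

namespace IsAnnular

variable {f : E → ℝ} {a b : ℝ}

theorem eq_zero (hf : IsAnnular f a b) (θ : Metric.sphere (0 : E) 1) {r : ℝ} (hr : 0 < r)
    (h : r ∉ Icc a b) : f (r • (θ : E)) = 0 :=
  hf.zero _ (by rwa [(sphere_coe_ne_zero hr θ).2.1])

theorem fderiv_eq_zero (hf : IsAnnular f a b) {x : E} (hx : ‖x‖ ∉ Icc a b) :
    fderiv ℝ f x = 0 := by
  have : f =ᶠ[𝓝 x] fun _ => 0 := by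
    filter_upwards [(isClosed_Icc.preimage continuous_norm).isOpen_compl.mem_nhds hx] with y hy
    exact hf.zero y hy
  rw [this.fderiv_eq]
  simp

theorem radialDeriv_eq_zero (hf : IsAnnular f a b) (θ : Metric.sphere (0 : E) 1) {r : ℝ}
    (hr : 0 < r) (h : r ∉ Icc a b) : radialDeriv f θ r = 0 := by
  rw [radialDeriv, hf.fderiv_eq_zero (by rwa [(sphere_coe_ne_zero hr θ).2.1])]
  rfl

theorem hasCompactSupport (hf : IsAnnular f a b) : HasCompactSupport f := by
  refine HasCompactSupport.of_support_subset_isCompact (isCompact_closedBall (0 : E) b)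
    fun x hx => ?_
  by_contra h
  refine hx (hf.zero x fun hm => h ?_)
  simpa using hm.2

theorem continuous_radial (hf : IsAnnular f a b) :
    Continuous fun p : Metric.sphere (0 : E) 1 × ℝ => f (p.2 • (p.1 : E)) :=
  hf.smooth.continuous.comp continuous_smul_sphere

theorem continuous_radialDeriv (hf : IsAnnular f a b) :
    Continuous fun p : Metric.sphere (0 : E) 1 × ℝ => radialDeriv f p.1 p.2 :=
  ((hf.smooth.continuous_fderiv (by simp)).comp continuous_smul_sphere).clm_apply
    (continuous_subtype_val.comp continuous_fst)

theorem continuous_norm_fderiv (hf : IsAnnular f a b) :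
    Continuous fun p : Metric.sphere (0 : E) 1 × ℝ => ‖fderiv ℝ f (p.2 • (p.1 : E))‖ :=
  ((hf.smooth.continuous_fderiv (by simp)).comp continuous_smul_sphere).norm

theorem hasDerivAt_ray (hf : IsAnnular f a b) (θ : Metric.sphere (0 : E) 1) (r : ℝ) :
    HasDerivAt (fun r : ℝ => f (r • (θ : E))) (radialDeriv f θ r) r := by
  have h1 : HasDerivAt (fun r : ℝ => r • (θ : E)) ((1 : ℝ) • (θ : E)) r :=
    (hasDerivAt_id r).smul_const _
  rw [one_smul] at h1
  exact (hf.smooth.differentiable (by simp) _).hasFDerivAt.comp_hasDerivAt r h1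

theorem isRadialTest_ray (hf : IsAnnular f a b) (θ : Metric.sphere (0 : E) 1) :
    IsRadialTest (fun r => f (r • (θ : E))) (radialDeriv f θ) where
  hasDeriv r _ := hf.hasDerivAt_ray θ r
  cont' := (hf.continuous_radialDeriv.comp (Continuous.prodMk_right θ)).continuousOn
  supp := ⟨a, b, hf.pos, hf.lt, fun _ hr h => hf.eq_zero θ hr h⟩

theorem exists_abs_radialDeriv_le (hf : IsAnnular f a b) :
    ∃ C, ∀ θ r, |radialDeriv f θ r| ≤ C := by
  obtain ⟨C, hC⟩ := (hf.hasCompactSupport.fderiv (𝕜 := ℝ)).exists_bound_of_continuous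
    (hf.smooth.continuous_fderiv (by simp))
  refine ⟨C, fun θ r => ?_⟩
  have h := (fderiv ℝ f (r • (θ : E))).le_opNorm (θ : E)
  rw [norm_eq_of_mem_sphere θ, mul_one] at h
  exact h.trans (hC _)

theorem isRadialTest_sphericalMean (hf : IsAnnular f a b) :
    IsRadialTest (sphericalMean f) (sphericalMeanDeriv f) where
  hasDeriv r _ := by
    obtain ⟨C, hC⟩ := hf.exists_abs_radialDeriv_le
    have h := (hasDerivAt_integral_of_dominated_loc_of_deriv_le (μ := surfaceMeasure E)
      (s := univ) (x₀ := r) (F := fun r θ => f (r • (θ : E)))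
      (F' := fun r θ => radialDeriv f θ r) (bound := fun _ => C) univ_mem
      (Eventually.of_forall fun r =>
        (hf.continuous_radial.comp (Continuous.prodMk_left r)).aestronglyMeasurable)
      (integrable_surface (hf.continuous_radial.comp (Continuous.prodMk_left r)))
      (hf.continuous_radialDeriv.comp (Continuous.prodMk_left r)).aestronglyMeasurable
      (Eventually.of_forall fun θ r _ => hC θ r) (integrable_const C)
      (Eventually.of_forall fun θ r _ => hf.hasDerivAt_ray θ r)).2
    exact h.const_mul _
  cont' := by
    obtain ⟨C, hC⟩ := hf.exists_abs_radialDeriv_le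
    refine Continuous.continuousOn (continuous_const.mul ?_)
    refine continuous_of_dominated (bound := fun _ => C) (fun r =>
      (hf.continuous_radialDeriv.comp (Continuous.prodMk_left r)).aestronglyMeasurable)
      (fun r => Eventually.of_forall fun θ => hC θ r) (integrable_const C)
      (Eventually.of_forall fun θ => hf.continuous_radialDeriv.comp (Continuous.prodMk_right θ))
  supp := ⟨a, b, hf.pos, hf.lt, fun r hr h => by
    simp [sphericalMean, hf.eq_zero _ hr h]⟩

/-- The sphere Poincaré inequality applied to `f` on the sphere of radius `r`. -/
theorem sphere_poincare_radius [Nontrivial E] (hf : IsAnnular f a b) (r : ℝ) :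
    ((Module.finrank ℝ E : ℝ) - 1) *
        ∫ θ, (f (r • (θ : E)) - sphericalMean f r) ^ 2 ∂surfaceMeasure E ≤
      r ^ 2 * ∫ θ, tangentialSq f (r • (θ : E)) (θ : E) ∂surfaceMeasure E := by
  have hs := surfaceMeasure_real_pos (E := E)
  have hg : ContDiff ℝ 1 (fun x : E => f (r • x)) := hf.smooth.comp (contDiff_const_smul r)
  have h := sphere_poincare hg (sphericalMean f r) (by rw [sphericalMean]; field_simp)
  refine h.trans_eq ?_
  rw [← integral_const_mul]
  congr 1; ext θ
  -- Rescaling the sphere of radius `r` to the unit sphere produces the factor `r²` in the energy.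
  have hd : fderiv ℝ (fun x : E => f (r • x)) θ = r • fderiv ℝ f (r • (θ : E)) := by
    have h1 : HasFDerivAt (fun x : E => r • x) (r • ContinuousLinearMap.id ℝ E) (θ : E) :=
      (hasFDerivAt_id _).const_smul r
    have h2 : HasFDerivAt f (fderiv ℝ f (r • (θ : E))) ((fun x : E => r • x) θ) :=
      (hf.smooth.differentiable (by simp) _).hasFDerivAt
    refine (HasFDerivAt.comp (g := f) (f := fun x : E => r • x) (θ : E) h2 h1).fderiv.trans ?_
    ext v; simp
  rw [tangentialSq, tangentialSq, hd, norm_smul, mul_pow, smul_apply, smul_eq_mul,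
    Real.norm_eq_abs, sq_abs]
  ring

end IsAnnular
end Annulus

/-! ### Splitting variance and energy into spherical mean and fluctuation -/

section AnnulusPoincare

variable {E : Type*} [NormedAddCommGroup E] [InnerProductSpace ℝ E] [FiniteDimensional ℝ E]
  [MeasurableSpace E] [BorelSpace E]

theorem IsConvexPotential.continuousOn_density {V : ℝ → ℝ} (hV : IsConvexPotential V) :
    ContinuousOn (fun x : E => Real.exp (-V ‖x‖)) {0}ᶜ :=
  ((hV.continuousOn.comp continuous_norm.continuousOn fun _ hx => norm_pos_iff.2 hx).neg).rexp

namespace IsAnnular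

variable {f : E → ℝ} {a b : ℝ} {V : ℝ → ℝ}

theorem integrable_mul_density (hf : IsAnnular f a b) (hV : IsConvexPotential V) {F : E → ℝ}
    (hF : Continuous F) (hz : ∀ x, ‖x‖ ∉ Icc a b → F x = 0) :
    Integrable (fun x => F x * Real.exp (-V ‖x‖)) := by
  have hK : IsCompact {x : E | ‖x‖ ∈ Icc a b} := by
    refine (isCompact_closedBall (0 : E) b).of_isClosed_subset
      (isClosed_Icc.preimage continuous_norm) fun x hx => ?_
    simpa using hx.2
  have h1 : IntegrableOn (fun x => F x * Real.exp (-V ‖x‖)) {x : E | ‖x‖ ∈ Icc a b} := by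
    refine ContinuousOn.integrableOn_compact hK (hF.continuousOn.mul
      (hV.continuousOn_density.mono fun x hx => ?_))
    exact norm_pos_iff.1 (hf.pos.trans_le hx.1)
  rw [← integrableOn_univ]
  refine h1.of_forall_sdiff_eq_zero MeasurableSet.univ fun x hx => ?_
  rw [hz x hx.2, zero_mul]

theorem integral_mul_density [Nontrivial E] (hf : IsAnnular f a b) (hV : IsConvexPotential V)
    {F : E → ℝ} (hF : Continuous F) (hz : ∀ x, ‖x‖ ∉ Icc a b → F x = 0) :
    ∫ x, F x * Real.exp (-V ‖x‖) =
      ∫ θ, (∫ r in Ioi 0, F (r • (θ : E)) * radialWeight (Module.finrank ℝ E) V r)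
        ∂surfaceMeasure E := by
  rw [integral_polar (hf.integrable_mul_density hV hF hz)]
  refine integral_congr_ae (Eventually.of_forall fun θ => ?_)
  refine setIntegral_congr_fun measurableSet_Ioi fun r hr => ?_
  rw [(sphere_coe_ne_zero hr θ).2.1, radialWeight]
  ring

theorem integrable_prod_mul_radialWeight (hf : IsAnnular f a b) (hV : IsConvexPotential V) (n : ℕ)
    {K : Metric.sphere (0 : E) 1 → ℝ → ℝ}
    (hK : ContinuousOn (fun p : Metric.sphere (0 : E) 1 × ℝ => K p.1 p.2) (univ ×ˢ Ioi 0))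
    (hz : ∀ θ r, 0 < r → r ∉ Icc a b → K θ r = 0) :
    Integrable (Function.uncurry fun θ r => K θ r * radialWeight n V r)
      ((surfaceMeasure E).prod (volume.restrict (Ioi 0))) := by
  refine integrable_sphere_prod (a := a) (b := b) ?_ hf.pos fun θ r hr h => ?_
  · exact hK.mul (hV.continuousOn_radialWeight.comp continuous_snd.continuousOn fun p hp => hp.2)
  · simp only [Function.uncurry]
    rw [hz θ r hr h, zero_mul]

theorem integral_sphere_swap_mul (hf : IsAnnular f a b) (hV : IsConvexPotential V) (n : ℕ)
    {K : Metric.sphere (0 : E) 1 → ℝ → ℝ}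
    (hK : ContinuousOn (fun p : Metric.sphere (0 : E) 1 × ℝ => K p.1 p.2) (univ ×ˢ Ioi 0))
    (hz : ∀ θ r, 0 < r → r ∉ Icc a b → K θ r = 0) :
    IntegrableOn (fun r => (∫ θ, K θ r ∂surfaceMeasure E) * radialWeight n V r) (Ioi 0) ∧
    ∫ θ, (∫ r in Ioi 0, K θ r * radialWeight n V r) ∂surfaceMeasure E =
      ∫ r in Ioi 0, (∫ θ, K θ r ∂surfaceMeasure E) * radialWeight n V r := by
  have hi := hf.integrable_prod_mul_radialWeight hV n hK hz
  refine ⟨hi.integral_prod_right.congr (Eventually.of_forall fun r => ?_), ?_⟩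
  · simp only [Function.uncurry, integral_mul_const]
  · rw [integral_sphere_swap hi]
    simp only [integral_mul_const]

/-- Splitting of the weighted second moment of `K` into its spherical mean `m` and its
fluctuation. -/
theorem integral_sq_split [Nontrivial E] (hf : IsAnnular f a b) (hV : IsConvexPotential V) (n : ℕ)
    {K : Metric.sphere (0 : E) 1 → ℝ → ℝ} (hK : Continuous fun p : Metric.sphere (0 : E) 1 × ℝ => K p.1 p.2)
    (hz : ∀ θ r, 0 < r → r ∉ Icc a b → K θ r = 0) {m : ℝ → ℝ} (hmc : ContinuousOn m (Ioi 0))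
    (hm : ∀ r, m r = ((surfaceMeasure E).real univ)⁻¹ * ∫ θ, K θ r ∂surfaceMeasure E) :
    ∫ θ, (∫ r in Ioi 0, K θ r ^ 2 * radialWeight n V r) ∂surfaceMeasure E =
      (surfaceMeasure E).real univ * (∫ r in Ioi 0, m r ^ 2 * radialWeight n V r) +
      ∫ θ, (∫ r in Ioi 0, (K θ r - m r) ^ 2 * radialWeight n V r) ∂surfaceMeasure E := by
  have hmz : ∀ r, 0 < r → r ∉ Icc a b → m r = 0 := fun r hr h => by
    rw [hm]; simp [hz _ r hr h]
  have hmc' : ContinuousOn (fun p : Metric.sphere (0 : E) 1 × ℝ => m p.2) (univ ×ˢ Ioi 0) :=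
    hmc.comp continuous_snd.continuousOn fun p hp => hp.2
  have h1 := hf.integral_sphere_swap_mul hV n (K := fun θ r => K θ r ^ 2) (hK.fun_pow 2).continuousOn
    (fun θ r hr h => by simp [hz θ r hr h])
  have h2 := hf.integral_sphere_swap_mul hV n (K := fun θ r => (K θ r - m r) ^ 2)
    ((hK.continuousOn.fun_sub hmc').fun_pow 2) (fun θ r hr h => by simp [hz θ r hr h, hmz r hr h])
  have h3 : IntegrableOn (fun r => m r ^ 2 * radialWeight n V r) (Ioi 0) :=
    integrableOn_Ioi_of_compactlySupported ((hmc.pow 2).mul hV.continuousOn_radialWeight)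
      ⟨a, b, hf.pos, hf.lt, fun r hr h => by simp [hmz r hr h]⟩
  rw [h1.2, h2.2, ← integral_const_mul, ← integral_add (h3.const_mul _) h2.1]
  refine setIntegral_congr_fun measurableSet_Ioi fun r _ => ?_
  have h := integral_sq_eq_mean_add (K := fun θ => K θ r)
    (hK.comp (Continuous.prodMk_left r)) (hm r)
  rw [h]
  ring

theorem continuous_tangentialSq (hf : IsAnnular f a b) :
    Continuous fun p : Metric.sphere (0 : E) 1 × ℝ =>
      tangentialSq f (p.2 • (p.1 : E)) (p.1 : E) :=
  (hf.continuous_norm_fderiv.pow 2).sub (hf.continuous_radialDeriv.pow 2)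

/-- The sphere Poincaré inequality integrated against the radial weight. -/
theorem integral_fluctuation_le [Nontrivial E] (hf : IsAnnular f a b) (hV : IsConvexPotential V)
    (n : ℕ) :
    ((Module.finrank ℝ E : ℝ) - 1) *
      ∫ θ, (∫ r in Ioi 0, (f (r • (θ : E)) - sphericalMean f r) ^ 2 / r ^ 2 *
        radialWeight n V r) ∂surfaceMeasure E ≤
      ∫ θ, (∫ r in Ioi 0, tangentialSq f (r • (θ : E)) (θ : E) * radialWeight n V r)
        ∂surfaceMeasure E := by
  have hm := hf.isRadialTest_sphericalMean
  have hmz : ∀ r, 0 < r → r ∉ Icc a b → sphericalMean f r = 0 := fun r hr h => by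
    simp [sphericalMean, hf.eq_zero _ hr h]
  have hmc' : ContinuousOn (fun p : Metric.sphere (0 : E) 1 × ℝ => sphericalMean f p.2)
      (univ ×ˢ Ioi 0) := hm.cont.comp continuous_snd.continuousOn fun p hp => hp.2
  have h1 := hf.integral_sphere_swap_mul hV n
    (K := fun θ r => (f (r • (θ : E)) - sphericalMean f r) ^ 2 / r ^ 2)
    (((hf.continuous_radial.continuousOn.fun_sub hmc').fun_pow 2).div (continuous_snd.fun_pow 2).continuousOn
      fun p hp => pow_ne_zero _ (ne_of_gt hp.2))
    (fun θ r hr h => by simp [hf.eq_zero θ hr h, hmz r hr h])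
  have h2 := hf.integral_sphere_swap_mul hV n
    (K := fun θ r => tangentialSq f (r • (θ : E)) (θ : E)) hf.continuous_tangentialSq.continuousOn
    (fun θ r hr h => by
      simp [tangentialSq, hf.fderiv_eq_zero (x := r • (θ : E))
        (by rwa [(sphere_coe_ne_zero hr θ).2.1])])
  rw [h1.2, h2.2, ← integral_const_mul]
  refine setIntegral_mono_on (h1.1.const_mul _) h2.1 measurableSet_Ioi fun r hr => ?_
  rw [← mul_assoc]
  refine mul_le_mul_of_nonneg_right ?_ (radialWeight_pos n V hr).le
  have hr2 : 0 < r ^ 2 := pow_pos hr 2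
  rw [integral_div, mul_div_assoc', div_le_iff₀ hr2, mul_comm _ (r ^ 2)]
  exact hf.sphere_poincare_radius r

/-- The Poincaré inequality for `e^{-V(‖x‖)} dx` and functions supported in an annulus. -/
theorem poincare [Nontrivial E] (hf : IsAnnular f a b) (hV : IsConvexPotential V)
    (hd : 2 ≤ Module.finrank ℝ E)
    (hi : IntegrableOn (radialWeight (Module.finrank ℝ E) V) (Ioi 0)) :
    ((Module.finrank ℝ E : ℝ) - 1) *
      ((∫ x : E, Real.exp (-V ‖x‖)) * (∫ x, f x ^ 2 * Real.exp (-V ‖x‖)) -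
        (∫ x, f x * Real.exp (-V ‖x‖)) ^ 2) ≤
      (∫ x : E, ‖x‖ ^ 2 * Real.exp (-V ‖x‖)) *
        ∫ x, ‖fderiv ℝ f x‖ ^ 2 * Real.exp (-V ‖x‖) := by
  have hm := hf.isRadialTest_sphericalMean
  have hfc := hf.smooth.continuous
  have hfc' := hf.smooth.continuous_fderiv (by simp)
  have hmz : ∀ r, 0 < r → r ∉ Icc a b → sphericalMean f r = 0 := fun r hr h => by
    simp [sphericalMean, hf.eq_zero _ hr h]
  have hmz' : ∀ r, 0 < r → r ∉ Icc a b → sphericalMeanDeriv f r = 0 := fun r hr h => by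
    simp [sphericalMeanDeriv, hf.radialDeriv_eq_zero _ hr h]
  have hmc : ContinuousOn (fun p : Metric.sphere (0 : E) 1 × ℝ => sphericalMean f p.2)
      (univ ×ˢ Ioi 0) := hm.cont.comp continuous_snd.continuousOn fun p hp => hp.2
  have hmc' : ContinuousOn (fun p : Metric.sphere (0 : E) 1 × ℝ => sphericalMeanDeriv f p.2)
      (univ ×ˢ Ioi 0) := hm.cont'.comp continuous_snd.continuousOn fun p hp => hp.2
  have hs := surfaceMeasure_real_pos (E := E)
  have hN : (0 : ℝ) ≤ (Module.finrank ℝ E : ℝ) - 1 := by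
    have : (2 : ℝ) ≤ Module.finrank ℝ E := by exact_mod_cast hd
    linarith
  have hTz : ∀ (θ : Metric.sphere (0 : E) 1) r, 0 < r → r ∉ Icc a b →
      tangentialSq f (r • (θ : E)) (θ : E) = 0 := fun θ r hr h => by
    simp [tangentialSq, hf.fderiv_eq_zero (x := r • (θ : E))
      (by rwa [(sphere_coe_ne_zero hr θ).2.1])]
  have hfl := hf.integral_fluctuation_le hV (Module.finrank ℝ E)
  have e0 : ∫ x : E, Real.exp (-V ‖x‖) = (surfaceMeasure E).real univ *
      ∫ r in Ioi 0, radialWeight (Module.finrank ℝ E) V r :=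
    integral_radial fun r => Real.exp (-V r)
  have e1 : ∫ x : E, ‖x‖ ^ 2 * Real.exp (-V ‖x‖) = (surfaceMeasure E).real univ *
      ∫ r in Ioi 0, r ^ 2 * radialWeight (Module.finrank ℝ E) V r := by
    rw [integral_radial fun r => r ^ 2 * Real.exp (-V r)]
    simp only [radialWeight, mul_left_comm]
  have e2 := hf.integral_mul_density hV (F := fun x => f x ^ 2) (by fun_prop)
    (fun x hx => by simp [hf.zero x hx])
  rw [hf.integral_sq_split hV _ (K := fun θ r => f (r • (θ : E))) hf.continuous_radial
    (fun θ r hr h => hf.eq_zero θ hr h) hm.cont (fun r => rfl)] at e2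
  have e3 := hf.integral_mul_density hV (F := f) hfc hf.zero
  have e3' : ∫ x, f x * Real.exp (-V ‖x‖) = (surfaceMeasure E).real univ *
      ∫ r in Ioi 0, sphericalMean f r * radialWeight (Module.finrank ℝ E) V r := by
    rw [e3, (hf.integral_sphere_swap_mul hV _ (K := fun θ r => f (r • (θ : E)))
      hf.continuous_radial.continuousOn (fun θ r hr h => hf.eq_zero θ hr h)).2,
      ← integral_const_mul]
    congr 1; ext r
    rw [sphericalMean, ← mul_assoc, ← mul_assoc, mul_inv_cancel₀ hs.ne', one_mul]
  have e4 := hf.integral_mul_density hV (F := fun x => ‖fderiv ℝ f x‖ ^ 2) (by fun_prop)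
    (fun x hx => by simp [hf.fderiv_eq_zero hx])
  have iD := hf.integrable_prod_mul_radialWeight hV (Module.finrank ℝ E)
    (K := fun θ r => radialDeriv f θ r ^ 2) (hf.continuous_radialDeriv.fun_pow 2).continuousOn
    (fun θ r hr h => by simp [hf.radialDeriv_eq_zero θ hr h])
  have iT := hf.integrable_prod_mul_radialWeight hV (Module.finrank ℝ E)
    (K := fun θ r => tangentialSq f (r • (θ : E)) (θ : E)) hf.continuous_tangentialSq.continuousOn
    hTz
  -- The energy is radial plus tangential. The radial part is split again into mean and fluctuation;
  -- the tangential part is kept to pay for the Hardy term.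
  have e5 : ∫ θ, (∫ r in Ioi 0, ‖fderiv ℝ f (r • (θ : E))‖ ^ 2 *
      radialWeight (Module.finrank ℝ E) V r) ∂surfaceMeasure E =
      ∫ θ, (∫ r in Ioi 0, radialDeriv f θ r ^ 2 * radialWeight (Module.finrank ℝ E) V r)
        ∂surfaceMeasure E +
      ∫ θ, (∫ r in Ioi 0, tangentialSq f (r • (θ : E)) (θ : E) *
        radialWeight (Module.finrank ℝ E) V r) ∂surfaceMeasure E := by
    have iD' := iD.integral_prod_left
    have iT' := iT.integral_prod_left
    simp only [Function.uncurry] at iD' iT'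
    rw [← integral_add iD' iT']
    refine integral_congr_ae ?_
    filter_upwards [iD.prod_right_ae, iT.prod_right_ae] with θ h1 h2
    simp only [Function.uncurry] at h1 h2 ⊢
    rw [← integral_add h1 h2]
    congr 1; ext r
    rw [tangentialSq, radialDeriv]; ring
  rw [e5, hf.integral_sq_split hV _ (K := fun θ r => radialDeriv f θ r) hf.continuous_radialDeriv
    (fun θ r hr h => hf.radialDeriv_eq_zero θ hr h) hm.cont' (fun r => rfl)] at e4
  have hRad := (hV.radial_inequalities hd hi hm).2
  -- The Hardy inequality for the fluctuation on the ray through each `θ`, integrated over the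
  -- sphere. No mean-zero condition along the ray is available, which is why Poincaré would not do
  -- here.
  have hY : ((Module.finrank ℝ E : ℝ) - 1) *
      (∫ r in Ioi 0, radialWeight (Module.finrank ℝ E) V r) *
      (∫ θ, (∫ r in Ioi 0, (f (r • (θ : E)) - sphericalMean f r) ^ 2 *
        radialWeight (Module.finrank ℝ E) V r) ∂surfaceMeasure E) ≤
      (∫ r in Ioi 0, r ^ 2 * radialWeight (Module.finrank ℝ E) V r) *
      ((∫ θ, (∫ r in Ioi 0, (radialDeriv f θ r - sphericalMeanDeriv f r) ^ 2 *
        radialWeight (Module.finrank ℝ E) V r) ∂surfaceMeasure E) +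
      ((Module.finrank ℝ E : ℝ) - 1) *
      ∫ θ, (∫ r in Ioi 0, (f (r • (θ : E)) - sphericalMean f r) ^ 2 / r ^ 2 *
        radialWeight (Module.finrank ℝ E) V r) ∂surfaceMeasure E) := by
    have j1 := (hf.integrable_prod_mul_radialWeight hV (Module.finrank ℝ E)
      (K := fun θ r => (f (r • (θ : E)) - sphericalMean f r) ^ 2)
      ((hf.continuous_radial.continuousOn.fun_sub hmc).fun_pow 2)
      (fun θ r hr h => by simp [hf.eq_zero θ hr h, hmz r hr h])).integral_prod_left
    have j2 := (hf.integrable_prod_mul_radialWeight hV (Module.finrank ℝ E)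
      (K := fun θ r => (radialDeriv f θ r - sphericalMeanDeriv f r) ^ 2)
      ((hf.continuous_radialDeriv.continuousOn.fun_sub hmc').fun_pow 2)
      (fun θ r hr h => by simp [hf.radialDeriv_eq_zero θ hr h, hmz' r hr h])).integral_prod_left
    have j3 := (hf.integrable_prod_mul_radialWeight hV (Module.finrank ℝ E)
      (K := fun θ r => (f (r • (θ : E)) - sphericalMean f r) ^ 2 / r ^ 2)
      (((hf.continuous_radial.continuousOn.fun_sub hmc).fun_pow 2).div (continuous_snd.fun_pow 2).continuousOn
        fun p hp => pow_ne_zero _ (ne_of_gt hp.2))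
      (fun θ r hr h => by simp [hf.eq_zero θ hr h, hmz r hr h])).integral_prod_left
    simp only [Function.uncurry] at j1 j2 j3
    have h := integral_mono (j1.const_mul (((Module.finrank ℝ E : ℝ) - 1) *
        ∫ r in Ioi 0, radialWeight (Module.finrank ℝ E) V r))
      ((j2.add (j3.const_mul ((Module.finrank ℝ E : ℝ) - 1))).const_mul
        (∫ r in Ioi 0, r ^ 2 * radialWeight (Module.finrank ℝ E) V r)) fun θ =>
      (hV.radial_inequalities hd hi ((hf.isRadialTest_ray θ).sub hm)).1
    rwa [integral_const_mul, integral_const_mul,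
      integral_add' j2 (j3.const_mul ((Module.finrank ℝ E : ℝ) - 1)), integral_const_mul] at h
  have hM0 : 0 ≤ ∫ r in Ioi 0, r ^ 2 * radialWeight (Module.finrank ℝ E) V r :=
    setIntegral_nonneg measurableSet_Ioi fun r hr =>
      mul_nonneg (sq_nonneg r) (radialWeight_pos _ V hr).le
  have hfl' := mul_le_mul_of_nonneg_left hfl hM0
  rw [e0, e1, e2, e3', e4]
  -- Each purely radial integral carries one factor of the surface area: the inequality for the mean
  -- needs two, the two for the fluctuation need one.
  have h1 := mul_le_mul_of_nonneg_left hRad (sq_nonneg ((surfaceMeasure E).real univ))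
  have h2 := mul_le_mul_of_nonneg_left hY hs.le
  have h3 := mul_le_mul_of_nonneg_left hfl' hs.le
  linarith

end IsAnnular
end AnnulusPoincare

/-! ### The radial probability measure, its moments and its cutoffs -/

section RadialMeasure

variable {E : Type*} [NormedAddCommGroup E] [InnerProductSpace ℝ E] [FiniteDimensional ℝ E]
  [MeasurableSpace E] [BorelSpace E]

/-- `μ` is the probability measure with density `c e^{-V(‖x‖)}`, in dimension at least two. -/
structure IsRadialMeasure (V : ℝ → ℝ) (c : ℝ) (μ : Measure E) : Prop where
  potential : IsConvexPotential V
  two_le : 2 ≤ Module.finrank ℝ E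
  pos : 0 < c
  prob : IsProbabilityMeasure μ
  eq : μ = (volume : Measure E).withDensity fun x => ENNReal.ofReal (c * Real.exp (-V ‖x‖))

theorem IsConvexPotential.aemeasurable_density [Nontrivial E] {V : ℝ → ℝ}
    (hV : IsConvexPotential V) :
    AEMeasurable (fun x : E => Real.exp (-V ‖x‖)) volume := by
  have h := (hV.continuousOn_density (E := E)).aemeasurable (μ := volume)
    (measurableSet_singleton (0 : E)).compl
  rwa [restrict_compl_singleton] at h

namespace IsRadialMeasure

variable {V : ℝ → ℝ} {c : ℝ} {μ : Measure E}

theorem nontrivial (h : IsRadialMeasure V c μ) : Nontrivial E :=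
  Module.nontrivial_of_finrank_pos (R := ℝ) (by have := h.two_le; omega)

theorem aemeasurable_ofReal (h : IsRadialMeasure V c μ) :
    AEMeasurable (fun x : E => ENNReal.ofReal (c * Real.exp (-V ‖x‖))) volume :=
  have := h.nontrivial
  (h.potential.aemeasurable_density.const_mul c).ennreal_ofReal

theorem integral_eq (h : IsRadialMeasure V c μ) (F : E → ℝ) :
    ∫ x, F x ∂μ = c * ∫ x, F x * Real.exp (-V ‖x‖) := by
  have hc : ∫ x, F x ∂μ = ∫ x, (ENNReal.ofReal (c * Real.exp (-V ‖x‖))).toReal • F x := by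
    conv_lhs => rw [h.eq]
    exact integral_withDensity_eq_integral_toReal_smul₀ h.aemeasurable_ofReal
      (Eventually.of_forall fun _ => ENNReal.ofReal_lt_top) F
  rw [hc, ← integral_const_mul c fun x => F x * Real.exp (-V ‖x‖)]
  congr 1; ext x
  rw [ENNReal.toReal_ofReal (mul_pos h.pos (Real.exp_pos _)).le, smul_eq_mul]
  ring

theorem integrable_iff (h : IsRadialMeasure V c μ) {F : E → ℝ} :
    Integrable F μ ↔ Integrable fun x => F x * Real.exp (-V ‖x‖) := by
  rw [h.eq, integrable_withDensity_iff_integrable_smul₀' h.aemeasurable_ofReal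
    (Eventually.of_forall fun _ => ENNReal.ofReal_lt_top)]
  refine Iff.trans ?_ (integrable_const_mul_iff (c := c) h.pos.ne'.isUnit _)
  refine integrable_congr (Eventually.of_forall fun x => ?_)
  simp only
  rw [ENNReal.toReal_ofReal (mul_pos h.pos (Real.exp_pos _)).le, smul_eq_mul]
  ring

theorem absolutelyContinuous (h : IsRadialMeasure V c μ) : μ ≪ volume := by
  rw [h.eq]; exact withDensity_absolutelyContinuous _ _

theorem ae_ne_zero (h : IsRadialMeasure V c μ) : ∀ᵐ x ∂μ, x ≠ 0 := by
  have := h.nontrivial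
  exact h.absolutelyContinuous.ae_le (Measure.ae_ne volume 0)

theorem integrable_radial_iff (h : IsRadialMeasure V c μ) {f : ℝ → ℝ} :
    Integrable (fun x => f ‖x‖) μ ↔
      IntegrableOn (fun r => f r * radialWeight (Module.finrank ℝ E) V r) (Ioi 0) := by
  have := h.nontrivial
  rw [h.integrable_iff, integrable_fun_norm_addHaar volume (f := fun r => f r * Real.exp (-V r))]
  refine integrableOn_congr_fun (fun r _ => ?_) measurableSet_Ioi
  simp only [radialWeight, smul_eq_mul]
  ring

theorem integral_radial (h : IsRadialMeasure V c μ) (f : ℝ → ℝ) :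
    ∫ x, f ‖x‖ ∂μ = c * ((surfaceMeasure E).real univ *
      ∫ r in Ioi 0, f r * radialWeight (Module.finrank ℝ E) V r) := by
  have := h.nontrivial
  rw [h.integral_eq, RadialGap.integral_radial fun r => f r * Real.exp (-V r)]
  congr 3; ext r
  rw [radialWeight]; ring

theorem integrableOn_radialWeight (h : IsRadialMeasure V c μ) :
    IntegrableOn (radialWeight (Module.finrank ℝ E) V) (Ioi 0) := by
  have := h.prob
  simpa using (h.integrable_radial_iff (f := fun _ => 1)).1 (integrable_const (μ := μ) (1 : ℝ))

theorem integrable_norm_sq (h : IsRadialMeasure V c μ) : Integrable (fun x => ‖x‖ ^ 2) μ :=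
  (h.integrable_radial_iff (f := fun r => r ^ 2)).2
    (h.potential.integrableOn_pow_mul_radialWeight h.integrableOn_radialWeight 2)

theorem integral_norm_sq_pos (h : IsRadialMeasure V c μ) : 0 < ∫ x, ‖x‖ ^ 2 ∂μ := by
  have := h.nontrivial
  rw [h.integral_radial fun r => r ^ 2]
  refine mul_pos h.pos (mul_pos surfaceMeasure_real_pos (setIntegral_Ioi_pos (fun r hr =>
    mul_pos (pow_pos hr 2) (radialWeight_pos _ V hr))
    (h.potential.integrableOn_pow_mul_radialWeight h.integrableOn_radialWeight 2)))

/-- The cutoffs have vanishing energy, even against the weight `1 + ‖x‖²`. -/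
theorem tendsto_integral_cutoff (h : IsRadialMeasure V c μ) :
    Tendsto (fun k => ∫ x, ‖fderiv ℝ (cutoff k) x‖ ^ 2 * (1 + ‖x‖ ^ 2) ∂μ) atTop (𝓝 0) := by
  obtain ⟨M, hM⟩ := h.potential.radialWeight_le h.two_le
  have ht := tendsto_integral_logCutoffDeriv_sq (w := radialWeight (Module.finrank ℝ E) V)
    (fun r hr => (radialWeight_pos _ V hr).le) h.potential.continuousOn_radialWeight
    h.integrableOn_radialWeight hM
  have := (ht.const_mul ((surfaceMeasure E).real univ)).const_mul c
  simp only [mul_zero] at this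
  refine this.congr fun k => ?_
  rw [← h.integral_radial fun r => logCutoffDeriv k r ^ 2 * (1 + r ^ 2)]
  refine integral_congr_ae ?_
  filter_upwards [h.ae_ne_zero] with x hx
  rw [norm_fderiv_cutoff k hx, sq_abs]

theorem poincare_annular (h : IsRadialMeasure V c μ) {f : E → ℝ} {a b : ℝ} (hf : IsAnnular f a b) :
    ((Module.finrank ℝ E : ℝ) - 1) * ((∫ x, f x ^ 2 ∂μ) - (∫ x, f x ∂μ) ^ 2) ≤
      (∫ x, ‖x‖ ^ 2 ∂μ) * ∫ x, ‖fderiv ℝ f x‖ ^ 2 ∂μ := by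
  have := h.nontrivial
  have := h.prob
  have h1 := hf.poincare h.potential h.two_le h.integrableOn_radialWeight
  have h0 : c * ∫ x : E, Real.exp (-V ‖x‖) = 1 := by
    have := h.integral_eq fun _ => 1
    simpa using this.symm
  have h2 := mul_le_mul_of_nonneg_left h1 (sq_nonneg c)
  rw [h.integral_eq, h.integral_eq, h.integral_eq, h.integral_eq]
  refine Eq.trans_le ?_ (h2.trans_eq (by ring))
  linear_combination (-((Module.finrank ℝ E : ℝ) - 1) * c * ∫ x, f x ^ 2 * Real.exp (-V ‖x‖)) * h0

/-- Positivity of `c` is automatic: for `c ≤ 0`, `ENNReal.ofReal` would truncate the density to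
zero. -/
theorem of_withDensity {V : ℝ → ℝ} (hV : IsConvexPotential V) (hd : 2 ≤ Module.finrank ℝ E)
    [hp : IsProbabilityMeasure μ]
    (hμ : μ = (volume : Measure E).withDensity fun x => ENNReal.ofReal (c * Real.exp (-V ‖x‖))) :
    IsRadialMeasure V c μ where
  potential := hV
  two_le := hd
  prob := hp
  eq := hμ
  pos := by
    by_contra! hc
    refine IsProbabilityMeasure.ne_zero μ ?_
    rw [hμ]
    have : (fun x : E => ENNReal.ofReal (c * Real.exp (-V ‖x‖))) = 0 := by
      ext x
      exact ENNReal.ofReal_of_nonpos (mul_nonpos_of_nonpos_of_nonneg hc (Real.exp_pos _).le)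
    rw [this, withDensity_zero]

end IsRadialMeasure
end RadialMeasure

/-! ### The form domain -/

section LTwo

variable {α F : Type*} [MeasurableSpace α] {μ : Measure α} [NormedAddCommGroup F]
  [InnerProductSpace ℝ F]

theorem inner_toLp {f g : α → F} (hf : MemLp f 2 μ) (hg : MemLp g 2 μ) :
    ⟪hf.toLp f, hg.toLp g⟫_ℝ = ∫ x, ⟪f x, g x⟫_ℝ ∂μ := by
  rw [L2.inner_def]
  refine integral_congr_ae ?_
  filter_upwards [hf.coeFn_toLp, hg.coeFn_toLp] with x h1 h2
  rw [h1, h2]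

theorem norm_toLp_sq {f : α → F} (hf : MemLp f 2 μ) :
    ‖hf.toLp f‖ ^ 2 = ∫ x, ‖f x‖ ^ 2 ∂μ := by
  rw [← real_inner_self_eq_norm_sq, inner_toLp]
  simp only [real_inner_self_eq_norm_sq]

theorem tendsto_toLp {f : ℕ → α → F} {g : α → F} (hf : ∀ k, MemLp (f k) 2 μ) (hg : MemLp g 2 μ)
    (h : Tendsto (fun k => ∫ x, ‖f k x - g x‖ ^ 2 ∂μ) atTop (𝓝 0)) :
    Tendsto (fun k => (hf k).toLp (f k)) atTop (𝓝 (hg.toLp g)) := by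
  rw [tendsto_iff_norm_sub_tendsto_zero]
  have h2 := h.sqrt
  rw [Real.sqrt_zero] at h2
  refine h2.congr fun k => ?_
  rw [← MemLp.toLp_sub, ← Real.sqrt_sq (norm_nonneg _), norm_toLp_sq]
  rfl

theorem integrable_norm_sq_of_memLp {f : α → F} (hf : MemLp f 2 μ) :
    Integrable (fun x => ‖f x‖ ^ 2) μ := by
  simpa using hf.integrable_norm_pow (by simp)

end LTwo

section FormDomain

variable {n : ℕ}

theorem norm_gradient (f : EuclideanSpace ℝ (Fin n) → ℝ) (x : EuclideanSpace ℝ (Fin n)) : ‖gradient f x‖ = ‖fderiv ℝ f x‖ := by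
  simp [gradient]

theorem continuous_gradient {f : EuclideanSpace ℝ (Fin n) → ℝ} (hf : ContDiff ℝ 1 f) : Continuous (gradient f) :=
  (InnerProductSpace.toDual ℝ (EuclideanSpace ℝ (Fin n))).symm.continuous.comp (hf.continuous_fderiv (by simp))

namespace IsTestFunction

variable {φ : EuclideanSpace ℝ (Fin n) → ℝ} {μ : Measure (EuclideanSpace ℝ (Fin n))} [IsFiniteMeasure μ]

theorem memLp (hφ : IsTestFunction φ) : MemLp φ 2 μ :=
  hφ.smooth.continuous.memLp_of_hasCompactSupport hφ.compact

theorem memLp_gradient (hφ : IsTestFunction φ) : MemLp (gradient φ) 2 μ := by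
  have hc : ContDiff ℝ 1 φ := hφ.smooth.of_le (by simp)
  have hs : HasCompactSupport (gradient φ) :=
    (hφ.compact.fderiv (𝕜 := ℝ)).comp_left (g := (InnerProductSpace.toDual ℝ (EuclideanSpace ℝ (Fin n))).symm) (map_zero _)
  exact (continuous_gradient hc).memLp_of_hasCompactSupport hs

theorem mem_testGradientGraph (hφ : IsTestFunction φ) :
    (hφ.memLp.toLp φ, hφ.memLp_gradient.toLp (gradient φ)) ∈ testGradientGraph μ :=
  ⟨φ, hφ, hφ.memLp.coeFn_toLp, hφ.memLp_gradient.coeFn_toLp⟩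

theorem mem_formGraph (hφ : IsTestFunction φ) :
    (hφ.memLp.toLp φ, hφ.memLp_gradient.toLp (gradient φ)) ∈ formGraph μ :=
  Submodule.le_topologicalClosure _ hφ.mem_testGradientGraph

end IsTestFunction

theorem isTestFunction_cutoff_mul (k : ℕ) {f : EuclideanSpace ℝ (Fin n) → ℝ} (hf : ContDiff ℝ ∞ f) :
    IsTestFunction fun x => cutoff k x * f x :=
  ⟨(contDiff_cutoff k).mul hf, (hasCompactSupport_cutoff k).mul_right⟩

theorem isAnnular_cutoff_mul (k : ℕ) {f : EuclideanSpace ℝ (Fin n) → ℝ} (hf : ContDiff ℝ ∞ f) :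
    IsAnnular (fun x => cutoff k x * f x) (Real.exp (-(2 * (k + 1)))) (Real.exp (2 * (k + 1))) where
  smooth := ((contDiff_cutoff k).mul hf).of_le (by simp)
  pos := Real.exp_pos _
  lt := Real.exp_lt_exp.2 (by linarith [(k.cast_nonneg : (0 : ℝ) ≤ k)])
  zero x hx := by
    rw [mem_Icc, not_and_or, not_le, not_le] at hx
    rcases hx with hx | hx
    · rw [cutoff_eq_zero_of_norm_lt hx, zero_mul]
    · rw [cutoff_eq_zero_of_lt_norm hx, zero_mul]

theorem gradient_cutoff_mul (k : ℕ) {f : EuclideanSpace ℝ (Fin n) → ℝ} (hf : ContDiff ℝ ∞ f) (x : EuclideanSpace ℝ (Fin n)) :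
    gradient (fun x => cutoff k x * f x) x =
      cutoff k x • gradient f x + f x • gradient (cutoff k) x := by
  have h1 := ((contDiff_cutoff k).differentiable (by simp) x).hasFDerivAt.mul
    (hf.differentiable (by simp) x).hasFDerivAt
  simp only [gradient]
  rw [show fderiv ℝ (fun x => cutoff k x * f x) x = _ from h1.fderiv]
  simp

namespace IsRadialMeasure

variable {V : ℝ → ℝ} {c : ℝ} {μ : Measure (EuclideanSpace ℝ (Fin n))}

/-- Truncation by the cutoffs converges in the form norm, for functions of at most linear
growth. -/
theorem tendsto_cutoff_mul (h : IsRadialMeasure V c μ) [IsFiniteMeasure μ] {f : EuclideanSpace ℝ (Fin n) → ℝ}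
    (hf : ContDiff ℝ ∞ f) (hf2 : MemLp f 2 μ) (hG : MemLp (gradient f) 2 μ) {C : ℝ}
    (hC : ∀ x, f x ^ 2 ≤ C * (1 + ‖x‖ ^ 2)) :
    Tendsto (fun k => (((isTestFunction_cutoff_mul k hf).memLp (μ := μ)).toLp _,
      ((isTestFunction_cutoff_mul k hf).memLp_gradient (μ := μ)).toLp _)) atTop
      (𝓝 (hf2.toLp f, hG.toLp (gradient f))) := by
  have hdct : ∀ {F : EuclideanSpace ℝ (Fin n) → ℝ}, Integrable F μ →
      Tendsto (fun k => ∫ x, (1 - cutoff k x) ^ 2 * F x ∂μ) atTop (𝓝 0) := by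
    intro F hF
    have : (0 : ℝ) = ∫ _x : EuclideanSpace ℝ (Fin n), (0 : ℝ) ∂μ := by simp
    rw [this]
    refine tendsto_integral_of_dominated_convergence (fun x => ‖F x‖) (fun k => ?_) hF.norm
      (fun k => Eventually.of_forall fun x => ?_) ?_
    · exact (((continuous_const.sub (contDiff_cutoff k).continuous).fun_pow 2).aestronglyMeasurable).mul
        hF.aestronglyMeasurable
    · rw [norm_mul, Real.norm_of_nonneg (sq_nonneg _)]
      refine mul_le_of_le_one_left (norm_nonneg _) ?_
      have h1 := cutoff_nonneg k x
      have h2 := cutoff_le_one k x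
      exact pow_le_one₀ (by linarith) (by linarith)
    · filter_upwards [h.ae_ne_zero] with x hx
      refine tendsto_const_nhds.congr' ?_
      filter_upwards [eventually_cutoff_eq_one hx] with k hk
      simp [hk]
  refine Tendsto.prodMk_nhds (tendsto_toLp _ _ ?_) (tendsto_toLp _ _ ?_)
  · refine (hdct (integrable_norm_sq_of_memLp hf2)).congr fun k => ?_
    congr 1; ext x
    rw [Real.norm_eq_abs, Real.norm_eq_abs, sq_abs, sq_abs]
    ring
  -- The gradient error is `(χ - 1) ∇f + f ∇χ`. The first term goes to zero by dominated
  -- convergence; the growth bound on `f` controls the second by the cutoff energy weighted with `1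
  -- + ‖x‖²`.
  · have t1 := (hdct (integrable_norm_sq_of_memLp hG)).const_mul 2
    have t2 := h.tendsto_integral_cutoff.const_mul (2 * C)
    have t := t1.add t2
    simp only [mul_zero, add_zero] at t
    refine squeeze_zero (fun k => integral_nonneg fun x => sq_nonneg _) (fun k => ?_) t
    have i1 : Integrable (fun x => (1 - cutoff k x) ^ 2 * ‖gradient f x‖ ^ 2) μ := by
      refine (integrable_norm_sq_of_memLp hG).bdd_mul (c := 1)
        ((continuous_const.sub (contDiff_cutoff k).continuous).fun_pow 2).aestronglyMeasurable
        (Eventually.of_forall fun x => ?_)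
      rw [Real.norm_of_nonneg (sq_nonneg _)]
      have h1 := cutoff_nonneg k x
      have h2 := cutoff_le_one k x
      exact pow_le_one₀ (by linarith) (by linarith)
    have i2 : Integrable (fun x : EuclideanSpace ℝ (Fin n) => ‖fderiv ℝ (cutoff k) x‖ ^ 2 * (1 + ‖x‖ ^ 2)) μ := by
      have hc := (contDiff_cutoff (E := EuclideanSpace ℝ (Fin n)) k).continuous_fderiv (by simp)
      refine Continuous.integrable_of_hasCompactSupport (by fun_prop) ?_
      exact (((hasCompactSupport_cutoff (E := EuclideanSpace ℝ (Fin n)) k).fderiv (𝕜 := ℝ)).comp_left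
        (g := fun L => ‖L‖ ^ 2) (by simp)).mul_right
    rw [← integral_const_mul, ← integral_const_mul,
      ← integral_add (i1.const_mul 2) (i2.const_mul (2 * C))]
    refine integral_mono_of_nonneg (Eventually.of_forall fun x => sq_nonneg _)
      ((i1.const_mul 2).add (i2.const_mul (2 * C))) (Eventually.of_forall fun x => ?_)
    simp only
    have e : gradient (fun x => cutoff k x * f x) x - gradient f x =
        (cutoff k x - 1) • gradient f x + f x • gradient (cutoff k) x := by
      rw [gradient_cutoff_mul k hf]; module
    rw [e]
    have h1 := norm_add_le ((cutoff k x - 1) • gradient f x) (f x • gradient (cutoff k) x)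
    have h2 : ‖(cutoff k x - 1) • gradient f x‖ ^ 2 = (1 - cutoff k x) ^ 2 * ‖gradient f x‖ ^ 2 := by
      rw [norm_smul, mul_pow, Real.norm_eq_abs, sq_abs]; ring
    have h3 : ‖f x • gradient (cutoff k) x‖ ^ 2 ≤
        C * (‖fderiv ℝ (cutoff k) x‖ ^ 2 * (1 + ‖x‖ ^ 2)) := by
      rw [norm_smul, mul_pow, Real.norm_eq_abs, sq_abs, norm_gradient]
      refine (mul_le_mul_of_nonneg_right (hC x) (sq_nonneg _)).trans_eq (by ring)
    have h4 := pow_le_pow_left₀ (norm_nonneg _) h1 2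
    have h5 := add_sq_le (a := ‖(cutoff k x - 1) • gradient f x‖)
      (b := ‖f x • gradient (cutoff k) x‖)
    linarith

/-- Needed for the constants and the coordinate functions, which lack compact support. -/
theorem mem_formGraph (h : IsRadialMeasure V c μ) [IsFiniteMeasure μ] {f : EuclideanSpace ℝ (Fin n) → ℝ}
    (hf : ContDiff ℝ ∞ f) (hf2 : MemLp f 2 μ) (hG : MemLp (gradient f) 2 μ) {C : ℝ}
    (hC : ∀ x, f x ^ 2 ≤ C * (1 + ‖x‖ ^ 2)) :
    (hf2.toLp f, hG.toLp (gradient f)) ∈ formGraph μ :=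
  mem_closure_of_tendsto (h.tendsto_cutoff_mul hf hf2 hG hC)
    (Eventually.of_forall fun k => (isTestFunction_cutoff_mul k hf).mem_testGradientGraph)

/-- Test functions vanishing near the origin are dense in the form domain. -/
theorem formGraph_subset (h : IsRadialMeasure V c μ) [IsFiniteMeasure μ]
    {S : Set (Lp ℝ 2 μ × Lp (EuclideanSpace ℝ (Fin n)) 2 μ)} (hS : IsClosed S)
    (hA : ∀ (η : EuclideanSpace ℝ (Fin n) → ℝ) (hη : IsTestFunction η) (a b : ℝ), IsAnnular η a b →
      (hη.memLp.toLp η, hη.memLp_gradient.toLp (gradient η)) ∈ S) :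
    (formGraph μ : Set (Lp ℝ 2 μ × Lp (EuclideanSpace ℝ (Fin n)) 2 μ)) ⊆ S := by
  refine closure_minimal (fun p hp => ?_) hS
  obtain ⟨φ, hφ, h1, h2⟩ := hp
  have e : p = (hφ.memLp.toLp φ, hφ.memLp_gradient.toLp (gradient φ)) :=
    Prod.ext (Lp.ext (h1.trans hφ.memLp.coeFn_toLp.symm))
      (Lp.ext (h2.trans hφ.memLp_gradient.coeFn_toLp.symm))
  obtain ⟨M, hM⟩ := hφ.compact.exists_bound_of_continuous hφ.smooth.continuous
  have hC : ∀ x, φ x ^ 2 ≤ M ^ 2 * (1 + ‖x‖ ^ 2) := fun x => by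
    have h3 : φ x ^ 2 ≤ M ^ 2 := by
      rw [← sq_abs]; exact pow_le_pow_left₀ (abs_nonneg _) (hM x) 2
    nlinarith [sq_nonneg (M * ‖x‖)]
  rw [e]
  exact hS.mem_of_tendsto (h.tendsto_cutoff_mul hφ.smooth hφ.memLp hφ.memLp_gradient hC)
    (Eventually.of_forall fun k => hA _ (isTestFunction_cutoff_mul k hφ.smooth) _ _
      (isAnnular_cutoff_mul k hφ.smooth))

/-- The Poincaré inequality on the form domain. -/
theorem poincare (h : IsRadialMeasure V c μ) [IsFiniteMeasure μ] {o : Lp ℝ 2 μ}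
    (ho : o =ᵐ[μ] fun _ => 1) {p : Lp ℝ 2 μ × Lp (EuclideanSpace ℝ (Fin n)) 2 μ} (hp : p ∈ formGraph μ) :
    ((n : ℝ) - 1) * (‖p.1‖ ^ 2 - ⟪o, p.1⟫_ℝ ^ 2) ≤ (∫ x, ‖x‖ ^ 2 ∂μ) * ‖p.2‖ ^ 2 := by
  refine h.formGraph_subset (S := {p | ((n : ℝ) - 1) * (‖p.1‖ ^ 2 - ⟪o, p.1⟫_ℝ ^ 2) ≤
    (∫ x, ‖x‖ ^ 2 ∂μ) * ‖p.2‖ ^ 2}) (isClosed_le (by fun_prop) (by fun_prop))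
    (fun η hη a b hab => ?_) hp
  have h1 := h.poincare_annular hab
  rw [finrank_euclideanSpace_fin] at h1
  have h2 : ⟪o, hη.memLp.toLp η⟫_ℝ = ∫ x, η x ∂μ := by
    rw [L2.inner_def]
    refine integral_congr_ae ?_
    filter_upwards [ho, hη.memLp.coeFn_toLp] with x h3 h4
    rw [h3, h4]; simp
  rw [mem_ofPred_eq, h2, norm_toLp_sq, norm_toLp_sq]
  simpa [norm_gradient] using h1

end IsRadialMeasure
end FormDomain

/-! ### The generator on test functions -/

section Generator

variable {n : ℕ}

theorem laplacian_eq_sum {f : EuclideanSpace ℝ (Fin n) → ℝ} (hf : ContDiff ℝ ∞ f)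
    (x : EuclideanSpace ℝ (Fin n)) :
    Laplacian.laplacian f x = ∑ i, fderiv ℝ
      (fun y => fderiv ℝ f y (EuclideanSpace.basisFun (Fin n) ℝ i)) x
        (EuclideanSpace.basisFun (Fin n) ℝ i) := by
  rw [InnerProductSpace.laplacian_eq_iteratedFDeriv_orthonormalBasis f
    (EuclideanSpace.basisFun (Fin n) ℝ)]
  refine Finset.sum_congr rfl fun i _ => ?_
  have hd : DifferentiableAt ℝ (fderiv ℝ f) x :=
    (hf.fderiv_right (m := 1) (by norm_cast)).differentiable (by simp) x
  have h := hd.hasFDerivAt.clm_apply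
    (hasFDerivAt_const (EuclideanSpace.basisFun (Fin n) ℝ i) x)
  rw [h.fderiv, iteratedFDeriv_two_apply]
  simp

/-- Green's formula against a compactly supported function. -/
theorem integral_inner_gradient_eq_neg {f u : EuclideanSpace ℝ (Fin n) → ℝ}
    (hf : ContDiff ℝ ∞ f) (hu : ContDiff ℝ 1 u) (hs : HasCompactSupport u) :
    Integrable (fun x => Laplacian.laplacian f x * u x) ∧
    Integrable (fun x => ⟪gradient f x, gradient u x⟫_ℝ) ∧
    ∫ x, ⟪gradient f x, gradient u x⟫_ℝ = -∫ x, Laplacian.laplacian f x * u x := by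
  set b := EuclideanSpace.basisFun (Fin n) ℝ
  have hg : ∀ i, ContDiff ℝ 1 (fun y => fderiv ℝ f y (b i)) := fun i =>
    (hf.fderiv_right (m := 1) (by norm_cast)).clm_apply contDiff_const
  have hgc : ∀ i, Continuous fun x => fderiv ℝ (fun y => fderiv ℝ f y (b i)) x (b i) := fun i =>
    ((hg i).continuous_fderiv (by simp)).clm_apply continuous_const
  have huc : ∀ i, Continuous fun x => fderiv ℝ u x (b i) := fun i =>
    (hu.continuous_fderiv (by simp)).clm_apply continuous_const
  have hus : ∀ i, HasCompactSupport fun x => fderiv ℝ u x (b i) := fun i =>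
    hs.fderiv_apply (𝕜 := ℝ) (b i)
  have i1 : ∀ i, Integrable fun x => fderiv ℝ (fun y => fderiv ℝ f y (b i)) x (b i) * u x :=
    fun i => ((hgc i).mul hu.continuous).integrable_of_hasCompactSupport hs.mul_left
  have i2 : ∀ i, Integrable fun x => fderiv ℝ f x (b i) * fderiv ℝ u x (b i) :=
    fun i => ((hg i).continuous.mul (huc i)).integrable_of_hasCompactSupport (hus i).mul_left
  have i3 : ∀ i, Integrable fun x => fderiv ℝ f x (b i) * u x :=
    fun i => ((hg i).continuous.mul hu.continuous).integrable_of_hasCompactSupport hs.mul_left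
  have e1 : (fun x => ⟪gradient f x, gradient u x⟫_ℝ) =
      fun x => ∑ i, fderiv ℝ f x (b i) * fderiv ℝ u x (b i) := by
    ext x
    rw [← b.sum_inner_mul_inner]
    refine Finset.sum_congr rfl fun i _ => ?_
    rw [inner_gradient_left, real_inner_comm, inner_gradient_left]
  have e2 : (fun x => Laplacian.laplacian f x * u x) =
      fun x => ∑ i, fderiv ℝ (fun y => fderiv ℝ f y (b i)) x (b i) * u x := by
    ext x
    rw [laplacian_eq_sum hf, Finset.sum_mul]
  refine ⟨?_, ?_, ?_⟩
  · rw [e2]; exact integrable_finsetSum _ fun i _ => i1 i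
  · rw [e1]; exact integrable_finsetSum _ fun i _ => i2 i
  · rw [e1, e2, integral_finsetSum _ fun i _ => i2 i, integral_finsetSum _ fun i _ => i1 i,
      ← Finset.sum_neg_distrib]
    refine Finset.sum_congr rfl fun i _ => ?_
    exact integral_mul_fderiv_eq_neg_fderiv_mul_of_integrable (i1 i) (i2 i) (i3 i)
      (fun x _ => (hg i).differentiable (by simp) x) (fun x _ => hu.differentiable (by simp) x)

theorem IsConvexPotential.hasFDerivAt_density {V : ℝ → ℝ} (hV : IsConvexPotential V)
    {x : EuclideanSpace ℝ (Fin n)} (hx : x ≠ 0) :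
    HasFDerivAt (fun y : EuclideanSpace ℝ (Fin n) => Real.exp (-V ‖y‖))
      (-(Real.exp (-V ‖x‖) * (deriv V ‖x‖ / ‖x‖)) • innerSL ℝ x) x := by
  have h := ((hV.hasDerivAt (norm_pos_iff.2 hx)).comp_hasFDerivAt x
    (hasFDerivAt_norm' hx)).neg.exp
  refine h.congr_fderiv ?_
  ext v
  simp
  ring

namespace IsRadialMeasure

variable {V : ℝ → ℝ} {c : ℝ} {μ : Measure (EuclideanSpace ℝ (Fin n))}

/-- Green's formula for Lebesgue measure is applied to `u = η e^{-V}`, which is `C¹` everywhere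
because `η` vanishes near the origin. Differentiating the exponential produces the drift term. -/
theorem integral_inner_gradient_annular (h : IsRadialMeasure V c μ)
    {f η : EuclideanSpace ℝ (Fin n) → ℝ} (hf : ContDiff ℝ ∞ f) {a b : ℝ} (hη : IsAnnular η a b) :
    ∫ x, ⟪gradient f x, gradient η x⟫_ℝ ∂μ = ∫ x, -diffusionExpr V f x * η x ∂μ := by
  have := h.nontrivial
  have hV := h.potential
  set u : EuclideanSpace ℝ (Fin n) → ℝ := fun x => η x * Real.exp (-V ‖x‖) with hu
  have hu1 : ContDiff ℝ 1 u := by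
    refine contDiff_of_eq_zero_near hη.pos (fun x hx => ?_) fun x hx => ?_
    · rw [hu]
      simp only
      rw [hη.zero x fun hm => absurd hm.1 (not_le.2 hx), zero_mul]
    · have h1 : ContDiffAt ℝ 1 V ‖x‖ :=
        ((hV.smooth.contDiffAt (Ioi_mem_nhds (norm_pos_iff.2 hx))).of_le (by simp))
      exact hη.smooth.contDiffAt.mul
        (Real.contDiff_exp.contDiffAt.comp x (h1.comp x (contDiffAt_norm ℝ hx)).neg)
  have hus : HasCompactSupport u := hη.hasCompactSupport.mul_right
  obtain ⟨i1, i2, e⟩ := integral_inner_gradient_eq_neg hf hu1 hus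
  have i3 := hη.integrable_mul_density hV (F := fun x => ⟪gradient f x, gradient η x⟫_ℝ)
    ((continuous_gradient (hf.of_le (by simp))).inner (continuous_gradient hη.smooth))
    (fun x hx => by simp [gradient, hη.fderiv_eq_zero hx])
  rw [h.integral_eq, h.integral_eq]
  congr 1
  have e3 : ∫ x, -diffusionExpr V f x * η x * Real.exp (-V ‖x‖) =
      ∫ x, (⟪gradient f x, gradient η x⟫_ℝ * Real.exp (-V ‖x‖) -
        (⟪gradient f x, gradient u x⟫_ℝ + Laplacian.laplacian f x * u x)) := by
    refine integral_congr_ae ?_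
    filter_upwards [Measure.ae_ne volume (0 : EuclideanSpace ℝ (Fin n))] with x hx
    have hd := (hη.smooth.differentiable (by simp) x).hasFDerivAt.mul (hV.hasFDerivAt_density hx)
    have hg : ⟪gradient f x, gradient u x⟫_ℝ = ⟪gradient f x, gradient η x⟫_ℝ *
        Real.exp (-V ‖x‖) - deriv V ‖x‖ / ‖x‖ * ⟪x, gradient f x⟫_ℝ * u x := by
      rw [real_inner_comm, inner_gradient_left, show fderiv ℝ u x = _ from hd.fderiv,
        real_inner_comm (gradient η x), inner_gradient_left]
      simp [hu]
      ring
    rw [hg, diffusionExpr, hu]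
    ring
  have i4 : Integrable fun x => ⟪gradient f x, gradient u x⟫_ℝ +
    Laplacian.laplacian f x * u x := i2.add i1
  rw [e3, integral_sub i3 i4, integral_add i2 i1, e]
  ring

/-- The generator acts on test functions by the differential expression. -/
theorem mem_generatorGraph (h : IsRadialMeasure V c μ) [IsFiniteMeasure μ]
    {f : EuclideanSpace ℝ (Fin n) → ℝ} (hf : IsTestFunction f)
    (hL : MemLp (diffusionExpr V f) 2 μ) :
    (hf.memLp.toLp f, -hL.toLp (diffusionExpr V f)) ∈ generatorGraph μ := by
  refine ⟨_, hf.mem_formGraph, fun q hq => ?_⟩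
  -- Both sides are continuous in `q`, so annular functions suffice; this avoids the possible
  -- singularity of `V` at the origin.
  refine h.formGraph_subset (S := {q | ⟪hf.memLp_gradient.toLp (gradient f), q.2⟫_ℝ =
    ⟪-hL.toLp (diffusionExpr V f), q.1⟫_ℝ}) (isClosed_eq (by fun_prop) (by fun_prop))
    (fun η hη a b hab => ?_) hq
  rw [mem_ofPred_eq, inner_toLp, inner_neg_left, inner_toLp,
    h.integral_inner_gradient_annular hf.smooth hab, ← integral_neg]
  congr 1; ext x
  simp [mul_comm]

end IsRadialMeasure

theorem negGenerator_graph (μ : Measure (EuclideanSpace ℝ (Fin n))) [IsFiniteMeasure μ] :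
    (negGenerator μ).graph = generatorGraph μ :=
  Submodule.toLinearPMap_graph_eq _ (generatorGraph_single_valued μ)

end Generator

/-! ### The spectral gap of the operator of a closed form -/

section Abstract

variable {H K : Type*} [NormedAddCommGroup H] [InnerProductSpace ℝ H]
  [NormedAddCommGroup K] [InnerProductSpace ℝ K]

/-- The operator of a form is known only through its graph, so injectivity and surjectivity of `T -
t` are put in those terms. -/
theorem notMem_opSpectrum_iff {T : H →ₗ.[ℝ] H} {t : ℝ} :
    t ∉ opSpectrum T ↔ (∀ x, (x, t • x) ∈ T.graph → x = 0) ∧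
      ∀ h, ∃ x, (x, h + t • x) ∈ T.graph := by
  have hlin : ∀ x : T.domain, T x - t • (x : H) = (T.toFun - t • T.domain.subtype) x :=
    fun x => rfl
  rw [opSpectrum, Set.mem_ofPred_eq, not_not, Function.Bijective]
  simp only [hlin]
  refine and_congr ?_ ?_
  · rw [show (Function.Injective fun f => (T.toFun - t • T.domain.subtype) f) ↔ _ from
      injective_iff_map_eq_zero (T.toFun - t • T.domain.subtype)]
    constructor
    · intro h x hx
      rw [LinearPMap.mem_graph_iff] at hx
      obtain ⟨y, hy, hy'⟩ := hx
      have : y = 0 := h y (by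
        change T y - t • (y : H) = 0
        rw [hy', hy, sub_self])
      rw [← show (y : H) = x from hy, this]; rfl
    · intro h y hy
      have hy' : T y = t • (y : H) := sub_eq_zero.1 hy
      exact Subtype.ext (h y (by rw [← hy']; exact T.mem_graph y))
  · refine forall_congr' fun h => ?_
    constructor
    · rintro ⟨y, hy⟩
      refine ⟨y, ?_⟩
      have hy' : T y = h + t • (y : H) := sub_eq_iff_eq_add.1 hy
      rw [← hy']
      exact T.mem_graph y
    · rintro ⟨x, hx⟩
      rw [LinearPMap.mem_graph_iff] at hx
      obtain ⟨y, hy, hy'⟩ := hx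
      refine ⟨y, ?_⟩
      change T y - t • (y : H) = h
      rw [hy', hy]; simp

/-- `T` is the operator associated with the form whose domain, with gradients, is `Γ`. -/
def IsFormOperator (Γ : Submodule ℝ (H × K)) (T : H →ₗ.[ℝ] H) : Prop :=
  ∀ f h, (f, h) ∈ T.graph ↔ ∃ G, (f, G) ∈ Γ ∧ ∀ q ∈ Γ, ⟪G, q.2⟫_ℝ = ⟪h, q.1⟫_ℝ

/-- `l` is a lower bound of the form on the orthogonal complement of the ground state `o`. -/
def IsGapBound (Γ : Submodule ℝ (H × K)) (o : H) (l : ℝ) : Prop :=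
  ∀ p ∈ Γ, ⟪o, p.1⟫_ℝ = 0 → l * ‖p.1‖ ^ 2 ≤ ‖p.2‖ ^ 2

variable {Γ : Submodule ℝ (H × K)} {T : H →ₗ.[ℝ] H} {o : H} {l t : ℝ}

/-- Lax–Milgram on the mean-zero part of the form domain. -/
theorem IsGapBound.exists_solution [CompleteSpace H] [CompleteSpace K]
    (hl : IsGapBound Γ o l) (hΓ : IsClosed (Γ : Set (H × K))) (hl0 : 0 < l) (ht : t < l) (h : H) :
    ∃ u ∈ Γ, ⟪o, u.1⟫_ℝ = 0 ∧ ∀ q ∈ Γ, ⟪o, q.1⟫_ℝ = 0 →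
      ⟪u.2, q.2⟫_ℝ - t * ⟪u.1, q.1⟫_ℝ = ⟪h, q.1⟫_ℝ := by
  -- Lax–Milgram needs a Hilbert space, so the sup norm on `H × K` is replaced by the equivalent
  -- `L²` product norm.
  set e := WithLp.prodContinuousLinearEquiv 2 ℝ H K
  set Λ : Submodule ℝ (H × K) := Γ ⊓ LinearMap.ker ((innerₛₗ ℝ o) ∘ₗ LinearMap.fst ℝ H K) with hΛ
  have hΛm : ∀ q : H × K, q ∈ Λ ↔ q ∈ Γ ∧ ⟪o, q.1⟫_ℝ = 0 := fun q => by simp [hΛ]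
  have hΛc : IsClosed (Λ : Set (H × K)) := by
    have : (Λ : Set (H × K)) = (Γ : Set (H × K)) ∩ {q | ⟪o, q.1⟫_ℝ = 0} := by ext q; simp [hΛm]
    rw [this]
    exact hΓ.inter (isClosed_eq (by fun_prop) continuous_const)
  set W : Submodule ℝ (WithLp 2 (H × K)) := Λ.comap (e : WithLp 2 (H × K) →ₗ[ℝ] H × K) with hW
  have hWc : IsClosed (W : Set (WithLp 2 (H × K))) := hΛc.preimage e.continuous
  have : CompleteSpace W := hWc.completeSpace_coe
  set S1 : W →L[ℝ] H := (ContinuousLinearMap.fst ℝ H K).comp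
    ((e : WithLp 2 (H × K) →L[ℝ] H × K).comp W.subtypeL)
  set S2 : W →L[ℝ] K := (ContinuousLinearMap.snd ℝ H K).comp
    ((e : WithLp 2 (H × K) →L[ℝ] H × K).comp W.subtypeL)
  set B1 : H →L[ℝ] H →L[ℝ] ℝ := (isBoundedBilinearMap_inner (𝕜 := ℝ)).toContinuousLinearMap
  set B2 : K →L[ℝ] K →L[ℝ] ℝ := (isBoundedBilinearMap_inner (𝕜 := ℝ)).toContinuousLinearMap
  set B : W →L[ℝ] W →L[ℝ] ℝ := B2.bilinearComp S2 S2 - t • B1.bilinearComp S1 S1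
  have hB : ∀ v w, B v w = ⟪S2 v, S2 w⟫_ℝ - t * ⟪S1 v, S1 w⟫_ℝ := fun v w => rfl
  have hmem : ∀ w : W, (S1 w, S2 w) ∈ Γ ∧ ⟪o, S1 w⟫_ℝ = 0 := fun w => (hΛm _).1 w.2
  have hn : ∀ w : W, ‖w‖ ^ 2 = ‖S1 w‖ ^ 2 + ‖S2 w‖ ^ 2 := fun w =>
    WithLp.prod_norm_sq_eq_of_L2 (w : WithLp 2 (H × K))
  have hco : IsCoercive B := by
    have hlt : 0 < l - t := sub_pos.2 ht
    have hl1 : 0 < 1 + l := by linarith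
    -- Keep a fraction `c` of the energy and spend `1 - c` of it on the gap bound: the coefficient
    -- of `‖S1 w‖²` becomes `(1 - c) l - t`, which is at least `c` exactly when `c (1 + l) ≤ l - t`.
    refine ⟨min 1 ((l - t) / (1 + l)), lt_min one_pos (div_pos hlt hl1), fun w => ?_⟩
    set c := min 1 ((l - t) / (1 + l))
    have hc1 : c ≤ 1 := min_le_left _ _
    have hc2 : c * (1 + l) ≤ l - t := (le_div_iff₀ hl1).1 (min_le_right _ _)
    have h1 := hl _ (hmem w).1 (hmem w).2
    rw [mul_assoc, ← sq, hn, hB, real_inner_self_eq_norm_sq, real_inner_self_eq_norm_sq]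
    simp only at h1
    have h2 := mul_le_mul_of_nonneg_left h1 (sub_nonneg.2 hc1)
    have h3 := mul_le_mul_of_nonneg_right hc2 (sq_nonneg ‖S1 w‖)
    linarith
  set L : W →L[ℝ] ℝ := (B1 h).comp S1
  set r := (InnerProductSpace.toDual ℝ W).symm L
  set v := hco.continuousLinearEquivOfBilin.symm r
  have hv : ∀ w, B v w = ⟪h, S1 w⟫_ℝ := fun w => by
    rw [← hco.continuousLinearEquivOfBilin_apply, ContinuousLinearEquiv.apply_symm_apply,
      InnerProductSpace.toDual_symm_apply]
    rfl
  refine ⟨(S1 v, S2 v), (hmem v).1, (hmem v).2, fun q hq hq0 => ?_⟩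
  exact hv ⟨e.symm q, by
    rw [hW, Submodule.mem_comap]
    simpa using (hΛm q).2 ⟨hq, hq0⟩⟩

theorem IsGapBound.notMem_opSpectrum [CompleteSpace H] [CompleteSpace K]
    (hl : IsGapBound Γ o l) (hT : IsFormOperator Γ T) (hΓ : IsClosed (Γ : Set (H × K)))
    (ho : ‖o‖ = 1) (hoΓ : (o, 0) ∈ Γ) (hl0 : 0 < l) (ht : t < l) (ht0 : t ≠ 0) :
    t ∉ opSpectrum T := by
  have hoo : ⟪o, o⟫_ℝ = 1 := by rw [real_inner_self_eq_norm_sq, ho, one_pow]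
  rw [notMem_opSpectrum_iff]
  constructor
  · intro x hx
    obtain ⟨G, hG, hq⟩ := (hT _ _).1 hx
    -- Testing against the ground state forces an eigenvector with eigenvalue `t ≠ 0` to be
    -- orthogonal to `o`.
    have h1 := hq _ hoΓ
    simp only [inner_zero_right, real_inner_smul_left] at h1
    have h2 : ⟪o, x⟫_ℝ = 0 := by
      rw [real_inner_comm]
      exact (mul_eq_zero.1 h1.symm).resolve_left ht0
    have h3 := hl _ hG h2
    have h4 := hq _ hG
    simp only [real_inner_smul_left, real_inner_self_eq_norm_sq] at h3 h4
    have h5 : ‖x‖ ^ 2 ≤ 0 := by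
      by_contra! hc
      nlinarith
    exact norm_eq_zero.1 (pow_eq_zero_iff two_ne_zero |>.1 (le_antisymm h5 (sq_nonneg _)))
  · intro h
    set m := ⟪o, h⟫_ℝ with hm
    obtain ⟨u, hu, hu0, hq⟩ := hl.exists_solution hΓ hl0 ht (h - m • o)
    -- On the line of `o` the operator `T - t` is multiplication by `-t`, so the component `m • o`
    -- of `h` has preimage `-(m / t) • o`; `u` handles the rest.
    refine ⟨u.1 - (m / t) • o, (hT _ _).2 ⟨u.2, ?_, fun q hqΓ => ?_⟩⟩
    · have := Γ.sub_mem hu (Γ.smul_mem (m / t) hoΓ)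
      have e : u - (m / t) • (o, (0 : K)) = (u.1 - (m / t) • o, u.2) := by
        ext <;> simp
      rwa [e] at this
    · have hq' := hq (q - ⟪o, q.1⟫_ℝ • (o, 0)) (Γ.sub_mem hqΓ (Γ.smul_mem _ hoΓ)) (by
        simp [inner_sub_right, real_inner_smul_right, ho])
      have huo : ⟪u.1, o⟫_ℝ = 0 := by rw [real_inner_comm]; exact hu0
      have hho : ⟪h, o⟫_ℝ = m := by rw [real_inner_comm]
      simp only [Prod.fst_sub, Prod.snd_sub, Prod.smul_fst, Prod.smul_snd, smul_zero, sub_zero,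
        inner_sub_right, inner_sub_left, real_inner_smul_left, real_inner_smul_right, hoo, huo,
        hho] at hq'
      have e : h + t • (u.1 - (m / t) • o) = h - m • o + t • u.1 := by
        rw [smul_sub, smul_smul, mul_div_cancel₀ _ ht0]; abel
      rw [e, inner_add_left, inner_sub_left, real_inner_smul_left, real_inner_smul_left]
      linarith

/-- The infimum of the form over the unit sphere of the mean-zero form domain is spectral. -/
theorem IsGapBound.mem_opSpectrum [CompleteSpace H] (hl : IsGapBound Γ o l)
    (hT : IsFormOperator Γ T) (hoΓ : (o, 0) ∈ Γ) (hl0 : 0 < l)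
    (hmin : ∀ ε > 0, ∃ p ∈ Γ, ⟪o, p.1⟫_ℝ = 0 ∧ ‖p.1‖ = 1 ∧ ‖p.2‖ ^ 2 < l + ε) :
    l ∈ opSpectrum T := by
  by_contra hc
  rw [opSpectrum, Set.mem_ofPred_eq, not_not] at hc
  set A : T.domain →ₗ[ℝ] H := T.toFun - l • T.domain.subtype with hA
  have hAb : Function.Bijective A := hc
  set S : H →ₗ[ℝ] H := T.domain.subtype ∘ₗ (LinearEquiv.ofBijective A hAb).symm.toLinearMap
  have hS : ∀ h, ∃ G, (S h, G) ∈ Γ ∧ ∀ q ∈ Γ, ⟪G, q.2⟫_ℝ = ⟪h, q.1⟫_ℝ + l * ⟪S h, q.1⟫_ℝ := by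
    intro h
    set y := (LinearEquiv.ofBijective A hAb).symm h with hy
    have h1 : A y = h := (LinearEquiv.ofBijective A hAb).apply_symm_apply h
    have h2 : T y = h + l • S h := sub_eq_iff_eq_add.1 h1
    have h3 : (S h, h + l • S h) ∈ T.graph := by rw [← h2]; exact T.mem_graph y
    obtain ⟨G, hG, hq⟩ := (hT _ _).1 h3
    exact ⟨G, hG, fun q hqΓ => by rw [hq q hqΓ, inner_add_left, real_inner_smul_left]⟩
  -- The inverse is symmetric and defined everywhere, hence bounded by Hellinger–Toeplitz.
  have hsym : S.IsSymmetric := by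
    intro h k
    obtain ⟨G, hG, hq⟩ := hS h
    obtain ⟨G', hG', hq'⟩ := hS k
    have h1 := hq _ hG'
    have h2 := hq' _ hG
    simp only at h1 h2
    rw [real_inner_comm] at h1
    rw [real_inner_comm (S h) (S k)] at h2
    rw [real_inner_comm]
    linarith
  set S' : H →L[ℝ] H := ⟨S, hsym.continuous⟩
  set C := ‖S'‖ + 1
  have hC0 : 0 < C := by positivity
  -- Let `b` be the form minus `l` times the inner product. Then `b(S p, p) = 1` and `b(S p, S p) =
  -- ⟪p, S p⟫ ≤ C`, so `b` at `p - C⁻¹ S p` is at most `b(p, p) - C⁻¹ < 0`, contradicting the gap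
  -- bound.
  obtain ⟨p, hp, hp0, hp1, hpl⟩ := hmin C⁻¹ (inv_pos.2 hC0)
  obtain ⟨G, hG, hq⟩ := hS p.1
  have hg0 : ⟪o, S p.1⟫_ℝ = 0 := by
    have h1 := hq _ hoΓ
    simp only [inner_zero_right] at h1
    rw [real_inner_comm, hp0, zero_add, real_inner_comm] at h1
    exact (mul_eq_zero.1 h1.symm).resolve_left hl0.ne'
  have hgg : ‖G‖ ^ 2 - l * ‖S p.1‖ ^ 2 ≤ C := by
    have h1 := hq _ hG
    simp only [real_inner_self_eq_norm_sq] at h1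
    have h2 := real_inner_le_norm p.1 (S p.1)
    have h3 : ‖S p.1‖ ≤ ‖S'‖ * ‖p.1‖ := S'.le_opNorm p.1
    rw [hp1] at h2 h3
    simp only [C]
    linarith
  have hgp := hq _ hp
  rw [real_inner_self_eq_norm_sq, hp1] at hgp
  have hpos := hl (p - C⁻¹ • (S p.1, G)) (Γ.sub_mem hp (Γ.smul_mem _ hG)) (by
    simp [inner_sub_right, real_inner_smul_right, hp0, hg0])
  simp only [Prod.fst_sub, Prod.snd_sub, Prod.smul_fst, Prod.smul_snd] at hpos
  rw [norm_sub_sq_real, norm_sub_sq_real, real_inner_smul_right, real_inner_smul_right, norm_smul,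
    norm_smul, mul_pow, mul_pow, Real.norm_eq_abs, sq_abs, hp1, real_inner_comm (S p.1),
    real_inner_comm G] at hpos
  have h4 := mul_le_mul_of_nonneg_left hgg (sq_nonneg C⁻¹)
  have h5 : C⁻¹ ^ 2 * C = C⁻¹ := by field_simp
  have h6 := inv_pos.2 hC0
  rw [h5] at h4
  nlinarith

/-- The gap is the infimum of the energy over unit vectors orthogonal to `o`, whether or not it is
attained. The bound `κ > 0` keeps this infimum away from the spectral value `0`; since it lies in
the spectrum, no larger threshold is admissible. -/
theorem exists_isSpectralGap [CompleteSpace H] [CompleteSpace K] (hT : IsFormOperator Γ T)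
    (hΓ : IsClosed (Γ : Set (H × K))) (ho : ‖o‖ = 1) (hoΓ : (o, 0) ∈ Γ) {κ : ℝ} (hκ : 0 < κ)
    (hκΓ : IsGapBound Γ o κ) (hne : ∃ p ∈ Γ, ⟪o, p.1⟫_ℝ = 0 ∧ p.1 ≠ 0) :
    ∃ l, IsSpectralGap T l ∧ κ ≤ l ∧ IsGapBound Γ o l := by
  set R : Set ℝ := {s | ∃ p ∈ Γ, ⟪o, p.1⟫_ℝ = 0 ∧ ‖p.1‖ = 1 ∧ ‖p.2‖ ^ 2 = s} with hR
  have hnorm : ∀ p ∈ Γ, ⟪o, p.1⟫_ℝ = 0 → p.1 ≠ 0 → (‖p.1‖⁻¹ ^ 2 * ‖p.2‖ ^ 2) ∈ R := by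
    intro p hp hp0 hpne
    refine ⟨‖p.1‖⁻¹ • p, Γ.smul_mem _ hp, ?_, ?_, ?_⟩
    · simp [real_inner_smul_right, hp0]
    · simp [norm_smul, hpne]
    · simp [norm_smul, mul_pow]
  have hRne : R.Nonempty := by
    obtain ⟨p, hp, hp0, hpne⟩ := hne
    exact ⟨_, hnorm p hp hp0 hpne⟩
  have hlow : ∀ s ∈ R, κ ≤ s := by
    rintro s ⟨p, hp, hp0, hp1, rfl⟩
    have := hκΓ p hp hp0
    rwa [hp1, one_pow, mul_one] at this
  have hbdd : BddBelow R := ⟨κ, hlow⟩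
  have hκl : κ ≤ sInf R := le_csInf hRne hlow
  have hl0 : 0 < sInf R := hκ.trans_le hκl
  have hgap : IsGapBound Γ o (sInf R) := by
    intro p hp hp0
    by_cases hpne : p.1 = 0
    · rw [hpne]; simp
    · have h1 := csInf_le hbdd (hnorm p hp hp0 hpne)
      have h2 : 0 < ‖p.1‖ := norm_pos_iff.2 hpne
      rwa [inv_pow, ← div_eq_inv_mul, le_div_iff₀ (pow_pos h2 2)] at h1
  have hmem : sInf R ∈ opSpectrum T := by
    refine hgap.mem_opSpectrum hT hoΓ hl0 fun ε hε => ?_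
    obtain ⟨s, ⟨p, hp, hp0, hp1, rfl⟩, hs⟩ := Real.lt_sInf_add_pos hRne hε
    exact ⟨p, hp, hp0, hp1, hs⟩
  refine ⟨sInf R, ⟨fun t ht => ?_, fun s hs => ?_⟩, hκl, hgap⟩
  · by_contra hc
    rw [mem_union, mem_singleton_iff, mem_Ici, not_or, not_le] at hc
    exact hgap.notMem_opSpectrum hT hΓ ho hoΓ hl0 hc.2 hc.1 ht
  · rcases hs hmem with h | h
    · exact absurd h hl0.ne'
    · exact h

end Abstract

/-! ### The ground state and the coordinate functions -/

section TestElements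

variable {n : ℕ} {V : ℝ → ℝ} {c : ℝ} {μ : Measure (EuclideanSpace ℝ (Fin n))}

theorem isFormOperator_negGenerator (μ : Measure (EuclideanSpace ℝ (Fin n))) [IsFiniteMeasure μ] :
    IsFormOperator (formGraph μ) (negGenerator μ) := fun f h => by
  rw [negGenerator_graph]; rfl

namespace IsRadialMeasure

theorem one_mem_formGraph (h : IsRadialMeasure V c μ) [IsFiniteMeasure μ] :
    ((memLp_const (1 : ℝ)).toLp (fun _ => (1 : ℝ)), 0) ∈ formGraph μ := by
  have hg : gradient (fun _ : EuclideanSpace ℝ (Fin n) => (1 : ℝ)) = fun _ => 0 := by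
    ext1 x; simp [gradient]
  have hG : MemLp (gradient (fun _ : EuclideanSpace ℝ (Fin n) => (1 : ℝ))) 2 μ := by
    rw [hg]; exact memLp_const 0
  have h1 := h.mem_formGraph (f := fun _ => 1) contDiff_const (memLp_const 1) hG (C := 1)
    fun x => by linarith [sq_nonneg ‖x‖]
  have h2 : hG.toLp _ = 0 := by
    rw [← norm_eq_zero, ← sq_eq_zero_iff, norm_toLp_sq, hg]
    simp
  rwa [h2] at h1

theorem norm_one_toLp [IsProbabilityMeasure μ] :
    ‖(memLp_const (μ := μ) (p := 2) (1 : ℝ)).toLp (fun _ => (1 : ℝ))‖ = 1 := by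
  have h := norm_toLp_sq (memLp_const (μ := μ) (p := 2) (1 : ℝ))
  simp only [norm_one, one_pow, integral_const, probReal_univ, smul_eq_mul, mul_one] at h
  exact (pow_eq_one_iff_of_nonneg (norm_nonneg _) two_ne_zero).1 h

theorem gradient_coord (i : Fin n) :
    gradient (fun x : EuclideanSpace ℝ (Fin n) => x i) =
      fun _ => EuclideanSpace.single i (1 : ℝ) := by
  ext1 x
  have e : (fun x : EuclideanSpace ℝ (Fin n) => x i) =
      fun x => ⟪EuclideanSpace.single i (1 : ℝ), x⟫_ℝ := by
    ext x; rw [EuclideanSpace.inner_single_left]; simp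
  have hd : HasFDerivAt (fun x : EuclideanSpace ℝ (Fin n) => x i)
      (InnerProductSpace.toDual ℝ _ (EuclideanSpace.single i (1 : ℝ))) x := by
    rw [e]
    exact (InnerProductSpace.toDual ℝ _ (EuclideanSpace.single i (1 : ℝ))).hasFDerivAt
  rw [gradient, hd.fderiv, LinearIsometryEquiv.symm_apply_apply]

theorem sq_coord_le (i : Fin n) (x : EuclideanSpace ℝ (Fin n)) : x i ^ 2 ≤ ‖x‖ ^ 2 := by
  rw [EuclideanSpace.real_norm_sq_eq]
  exact Finset.single_le_sum (f := fun j => x j ^ 2) (fun j _ => sq_nonneg _) (Finset.mem_univ i)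

theorem integrable_sq_coord (h : IsRadialMeasure V c μ) (i : Fin n) :
    Integrable (fun x => x i ^ 2) μ :=
  h.integrable_norm_sq.mono' (Continuous.aestronglyMeasurable (by fun_prop))
    (Eventually.of_forall fun x => by
      rw [Real.norm_of_nonneg (sq_nonneg _)]; exact sq_coord_le i x)

theorem memLp_coord (h : IsRadialMeasure V c μ) (i : Fin n) : MemLp (fun x => x i) 2 μ :=
  (memLp_two_iff_integrable_sq (Continuous.aestronglyMeasurable (by fun_prop))).2
    (h.integrable_sq_coord i)

theorem memLp_gradient_coord [IsFiniteMeasure μ] (i : Fin n) :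
    MemLp (gradient fun x : EuclideanSpace ℝ (Fin n) => x i) 2 μ := by
  rw [gradient_coord]; exact memLp_const _

theorem coord_mem_formGraph (h : IsRadialMeasure V c μ) [IsFiniteMeasure μ] (i : Fin n) :
    ((h.memLp_coord i).toLp _, (memLp_gradient_coord i).toLp _) ∈ formGraph μ :=
  h.mem_formGraph (by fun_prop) _ _ (C := 1) fun x => by
    have := sq_coord_le i x; linarith

theorem integral_coord (h : IsRadialMeasure V c μ) (i : Fin n) : ∫ x, x i ∂μ = 0 := by
  rw [h.integral_eq]
  have h1 := integral_neg_eq_self (fun x : EuclideanSpace ℝ (Fin n) => x i * Real.exp (-V ‖x‖))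
    volume
  simp only [PiLp.neg_apply, norm_neg, neg_mul, integral_neg] at h1
  rw [show ∫ x : EuclideanSpace ℝ (Fin n), x i * Real.exp (-V ‖x‖) = 0 by linarith, mul_zero]

theorem sum_integral_sq_coord (h : IsRadialMeasure V c μ) :
    ∑ i, ∫ x, x i ^ 2 ∂μ = ∫ x, ‖x‖ ^ 2 ∂μ := by
  rw [← integral_finsetSum _ fun i _ => h.integrable_sq_coord i]
  congr 1; ext x
  rw [EuclideanSpace.real_norm_sq_eq]

theorem inner_one_coord (h : IsRadialMeasure V c μ) [IsFiniteMeasure μ] (i : Fin n) :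
    ⟪(memLp_const (1 : ℝ)).toLp (fun _ => (1 : ℝ)), (h.memLp_coord i).toLp _⟫_ℝ = 0 := by
  rw [inner_toLp]
  refine Eq.trans ?_ (h.integral_coord i)
  congr 1; ext x; simp

theorem norm_sq_coord (h : IsRadialMeasure V c μ) (i : Fin n) :
    ‖(h.memLp_coord i).toLp _‖ ^ 2 = ∫ x, x i ^ 2 ∂μ := by
  rw [norm_toLp_sq]; simp

theorem norm_sq_gradient_coord [IsProbabilityMeasure μ] (i : Fin n) :
    ‖(memLp_gradient_coord (μ := μ) i).toLp _‖ ^ 2 = 1 := by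
  rw [norm_toLp_sq, gradient_coord]; simp

/-- The two-sided bound on the spectral gap. -/
theorem exists_isSpectralGap (h : IsRadialMeasure V c μ) :
    ∃ l, IsSpectralGap (negGenerator μ) l ∧ ((n : ℝ) - 1) / ∫ x, ‖x‖ ^ 2 ∂μ ≤ l ∧
      l ≤ (n : ℝ) / ∫ x, ‖x‖ ^ 2 ∂μ := by
  have := h.prob
  have hm := h.integral_norm_sq_pos
  have hn : (2 : ℝ) ≤ n := by
    have := h.two_le
    rw [finrank_euclideanSpace_fin] at this
    exact_mod_cast this
  have hκ : 0 < ((n : ℝ) - 1) / ∫ x, ‖x‖ ^ 2 ∂μ := div_pos (by linarith) hm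
  -- The squared norms of the coordinates add up to the second moment, which is positive; some
  -- coordinate therefore shows that the mean-zero part of the form domain is nontrivial.
  have hne : ∃ i : Fin n, (h.memLp_coord i).toLp _ ≠ 0 := by
    by_contra! hz
    have h1 := h.sum_integral_sq_coord
    simp only [← h.norm_sq_coord, hz] at h1
    simp at h1
    linarith
  obtain ⟨i, hi⟩ := hne
  obtain ⟨l, hl, hκl, hb⟩ := RadialGap.exists_isSpectralGap (isFormOperator_negGenerator μ)
    (testGradientGraph μ).isClosed_topologicalClosure norm_one_toLp h.one_mem_formGraph hκ
    (fun p hp hp0 => by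
      have h1 := h.poincare (memLp_const (1 : ℝ)).coeFn_toLp hp
      rw [hp0] at h1
      rw [div_mul_eq_mul_div, div_le_iff₀ hm]
      linarith)
    ⟨_, h.coord_mem_formGraph i, h.inner_one_coord i, hi⟩
  refine ⟨l, hl, hκl, ?_⟩
  rw [le_div_iff₀ hm, ← h.sum_integral_sq_coord, Finset.mul_sum]
  calc ∑ i, l * ∫ x, x i ^ 2 ∂μ ≤ ∑ _i : Fin n, (1 : ℝ) := by
        refine Finset.sum_le_sum fun i _ => ?_
        have := hb _ (h.coord_mem_formGraph i) (h.inner_one_coord i)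
        simpa only [h.norm_sq_coord, norm_sq_gradient_coord] using this
    _ = n := by simp

end IsRadialMeasure
end TestElements
end RadialGap

theorem theorem2 (n : ℕ) (hn : 2 ≤ n) (V : ℝ → ℝ)
    (hVconv : ConvexOn ℝ (Set.Ioi 0) V) (hVsmooth : ContDiffOn ℝ ∞ V (Set.Ioi 0))
    (μ : MeasureTheory.Measure (EuclideanSpace ℝ (Fin n)))
    [MeasureTheory.IsProbabilityMeasure μ]
    (hμ : ∃ c : ℝ, μ = (MeasureTheory.volume : MeasureTheory.Measure
      (EuclideanSpace ℝ (Fin n))).withDensity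
        (fun x => ENNReal.ofReal (c * Real.exp (-V ‖x‖)))) :
    -- the self-adjoint operator `-L_μ` acts on test functions by the differential expression
    (∀ f : EuclideanSpace ℝ (Fin n) → ℝ, ∀ hf : RadialGap.IsTestFunction f,
      ∀ hLf : MeasureTheory.MemLp (RadialGap.diffusionExpr V f) 2 μ,
      ((hf.smooth.continuous.memLp_of_hasCompactSupport hf.compact).toLp f, -hLf.toLp _) ∈
        (RadialGap.negGenerator μ).graph) ∧
    -- the two-sided bound on its spectral gap
    MeasureTheory.Integrable (fun x => ‖x‖ ^ 2) μ ∧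
    ∃ l : ℝ, RadialGap.IsSpectralGap (RadialGap.negGenerator μ) l ∧
      ((n : ℝ) - 1) / ∫ x, ‖x‖ ^ 2 ∂μ ≤ l ∧ l ≤ (n : ℝ) / ∫ x, ‖x‖ ^ 2 ∂μ := by
  obtain ⟨c, hμ⟩ := hμ
  have h : RadialGap.IsRadialMeasure V c μ :=
    .of_withDensity ⟨hVconv, hVsmooth⟩ (by rwa [finrank_euclideanSpace_fin]) hμ
  refine ⟨fun f hf hLf => ?_, h.integrable_norm_sq, h.exists_isSpectralGap⟩
  rw [RadialGap.negGenerator_graph]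
  exact h.mem_generatorGraph hf hLf
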